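/- Let $A$ be a finite-dimensional Hopf algebra over a field $k$, with antipode $S$ (which is then bijective); write $\Delta(a)=\sum a^{(1)}\otimes a^{(2)}$. A Hopf bimodule over $A$ is a $k$-vector space $M$ (of any dimension) which is an $A$-bimodule and an $A$-bicomodule, with coactions $\delta_L(m)=\sum m_{(-1)}\otimes m_{(0)}\in A\otimes M$ and $\delta_R(m)=\sum m_{(0)}\otimes m_{(1)}\in M\otimes A$, such that $\delta_L$ and $\delta_R$ are bimodule maps for the diagonal actions on $A\otimes M$ and $M\otimes A$. Morphisms are the linear maps commuting with both actions and both coactions; the space of morphisms is written $\mathrm{Hom}_{A4}(M,N)$. A sequence of Hopf bimodules is exact if it is exact as a sequence of vector spaces. **The algebra $X$.** The Cibils–Rosso algebra $X$ is the vector space $(A^{*op}\otimes A^*)\otimes(A\otimes A^{op})$, in which $A^{*op}\otimes A^*$ and $A\otimes A^{op}$ keep their natural multiplications, $[(l\otimes\kappa)\otimes 1]\,[1\otimes(a\otimes b)]=(l\otimes\kappa)\otimes(a\otimes b)$, and $$[1\otimes(a\otimes b)]\,[(l\otimes\kappa)\otimes 1]=\sum \bigl(l(Sa^{(1)}\,\cdot\,S^{-1}b^{(1)})\otimes\kappa(S^{-1}a^{(3)}\,\cdot\,Sb^{(3)})\bigr)\otimes(a^{(2)}\otimes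 b^{(2)}).$$ A Hopf bimodule $M$ is a left $X$-module by letting $(l\otimes\kappa)\otimes(a\otimes b)$ act as $m\mapsto\sum l\bigl((amb)_{(-1)}\bigr)\,\kappa\bigl((amb)_{(1)}\bigr)\,(amb)_{(0)}$. Let $\mathrm{Ext}_X^*(M,N)$ be the Ext groups in the category of all left $X$-modules. **Hopf bimodule cohomology.** For Hopf bimodules $M,N$ and $p,q\ge 0$, equip $M\otimes A^{\otimes q+1}$ with the standard actions (on $M$ from the left, on the last factor $A$ from the right) and the codiagonal coactions, and $A^{\otimes p+1}\otimes N$ with the diagonal actions and the standard coactions (by $\Delta$ of the first factor $A$ on the left, by $\delta_R$ of $N$ on the right). Put $K^{pq}(M,N)=\mathrm{Hom}_{A4}(M\otimes A^{\otimes q+1},A^{\otimes p+1}\otimes N)$, with differentials $d_h:K^{pq}\to K^{p,q+1}$, $\alpha\mapsto\alpha\circ\lambda$, and $d_c:K^{pq}\to K^{p+1,q}$, $\alpha\mapsto(-1)^q\rho\circ\alpha$, where $$\lambda(m\otimes a_0\otimes\dots\otimes a_{q+1})=ma_0\otimes a_1\otimes\dots\otimes a_{q+1}+\sum_{i=0}^{q}(-1)^{i+1}m\otimes\dots\otimes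 a_ia_{i+1}\otimes\dots\otimes a_{q+1},$$ $$\rho=\sum_{i=0}^{p}(-1)^i\Delta_i+(-1)^{p+1}\,1^{\otimes p+1}\otimes\delta_L^N:\ A^{\otimes p+1}\otimes N\to A^{\otimes p+2}\otimes N,$$ $\Delta_i$ being $\Delta$ applied to the $i$-th factor $A$ (counted from $0$). This is a double complex; $H_{A4}^*(M,N)$ denotes the cohomology of its total complex (differential $d_h+d_c$). **Theorem.** For all Hopf bimodules $M,N$ and all $n\geq 0$ one has $H_{A4}^n(M,N)\cong\mathrm{Ext}_X^n(M,N)$. More precisely: 1. The map sending $\beta\in\mathrm{Hom}_{A4}(M,N)$ to the class of the cocycle $m\otimes a\mapsto\delta_L(\beta(ma))$ of bidegree $(0,0)$ is a bijection $\mathrm{Hom}_{A4}(M,N)\to H_{A4}^0(M,N)$. 2. Fix $N$. For every short exact sequence $0\to M'\to M\to M''\to0$ of Hopf bimodules, the induced sequence of total complexes $0\to K(M'',N)\to K(M,N)\to K(M',N)\to 0$ is exact. With the resulting connecting maps, $H_{A4}^*(-,N)$ is a (contravariant) $\delta$-functor on Hopf bimodules, and so is $\mathrm{Ext}_X^*(-,N)$.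 There is a unique morphism of $\delta$-functors $H_{A4}^*(-,N)\to\mathrm{Ext}_X^*(-,N)$ which in degree $0$ is the identity of $\mathrm{Hom}_{A4}(-,N)$ (identified with $H^0_{A4}(-,N)$ by 1, and viewed in $\mathrm{Ext}^0_X=\mathrm{Hom}_X$), and it is an isomorphism in every degree. 3. The same holds in the other variable: for fixed $M$, short exact sequences in $N$ give short exact sequences of total complexes, $H_{A4}^*(M,-)$ and $\mathrm{Ext}_X^*(M,-)$ are $\delta$-functors, and there is a unique morphism of $\delta$-functors between them which is the identity of $\mathrm{Hom}_{A4}(M,-)$ in degree $0$; it is an isomorphism in every degree. -/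

import Mathlib

open TensorProduct Coalgebra CategoryTheory

universe u v w

namespace CRHopf
section Antipode
variable {k A : Type u} [Field k] [Ring A] [HopfAlgebra k A]
local notation "S" => HopfAlgebra.antipode k (A := A)
local notation "δ" => Coalgebra.comul (R := k) (A := A)

lemma comul_antipode (a : A) : δ (S a) = TensorProduct.map S S (TensorProduct.comm k A A (δ a)) := by
  let i₁ : A →ₗ[k] A ⊗[k] A := (TensorProduct.mk k A A).flip 1
  let i₂ : A →ₗ[k] A ⊗[k] A := TensorProduct.mk k A A 1
  have h1 : WithConv.toConv (i₁ ∘ₗ S) * WithConv.toConv i₁ = 1 := by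
    ext x
    rw [(ℛ k x).convMul_apply]
    simp [i₁, ← TensorProduct.sum_tmul, HopfAlgebra.sum_antipode_mul_eq_algebraMap_counit,
      Algebra.TensorProduct.algebraMap_apply]
  have h2 : WithConv.toConv (i₂ ∘ₗ S) * WithConv.toConv i₂ = 1 := by
    ext x
    rw [(ℛ k x).convMul_apply]
    simp [i₂, ← TensorProduct.tmul_sum, HopfAlgebra.sum_antipode_mul_eq_algebraMap_counit,
      Algebra.TensorProduct.one_def, Algebra.algebraMap_eq_smul_one]
  have h3 : WithConv.toConv i₁ * WithConv.toConv i₂ = WithConv.toConv δ := by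
    ext x
    rw [(ℛ k x).convMul_apply]
    simp [i₁, i₂, (ℛ k x).eq]
  have h4 : WithConv.toConv (i₂ ∘ₗ S) * WithConv.toConv (i₁ ∘ₗ S) =
      WithConv.toConv (TensorProduct.map S S ∘ₗ (TensorProduct.comm k A A).toLinearMap ∘ₗ δ) := by
    ext x
    rw [(ℛ k x).convMul_apply]
    simp [i₁, i₂, ← (ℛ k x).eq]
  have h5 : WithConv.toConv δ * WithConv.toConv (δ ∘ₗ S) = 1 := LinearMap.comul_right_inv
  have h6 : WithConv.toConv (TensorProduct.map S S ∘ₗ (TensorProduct.comm k A A).toLinearMap ∘ₗ δ)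
      * WithConv.toConv δ = 1 := by
    rw [← h4, ← h3, mul_assoc, ← mul_assoc (WithConv.toConv (i₁ ∘ₗ S)), h1, one_mul, h2]
  have h7 := left_inv_eq_right_inv h6 h5
  exact (congrArg (fun f => f.ofConv a) h7).symm

lemma comul_antipode_antipode (a : A) : δ (S (S a)) = TensorProduct.map (S ∘ₗ S) (S ∘ₗ S) (δ a) := by
  rw [comul_antipode, comul_antipode, ← (ℛ k a).eq]
  simp

/-- `a ↦ ∑ a₍₁₎ f(a₍₂₎)` -/
def hitR (f : A →ₗ[k] k) : A →ₗ[k] A := (TensorProduct.rid k A).toLinearMap ∘ₗ f.lTensor A ∘ₗ δ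
/-- `a ↦ ∑ f(a₍₁₎) a₍₂₎` -/
def hitL (f : A →ₗ[k] k) : A →ₗ[k] A := (TensorProduct.lid k A).toLinearMap ∘ₗ f.rTensor A ∘ₗ δ

lemma hitR_repr {ι : Type*} (f : A →ₗ[k] k) {a : A} (r : Coalgebra.Repr k a ι) :
    hitR f a = ∑ i ∈ r.index, f (r.right i) • r.left i := by
  simp [hitR, ← r.eq]

lemma hitL_repr {ι : Type*} (f : A →ₗ[k] k) {a : A} (r : Coalgebra.Repr k a ι) :
    hitL f a = ∑ i ∈ r.index, f (r.left i) • r.right i := by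
  simp [hitL, ← r.eq]

lemma comul_hitR (f : A →ₗ[k] k) (a : A) : δ (hitR f a) = (hitR f).lTensor A (δ a) := by
  let F : A ⊗[k] (A ⊗[k] A) →ₗ[k] A ⊗[k] A :=
    ((TensorProduct.rid k A).toLinearMap ∘ₗ f.lTensor A).lTensor A
  have h := congrArg F (Coalgebra.coassoc_apply (R := k) a)
  have h1 : ∀ t : A ⊗[k] A, F (LinearMap.lTensor A δ t) = (hitR f).lTensor A t := by
    intro t
    rw [← LinearMap.comp_apply, ← LinearMap.lTensor_comp]; rfl
  have h2 : ∀ (z : A ⊗[k] A) (y : A), F (TensorProduct.assoc k A A A (z ⊗ₜ y)) = f y • z := by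
    intro z y
    induction z with
    | zero => simp
    | add a b ha hb => simp only [TensorProduct.add_tmul, map_add, ha, hb, smul_add]
    | tmul a b => simp [F]
  rw [h1] at h
  rw [← h, hitR_repr f (ℛ k a)]
  conv_rhs => rw [← (ℛ k a).eq]
  simp [h2]

lemma hitL_hitL (f g : A →ₗ[k] k) (a : A) : hitL g (hitL f a) =
    TensorProduct.lid k A (((LinearMap.mul' k k ∘ₗ TensorProduct.map f g) ∘ₗ δ).rTensor A (δ a)) := by
  let F : A ⊗[k] (A ⊗[k] A) →ₗ[k] A :=
    (TensorProduct.lid k A).toLinearMap ∘ₗ TensorProduct.map f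
      ((TensorProduct.lid k A).toLinearMap ∘ₗ g.rTensor A)
  have h := congrArg F (Coalgebra.coassoc_apply (R := k) a)
  have h2 : ∀ (z : A ⊗[k] A) (y : A), F (TensorProduct.assoc k A A A (z ⊗ₜ y)) =
      LinearMap.mul' k k (TensorProduct.map f g z) • y := by
    intro z y
    induction z with
    | zero => simp
    | add a b ha hb => simp only [TensorProduct.add_tmul, map_add, ha, hb, add_smul]
    | tmul a b => simp [F, smul_smul, mul_comm]
  have h1 : ∀ t : A ⊗[k] A, F (LinearMap.lTensor A δ t) = hitL g (TensorProduct.lid k A (f.rTensor A t)) := by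
    intro t
    induction t with
    | zero => simp
    | add a b ha hb => simp only [map_add, ha, hb]
    | tmul a b => simp [F, hitL]
  rw [h1] at h
  change hitL g (TensorProduct.lid k A (f.rTensor A (δ a))) = _
  rw [← h, ← (ℛ k a).eq]
  simp [h2]

/-- `x ↦ (y ↦ hitR g (x S²(y)))`. -/
def intOp (g : A →ₗ[k] k) : A →ₗ[k] A →ₗ[k] A :=
  (LinearMap.mul k A).compr₂ (hitR g) |>.compl₂ (S ∘ₗ S)

lemma intOp_apply (g : A →ₗ[k] k) (x y : A) : intOp g x y = hitR g (x * S (S y)) := rfl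

/-- The integral on `A` built from a functional `g`. -/
noncomputable def integ (g : A →ₗ[k] k) : A →ₗ[k] k := LinearMap.trace k A ∘ₗ intOp g

lemma intOp_aux (g : A →ₗ[k] k) (x y : A) {ι : Type*} (r : Coalgebra.Repr k y ι) :
    ∑ i ∈ r.index, δ (intOp g x (r.right i)) * (S (r.left i) ⊗ₜ 1) =
      (hitR g).lTensor A (δ x * (1 ⊗ₜ S (S y))) := by
  let o : A ⊗[k] A →ₗ[k] (A ⊗[k] A)ᵐᵒᵖ := (MulOpposite.opLinearEquiv k).toLinearMap
  let i₁ : A →ₗ[k] A ⊗[k] A := (TensorProduct.mk k A A).flip 1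
  let V : A →ₗ[k] A ⊗[k] A := δ ∘ₗ intOp g x
  let U : A →ₗ[k] A ⊗[k] A := (hitR g).lTensor A ∘ₗ LinearMap.mulLeft k (δ x) ∘ₗ
    (TensorProduct.mk k A A 1) ∘ₗ S ∘ₗ S
  have h1 : WithConv.toConv (o ∘ₗ i₁ ∘ₗ S) * WithConv.toConv (o ∘ₗ i₁ ∘ₗ S ∘ₗ S) = 1 := by
    ext z
    rw [(ℛ k z).convMul_apply]
    simp only [LinearMap.comp_apply, o, i₁, LinearMap.flip_apply,
      TensorProduct.mk_apply, LinearEquiv.coe_coe, MulOpposite.coe_opLinearEquiv,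
      ← MulOpposite.op_mul, Algebra.TensorProduct.tmul_mul_tmul, mul_one,
      ← HopfAlgebra.antipode_mul_antidistrib]
    rw [← Finset.op_sum, ← TensorProduct.sum_tmul, ← map_sum,
      HopfAlgebra.sum_mul_antipode_eq_algebraMap_counit]
    rw [Algebra.algebraMap_eq_smul_one, map_smul, HopfAlgebra.antipode_one, ← TensorProduct.smul_tmul', ← Algebra.TensorProduct.one_def]
    simp [Algebra.algebraMap_eq_smul_one]
  have h2 : WithConv.toConv (o ∘ₗ i₁ ∘ₗ S ∘ₗ S) * WithConv.toConv (o ∘ₗ U) =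
      WithConv.toConv (o ∘ₗ V) := by
    ext z
    rw [(ℛ k z).convMul_apply]
    simp only [LinearMap.comp_apply, o, i₁, LinearMap.flip_apply,
      TensorProduct.mk_apply, LinearEquiv.coe_coe, MulOpposite.coe_opLinearEquiv,
      ← MulOpposite.op_mul, V, U, intOp_apply, comul_hitR, Bialgebra.comul_mul,
      comul_antipode_antipode]
    rw [← Finset.op_sum]
    congr 1
    conv_rhs => rw [← (ℛ k z).eq]
    simp only [map_sum, Finset.mul_sum, TensorProduct.map_tmul]
    refine Finset.sum_congr rfl fun i _ => ?_
    generalize δ x = t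
    induction t with
    | zero => simp
    | add a b ha hb =>
      simp only [LinearMap.mulLeft_apply, map_add, add_mul] at ha hb ⊢
      rw [ha, hb]
    | tmul a b => simp
  have h3 : WithConv.toConv (o ∘ₗ i₁ ∘ₗ S) * WithConv.toConv (o ∘ₗ V) =
      WithConv.toConv (o ∘ₗ U) := by
    rw [← h2, ← mul_assoc, h1, one_mul]
  have h4 := congrArg (fun f => f.ofConv y) h3
  have h5 := r.convMul_apply (WithConv.toConv (o ∘ₗ i₁ ∘ₗ S)) (WithConv.toConv (o ∘ₗ V))
  have h6 := h5.symm.trans h4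
  apply MulOpposite.op_injective
  rw [Finset.op_sum]
  exact h6


lemma sum_coord_mul_antipode [FiniteDimensional k A] (f : A →ₗ[k] k) (v : A) :
    ∑ j, hitL ((Module.finBasis k A).coord j)
      (hitL (f ∘ₗ LinearMap.mulRight k (S (Module.finBasis k A j))) v) = f 1 • v := by
  simp only [hitL_hitL]
  rw [← map_sum, ← LinearMap.sum_apply]
  have key : ∑ j, ((LinearMap.mul' k k ∘ₗ TensorProduct.map
      (f ∘ₗ LinearMap.mulRight k (S (Module.finBasis k A j)))
      ((Module.finBasis k A).coord j)) ∘ₗ δ).rTensor A =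
      ((f 1) • Coalgebra.counit (R := k) (A := A)).rTensor A := by
    have h : ∑ j, ((LinearMap.mul' k k ∘ₗ TensorProduct.map
      (f ∘ₗ LinearMap.mulRight k (S (Module.finBasis k A j)))
      ((Module.finBasis k A).coord j)) ∘ₗ δ) = (f 1) • Coalgebra.counit (R := k) (A := A) := by
      have h0 : ∀ t : A ⊗[k] A, ∑ j, LinearMap.mul' k k (TensorProduct.map
          (f ∘ₗ LinearMap.mulRight k (S (Module.finBasis k A j)))
          ((Module.finBasis k A).coord j) t) = f (LinearMap.mul' k A (LinearMap.lTensor A S t)) := by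
        intro t
        induction t with
        | zero => simp
        | add a b ha hb => simp only [map_add, Finset.sum_add_distrib, ha, hb]
        | tmul a b =>
          simp only [TensorProduct.map_tmul, LinearMap.mul'_apply, LinearMap.lTensor_tmul]
          conv_rhs => rw [← (Module.finBasis k A).sum_repr b]
          simp [-Module.Basis.sum_repr, map_sum, Finset.mul_sum, mul_comm]
      ext v
      simp only [LinearMap.sum_apply, LinearMap.comp_apply, h0]
      rw [HopfAlgebra.mul_antipode_lTensor_comul_apply, Algebra.algebraMap_eq_smul_one]
      simp [mul_comm]
    rw [← h]
    ext a b
    simp [TensorProduct.sum_tmul]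
  rw [key]
  have := congrArg (TensorProduct.lid k A) (Coalgebra.rTensor_counit_comul (R := k) v)
  rw [TensorProduct.lid_tmul, one_smul] at this
  rw [LinearMap.rTensor_smul, LinearMap.smul_apply, map_smul, this]

lemma integ_hitL [FiniteDimensional k A] (f g : A →ₗ[k] k) (x : A) :
    integ g (hitL f x) = f 1 * integ g x := by
  let N := intOp g x
  have h1 : intOp g (hitL f x) = ∑ j, hitL (f ∘ₗ LinearMap.mulRight k (S (Module.finBasis k A j)))
      ∘ₗ (N ∘ₗ hitL ((Module.finBasis k A).coord j)) := by
    ext y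
    have h2 := congrArg (fun t => TensorProduct.lid k A (f.rTensor A t))
      (intOp_aux g x y (ℛ k y))
    have h3 : TensorProduct.lid k A (f.rTensor A ((hitR g).lTensor A (δ x * (1 ⊗ₜ S (S y))))) =
        intOp g (hitL f x) y := by
      rw [hitL_repr f (ℛ k x), ← (ℛ k x).eq]
      simp [Finset.sum_mul, intOp_apply]
    have h4 : ∀ l r : A, TensorProduct.lid k A (f.rTensor A (δ r * (S l ⊗ₜ[k] (1 : A)))) =
        ∑ j, (Module.finBasis k A).coord j l •
          hitL (f ∘ₗ LinearMap.mulRight k (S (Module.finBasis k A j))) r := by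
      intro l r
      simp only [hitL_repr _ (ℛ k r)]
      conv_lhs => rw [← (ℛ k r).eq, ← (Module.finBasis k A).sum_repr l]
      simp only [map_sum, Finset.sum_mul, Finset.smul_sum, TensorProduct.sum_tmul,
        Finset.mul_sum]
      refine Finset.sum_congr rfl fun j _ => Finset.sum_congr rfl fun i _ => ?_
      simp [smul_smul]
    rw [← h3, ← h2]
    simp only [map_sum, h4, LinearMap.sum_apply, LinearMap.comp_apply]
    rw [Finset.sum_comm]
    refine Finset.sum_congr rfl fun j _ => ?_
    rw [hitL_repr _ (ℛ k y)]
    simp [N]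
  simp only [integ, LinearMap.comp_apply]
  rw [h1, map_sum]
  have h5 : ∀ a b : A →ₗ[k] k, LinearMap.trace k A (hitL a ∘ₗ (N ∘ₗ hitL b)) =
      LinearMap.trace k A (N ∘ₗ (hitL b ∘ₗ hitL a)) := by
    intro a b
    rw [LinearMap.trace_comp_comm', LinearMap.comp_assoc]
  simp only [h5]
  rw [← map_sum, ← smul_eq_mul, ← map_smul]
  congr 1
  ext v
  simp only [LinearMap.sum_apply, LinearMap.comp_apply]
  rw [← map_sum, sum_coord_mul_antipode, map_smul]
  rfl

end Antipode
end CRHopf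

namespace CRHopf
section Antipode
variable {k A : Type u} [Field k] [Ring A] [HopfAlgebra k A]
local notation "S" => HopfAlgebra.antipode k (A := A)
local notation "δ" => Coalgebra.comul (R := k) (A := A)

lemma hitR_comp_hitR (f g : A →ₗ[k] k) (z : A) :
    hitR ((WithConv.toConv f * WithConv.toConv g).ofConv) z =
      TensorProduct.rid k A (f.lTensor A (δ (hitR g z))) := by
  rw [comul_hitR]
  let F : A ⊗[k] (A ⊗[k] A) →ₗ[k] A :=
    (TensorProduct.rid k A).toLinearMap ∘ₗ (LinearMap.mul' k k ∘ₗ TensorProduct.map f g).lTensor A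
  have h := congrArg F (Coalgebra.coassoc_apply (R := k) z)
  have h1 : ∀ t : A ⊗[k] A, F (LinearMap.lTensor A δ t) =
      TensorProduct.rid k A (LinearMap.lTensor A
        ((WithConv.toConv f * WithConv.toConv g).ofConv) t) := by
    intro t
    induction t with
    | zero => simp
    | add a b ha hb => simp only [map_add, ha, hb]
    | tmul a b => simp [F]
  have h2 : ∀ (z : A ⊗[k] A) (y : A), F (TensorProduct.assoc k A A A (z ⊗ₜ y)) =
      g y • TensorProduct.rid k A (f.lTensor A z) := by
    intro z y
    induction z with
    | zero => simp
    | add a b ha hb => simp only [TensorProduct.add_tmul, map_add, ha, hb, smul_add]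
    | tmul a b => simp [F, smul_smul, mul_comm]
  have h3 : F (LinearMap.lTensor A δ (δ z)) =
    hitR ((WithConv.toConv f * WithConv.toConv g).ofConv) z := h1 _
  rw [← h3, ← h, ← comul_hitR, hitR_repr g (ℛ k z)]
  conv_lhs => rw [← (ℛ k z).eq]
  simp only [map_sum, LinearMap.rTensor_tmul, h2, map_smul]

lemma trace_tensor_eq_zero [FiniteDimensional k A] (J : A ⊗[k] A →ₗ[k] A ⊗[k] A)
    (h : ∀ (w : A) (φ : A →ₗ[k] k), LinearMap.trace k A
      ((TensorProduct.rid k A).toLinearMap ∘ₗ φ.lTensor A ∘ₗ J ∘ₗ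
        (TensorProduct.mk k A A).flip w) = 0) : LinearMap.trace k (A ⊗[k] A) J = 0 := by
  let b := Module.finBasis k A
  have hb : ∀ (i j) (t : A ⊗[k] A), (b.tensorProduct b).repr t (i, j) =
      b.repr (TensorProduct.rid k A ((b.coord j).lTensor A t)) i := by
    intro i j t
    induction t with
    | zero => simp
    | add a b ha hb => simp only [map_add, Finsupp.add_apply, ha, hb]
    | tmul x y => simp [mul_comm]
  rw [LinearMap.trace_eq_matrix_trace k (b.tensorProduct b), Matrix.trace,
    Fintype.sum_prod_type_right]
  refine Finset.sum_eq_zero fun j _ => ?_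
  have := h (b j) (b.coord j)
  rw [LinearMap.trace_eq_matrix_trace k b, Matrix.trace] at this
  rw [← this]
  refine Finset.sum_congr rfl fun i _ => ?_
  simp [LinearMap.toMatrix_apply, hb]

/-- `y ⊗ w ↦ ∑ y₍₁₎ ⊗ P(y₍₂₎) w` -/
def gal (P : A →ₗ[k] A) : A ⊗[k] A →ₗ[k] A ⊗[k] A :=
  (LinearMap.mul' k A).lTensor A ∘ₗ (TensorProduct.assoc k A A A).toLinearMap ∘ₗ
      LinearMap.rTensor A (P.lTensor A ∘ₗ δ)

lemma gal_tmul (P : A →ₗ[k] A) (y w : A) {ι : Type*} (r : Coalgebra.Repr k y ι) :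
    gal P (y ⊗ₜ w) = ∑ i ∈ r.index, r.left i ⊗ₜ (P (r.right i) * w) := by
  simp [gal, ← r.eq, TensorProduct.sum_tmul]

lemma gal_gal (P Q : A →ₗ[k] A) (t : A ⊗[k] A) :
    gal P (gal Q t) = gal (WithConv.toConv P * WithConv.toConv Q).ofConv t := by
  induction t with
  | zero => simp
  | add a b ha hb => simp only [map_add, ha, hb]
  | tmul y w =>
    let F : A ⊗[k] (A ⊗[k] A) →ₗ[k] A ⊗[k] A :=
      (LinearMap.mulRight k w ∘ₗ LinearMap.mul' k A ∘ₗ TensorProduct.map P Q).lTensor A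
    have h := congrArg F (Coalgebra.coassoc_apply (R := k) y)
    rw [← (ℛ k y).eq] at h
    have h2 : ∀ (x y : A), F (TensorProduct.assoc k A A A (δ x ⊗ₜ y)) =
        gal P (x ⊗ₜ (Q y * w)) := by
      intro x y
      rw [gal_tmul _ _ _ (ℛ k x), ← (ℛ k x).eq]
      simp [F, TensorProduct.sum_tmul, mul_assoc]
    simp only [map_sum, LinearMap.rTensor_tmul, LinearMap.lTensor_tmul, h2] at h
    rw [gal_tmul _ _ _ (ℛ k y), gal_tmul _ _ _ (ℛ k y), map_sum, h]
    simp [F]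

lemma gal_one (t : A ⊗[k] A) : gal (1 : WithConv (A →ₗ[k] A)).ofConv t = t := by
  induction t with
  | zero => simp
  | add a b ha hb => simp only [map_add, ha, hb]
  | tmul y w =>
    rw [gal_tmul _ _ _ (ℛ k y)]
    have h := Coalgebra.sum_tmul_counit_eq (ℛ k y)
    have h2 := congrArg (TensorProduct.rid k A) h
    simp only [map_sum, TensorProduct.rid_tmul, one_smul] at h2
    conv_rhs => rw [← h2]
    simp [TensorProduct.sum_tmul, TensorProduct.smul_tmul, Algebra.algebraMap_eq_smul_one]

lemma gal_antipode_comul (z : A) : gal S (δ z) = z ⊗ₜ 1 := by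
  have h : ∀ z : A, δ z = gal LinearMap.id (z ⊗ₜ 1) := by
    intro z
    rw [gal_tmul _ _ _ (ℛ k z)]
    conv_lhs => rw [← (ℛ k z).eq]
    simp
  rw [h, gal_gal, LinearMap.antipode_mul_id, gal_one]

lemma exists_integ_ne_zero [FiniteDimensional k A] : ∃ g : A →ₗ[k] k, integ g ≠ 0 := by
  by_contra! hg
  have hnt : (1 : A) ≠ 0 := by
    intro h
    have := congrArg (Coalgebra.counit (R := k)) h
    simp at this
  obtain ⟨g, hg1⟩ : ∃ g : A →ₗ[k] k, g 1 ≠ 0 := by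
    by_contra! h
    exact hnt ((Module.forall_dual_apply_eq_zero_iff k (1 : A)).1 h)
  -- J (y ⊗ w) = δ (T_g (S (S y * w)))
  let J : A ⊗[k] A →ₗ[k] A ⊗[k] A := δ ∘ₗ hitR g ∘ₗ S ∘ₗ LinearMap.mul' k A ∘ₗ LinearMap.rTensor A S
  have hJ : LinearMap.trace k (A ⊗[k] A) J = 0 := by
    apply trace_tensor_eq_zero
    intro w φ
    have h1 := congrArg (fun f => f (S w)) (hg ((WithConv.toConv φ * WithConv.toConv g).ofConv))
    simp only [integ, LinearMap.comp_apply, LinearMap.zero_apply] at h1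
    rw [← h1]
    congr 1
    ext y
    rw [intOp_apply, hitR_comp_hitR]
    simp [J, HopfAlgebra.antipode_mul_antidistrib]
  have hJ2 : J = J ∘ₗ gal LinearMap.id ∘ₗ gal S := by
    ext1
    ext y w
    simp only [LinearMap.comp_apply, TensorProduct.AlgebraTensorModule.curry_apply,
      LinearMap.restrictScalars_self, TensorProduct.curry_apply, gal_gal,
      LinearMap.id_mul_antipode, gal_one]
  have hJ3 : gal S ∘ₗ J ∘ₗ gal LinearMap.id =
      ((TensorProduct.mk k A A).flip 1 ∘ₗ hitR g ∘ₗ S) ∘ₗ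
        ((TensorProduct.lid k A).toLinearMap ∘ₗ LinearMap.rTensor A (Coalgebra.counit (R := k))) := by
    ext1
    ext y w
    have : LinearMap.mul' k A (LinearMap.rTensor A S (gal LinearMap.id (y ⊗ₜ w))) =
        Coalgebra.counit (R := k) y • w := by
      rw [gal_tmul _ _ _ (ℛ k y)]
      simp only [map_sum, LinearMap.rTensor_tmul, LinearMap.mul'_apply, LinearMap.id_apply,
        ← mul_assoc]
      rw [← Finset.sum_mul, HopfAlgebra.sum_antipode_mul_eq_smul, smul_mul_assoc, one_mul]
    simp only [LinearMap.comp_apply, TensorProduct.AlgebraTensorModule.curry_apply,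
      LinearMap.restrictScalars_self, TensorProduct.curry_apply, J, this, gal_antipode_comul]
    simp [TensorProduct.smul_tmul']
  have h4 : LinearMap.trace k (A ⊗[k] A) J = g 1 := by
    rw [hJ2, ← LinearMap.comp_assoc, LinearMap.trace_comp_comm', hJ3, LinearMap.trace_comp_comm']
    have : ((TensorProduct.lid k A).toLinearMap ∘ₗ LinearMap.rTensor A (Coalgebra.counit (R := k)))
        ∘ₗ ((TensorProduct.mk k A A).flip 1 ∘ₗ hitR g ∘ₗ S) = (g ∘ₗ S).smulRight 1 := by
      ext w
      have h5 : Coalgebra.counit (R := k) (hitR g (S w)) = g (S w) := by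
        rw [hitR_repr g (ℛ k (S w))]
        have := congrArg g (Coalgebra.sum_counit_smul (ℛ k (S w)))
        simp only [map_sum, map_smul, smul_eq_mul] at this ⊢
        rw [← this]
        exact Finset.sum_congr rfl fun i _ => mul_comm _ _
      simp [h5]
    rw [this, LinearMap.trace_smulRight]
    simp
  exact hg1 (h4.symm.trans hJ)

/-- In a finite-dimensional Hopf algebra the antipode is injective. -/
lemma antipode_injective [FiniteDimensional k A] : Function.Injective S := by
  rw [← LinearMap.ker_eq_bot, LinearMap.ker_eq_bot']
  intro h hh
  obtain ⟨g, hg⟩ := exists_integ_ne_zero (k := k) (A := A)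
  obtain ⟨x, hx⟩ : ∃ x, integ g x ≠ 0 := by
    by_contra! hc
    exact hg (LinearMap.ext hc)
  set l := integ g with hl
  have hint : ∀ x : A, hitR l x = l x • 1 := by
    intro x
    rw [← sub_eq_zero, ← Module.forall_dual_apply_eq_zero_iff k]
    intro f
    have := integ_hitL f g x
    rw [hitL_repr f (ℛ k x)] at this
    rw [hitR_repr l (ℛ k x), map_sub, sub_eq_zero]
    simp only [map_sum, map_smul, smul_eq_mul, ← hl] at this ⊢
    rw [mul_comm, ← this]
    exact Finset.sum_congr rfl fun i _ => mul_comm _ _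
  -- `κ a = l (· S(a))`
  let κ : A →ₗ[k] Module.Dual k A := (LinearMap.mul k A).flip.compr₂ l ∘ₗ S
  have hκ : ∀ a y, κ a y = l (y * S a) := fun a y => rfl
  have hA : κ.rTensor A (δ h) = 0 := by
    apply (dualTensorHomEquiv k A A).injective
    rw [map_zero]
    ext y
    let G : A →ₗ[k] A := (TensorProduct.rid k A).toLinearMap ∘ₗ LinearMap.lTensor A l ∘ₗ
      LinearMap.mulLeft k (δ y) ∘ₗ TensorProduct.mk k A A 1 ∘ₗ S
    let H : A →ₗ[k] A := hitR l ∘ₗ LinearMap.mulLeft k y ∘ₗ S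
    have h1 : WithConv.toConv G * WithConv.toConv S = WithConv.toConv H := by
      ext a
      rw [(ℛ k a).convMul_apply]
      simp only [G, H, LinearMap.comp_apply, hitR, LinearMap.mulLeft_apply, Bialgebra.comul_mul,
        comul_antipode, LinearEquiv.coe_coe]
      conv_rhs => rw [← (ℛ k a).eq]
      simp only [map_sum, TensorProduct.comm_tmul, TensorProduct.map_tmul, Finset.mul_sum]
      refine Finset.sum_congr rfl fun i _ => ?_
      simp only [TensorProduct.mk_apply]
      generalize δ y = t
      induction t with
      | zero => simp
      | add a b ha hb => simp only [map_add, add_mul, ha, hb]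
      | tmul a b => simp
    have h2 : WithConv.toConv H * WithConv.toConv LinearMap.id = WithConv.toConv G := by
      rw [← h1, mul_assoc, LinearMap.antipode_mul_id, mul_one]
    have h3 := congrArg (fun f => f.ofConv h) h2
    have h4 := (ℛ k h).convMul_apply (WithConv.toConv H) (WithConv.toConv LinearMap.id)
    have h5 := h4.symm.trans h3
    rw [← (ℛ k h).eq]
    have h6 : G h = 0 := by simp [G, hh]
    refine Eq.trans ?_ (h5.trans h6)
    simp [H, hint, hκ]
  let Φ : Module.Dual k A ⊗[k] A →ₗ[k] A :=
    (TensorProduct.lid k A).toLinearMap ∘ₗ LinearMap.rTensor A (contractLeft k A) ∘ₗ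
      (TensorProduct.assoc k _ _ _).symm.toLinearMap ∘ₗ
      LinearMap.lTensor (Module.Dual k A) (LinearMap.rTensor A (LinearMap.mulLeft k x ∘ₗ S ∘ₗ S) ∘ₗ δ)
  have hB : Φ (κ.rTensor A (δ h)) = l x • h := by
    let F : A ⊗[k] (A ⊗[k] A) →ₗ[k] A :=
      (TensorProduct.lid k A).toLinearMap ∘ₗ LinearMap.rTensor A
        (l ∘ₗ LinearMap.mulLeft k x ∘ₗ S ∘ₗ LinearMap.mul' k A ∘ₗ LinearMap.lTensor A S) ∘ₗ
        (TensorProduct.assoc k _ _ _).symm.toLinearMap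
    have h1 := congrArg F (Coalgebra.coassoc_apply (R := k) h)
    have h2 : ∀ t : A ⊗[k] A, Φ (κ.rTensor A t) = F (LinearMap.lTensor A δ t) := by
      intro t
      induction t with
      | zero => simp
      | add a b ha hb => simp only [map_add, ha, hb]
      | tmul a b =>
        simp only [Φ, F, LinearMap.rTensor_tmul, LinearMap.comp_apply, LinearMap.lTensor_tmul,
          LinearEquiv.coe_coe]
        rw [← (ℛ k b).eq]
        simp [TensorProduct.tmul_sum, hκ, HopfAlgebra.antipode_mul_antidistrib, mul_assoc]
    rw [h2, ← h1]
    simp only [F, LinearMap.comp_apply, LinearEquiv.coe_coe, LinearEquiv.symm_apply_apply]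
    have h3 := Coalgebra.sum_counit_smul (ℛ k h)
    conv_rhs => rw [← h3]
    conv_lhs => rw [← (ℛ k h).eq]
    simp [HopfAlgebra.mul_antipode_lTensor_comul_apply, Finset.smul_sum, smul_smul,
      Algebra.algebraMap_eq_smul_one, mul_comm]
  rw [hA, map_zero] at hB
  exact (smul_eq_zero.1 hB.symm).resolve_left hx

variable (k A) in
/-- The inverse of the antipode. -/
noncomputable def antipodeInv [FiniteDimensional k A] : A →ₗ[k] A :=
  (LinearEquiv.ofInjectiveEndo S antipode_injective).symm.toLinearMap

variable [FiniteDimensional k A]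
local notation "S'" => antipodeInv k A

@[simp] lemma antipode_antipodeInv (a : A) : S (S' a) = a :=
  (LinearEquiv.ofInjectiveEndo S antipode_injective).apply_symm_apply a

@[simp] lemma antipodeInv_antipode (a : A) : S' (S a) = a :=
  (LinearEquiv.ofInjectiveEndo S antipode_injective).symm_apply_apply a

lemma antipodeInv_mul (a b : A) : S' (a * b) = S' b * S' a := by
  apply antipode_injective (k := k)
  simp [HopfAlgebra.antipode_mul_antidistrib]

@[simp] lemma antipodeInv_one : S' (1 : A) = 1 := by
  apply antipode_injective (k := k)
  simp

@[simp] lemma counit_antipodeInv (a : A) : Coalgebra.counit (R := k) (S' a) = Coalgebra.counit a := by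
  rw [← HopfAlgebra.counit_antipode, antipode_antipodeInv]

lemma comul_antipodeInv (a : A) :
    δ (S' a) = TensorProduct.map S' S' (TensorProduct.comm k A A (δ a)) := by
  have h := comul_antipode (k := k) (S' a)
  rw [antipode_antipodeInv] at h
  rw [h, ← (ℛ k (S' a)).eq]
  simp

end Antipode
end CRHopf

namespace CRHopf
section Algebra
variable (k A : Type u) [Field k] [Ring A] [HopfAlgebra k A]
local notation "S" => HopfAlgebra.antipode k (A := A)
local notation "S'" => antipodeInv k A
local notation "δ" => Coalgebra.comul (R := k) (A := A)

/-- The convolution product `(f * g)(x) = ∑ f(x₍₁₎) g(x₍₂₎)` of `A^*`. -/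
def dualMul : Module.Dual k A →ₗ[k] Module.Dual k A →ₗ[k] Module.Dual k A :=
  LinearMap.mk₂ k (fun f g => LinearMap.mul' k k ∘ₗ TensorProduct.map f g ∘ₗ δ)
    (fun f f' g => by simp [TensorProduct.map_add_left, LinearMap.add_comp, LinearMap.comp_add])
    (fun c f g => by simp [TensorProduct.map_smul_left, LinearMap.smul_comp, LinearMap.comp_smul])
    (fun f g g' => by simp [TensorProduct.map_add_right, LinearMap.add_comp, LinearMap.comp_add])
    (fun c f g => by simp [TensorProduct.map_smul_right, LinearMap.smul_comp, LinearMap.comp_smul])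

/-- `preL x f = f(x ·)`. -/
def preL : A →ₗ[k] Module.Dual k A →ₗ[k] Module.Dual k A :=
  LinearMap.mk₂ k (fun x f => f ∘ₗ LinearMap.mulLeft k x)
    (fun x y f => by ext; simp [add_mul]) (fun c x f => by ext; simp)
    (fun x f g => by ext; simp) (fun c x f => by ext; simp)

/-- `preR x f = f(· x)`. -/
def preR : A →ₗ[k] Module.Dual k A →ₗ[k] Module.Dual k A :=
  LinearMap.mk₂ k (fun x f => f ∘ₗ LinearMap.mulRight k x)
    (fun x y f => by ext; simp [mul_add]) (fun c x f => by ext; simp)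
    (fun x f g => by ext; simp) (fun c x f => by ext; simp)

variable {k A}

@[simp] lemma preL_apply (x : A) (f : Module.Dual k A) (y : A) : preL k A x f y = f (x * y) := rfl
@[simp] lemma preR_apply (x : A) (f : Module.Dual k A) (y : A) : preR k A x f y = f (y * x) := rfl

lemma dualMul_eq (f g : Module.Dual k A) :
    dualMul k A f g = (WithConv.toConv f * WithConv.toConv g).ofConv := rfl

lemma dualMul_assoc (f g h : Module.Dual k A) :
    dualMul k A (dualMul k A f g) h = dualMul k A f (dualMul k A g h) :=
  congrArg WithConv.ofConv (mul_assoc (WithConv.toConv f) (WithConv.toConv g) (WithConv.toConv h))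

lemma counit_dualMul (f : Module.Dual k A) : dualMul k A (Coalgebra.counit (R := k)) f = f :=
  congrArg WithConv.ofConv (one_mul (WithConv.toConv f))

lemma dualMul_counit (f : Module.Dual k A) : dualMul k A f (Coalgebra.counit (R := k)) = f :=
  congrArg WithConv.ofConv (mul_one (WithConv.toConv f))

lemma preL_dualMul (x : A) (f g : Module.Dual k A) {ι : Type*} (r : Coalgebra.Repr k x ι) :
    preL k A x (dualMul k A f g) =
      ∑ i ∈ r.index, dualMul k A (preL k A (r.left i) f) (preL k A (r.right i) g) := by
  ext y
  simp only [preL_apply, LinearMap.sum_apply]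
  change LinearMap.mul' k k (TensorProduct.map f g (δ (x * y))) =
    ∑ i ∈ r.index, LinearMap.mul' k k (TensorProduct.map _ _ (δ y))
  rw [Bialgebra.comul_mul, ← r.eq, ← (ℛ k y).eq]
  simp [Finset.sum_mul, Finset.mul_sum]
  rw [Finset.sum_comm]

lemma preR_dualMul (x : A) (f g : Module.Dual k A) {ι : Type*} (r : Coalgebra.Repr k x ι) :
    preR k A x (dualMul k A f g) =
      ∑ i ∈ r.index, dualMul k A (preR k A (r.left i) f) (preR k A (r.right i) g) := by
  ext y
  simp only [preR_apply, LinearMap.sum_apply]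
  change LinearMap.mul' k k (TensorProduct.map f g (δ (y * x))) =
    ∑ i ∈ r.index, LinearMap.mul' k k (TensorProduct.map _ _ (δ y))
  rw [Bialgebra.comul_mul, ← r.eq, ← (ℛ k y).eq]
  simp [Finset.sum_mul, Finset.mul_sum]

variable (k A) in
/-- The vector space `(A^{*op} ⊗ A^*) ⊗ (A ⊗ A^{op})` underlying the Cibils–Rosso algebra. -/
abbrev CRSpace : Type u := (Module.Dual k A ⊗[k] Module.Dual k A) ⊗[k] (A ⊗[k] A)

noncomputable instance instAddCommGroupCRSpace : AddCommGroup (CRSpace k A) :=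
  Module.addCommMonoidToAddCommGroup k

/-- `(l ⊗ κ) ⊗ (a ⊗ b) ↦ lam l * kap κ * (alp a * bet b)`. -/
def repMap {B : Type u} [Ring B] [Algebra k B] (lam kap : Module.Dual k A →ₗ[k] B)
    (alp bet : A →ₗ[k] B) : CRSpace k A →ₗ[k] B :=
  LinearMap.mul' k B ∘ₗ TensorProduct.map (LinearMap.mul' k B ∘ₗ TensorProduct.map lam kap)
    (LinearMap.mul' k B ∘ₗ TensorProduct.map alp bet)

@[simp] lemma repMap_tmul {B : Type u} [Ring B] [Algebra k B] (lam kap : Module.Dual k A →ₗ[k] B)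
    (alp bet : A →ₗ[k] B) (l κ a b) : repMap lam kap alp bet ((l ⊗ₜ κ) ⊗ₜ (a ⊗ₜ b)) =
      lam l * kap κ * (alp a * bet b) := rfl

lemma CRSpace.ext_hom {W : Type*} [AddCommMonoid W] [Module k W] {f g : CRSpace k A →ₗ[k] W}
    (h : ∀ l κ a b, f ((l ⊗ₜ κ) ⊗ₜ (a ⊗ₜ b)) = g ((l ⊗ₜ κ) ⊗ₜ (a ⊗ₜ b))) : f = g := by
  ext l κ a b
  exact h l κ a b

/-- An element of `A ⊗ (A ⊗ A)` is determined, for linear purposes, by pure tensors. -/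
lemma triple_ind {W : Type*} [AddCommMonoid W] [Module k W] {f g : A ⊗[k] (A ⊗[k] A) →ₗ[k] W}
    (h : ∀ x y z, f (x ⊗ₜ (y ⊗ₜ z)) = g (x ⊗ₜ (y ⊗ₜ z))) (t) : f t = g t := by
  have : f = g := by
    ext x y z
    exact h x y z
  rw [this]

variable [FiniteDimensional k A]

/-- Families of elements of an algebra `B` subject to the relations of the Cibils–Rosso algebra. -/
structure CRRep {B : Type u} [Ring B] [Algebra k B] (lam kap : Module.Dual k A →ₗ[k] B)
    (alp bet : A →ₗ[k] B) : Prop where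
  lam_one : lam (Coalgebra.counit (R := k)) = 1
  kap_one : kap (Coalgebra.counit (R := k)) = 1
  alp_one : alp 1 = 1
  bet_one : bet 1 = 1
  lam_mul : ∀ l l', lam l * lam l' = lam (dualMul k A l' l)
  kap_mul : ∀ l l', kap l * kap l' = kap (dualMul k A l l')
  alp_mul : ∀ a a', alp a * alp a' = alp (a * a')
  bet_mul : ∀ b b', bet b * bet b' = bet (b' * b)
  lam_kap : ∀ l κ, kap κ * lam l = lam l * kap κ
  alp_bet : ∀ a b, bet b * alp a = alp a * bet b
  alp_lam : ∀ a l, alp a * lam l =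
    LinearMap.mul' k B (TensorProduct.map (lam ∘ₗ (preL k A).flip l ∘ₗ S) alp (δ a))
  alp_kap : ∀ a κ, alp a * kap κ = LinearMap.mul' k B
    (TensorProduct.map (kap ∘ₗ (preL k A).flip κ ∘ₗ S') alp (TensorProduct.comm k A A (δ a)))
  bet_lam : ∀ b l, bet b * lam l =
    LinearMap.mul' k B (TensorProduct.map (lam ∘ₗ (preR k A).flip l ∘ₗ S') bet (δ b))
  bet_kap : ∀ b κ, bet b * kap κ = LinearMap.mul' k B
    (TensorProduct.map (kap ∘ₗ (preR k A).flip κ ∘ₗ S) bet (TensorProduct.comm k A A (δ b)))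

variable (k A) in
/-- Left multiplication by `l ∈ A^{*op}`. -/
def opLam : Module.Dual k A →ₗ[k] Module.End k (CRSpace k A) :=
  LinearMap.rTensorHom _ ∘ₗ LinearMap.rTensorHom _ ∘ₗ (dualMul k A).flip

variable (k A) in
/-- Left multiplication by `κ ∈ A^*`. -/
def opKap : Module.Dual k A →ₗ[k] Module.End k (CRSpace k A) :=
  LinearMap.rTensorHom _ ∘ₗ LinearMap.lTensorHom _ ∘ₗ dualMul k A

variable (k A) in
/-- `x ⊗ y ⊗ z ↦ ((l ⊗ κ) ⊗ (a ⊗ b) ↦ (l(Sx ·) ⊗ κ(S⁻¹z ·)) ⊗ (y a ⊗ b))`. -/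
noncomputable def opAlp₃ : A ⊗[k] (A ⊗[k] A) →ₗ[k] Module.End k (CRSpace k A) :=
  TensorProduct.homTensorHomMap (RingHom.id k) _ _ _ _ ∘ₗ
    TensorProduct.map (TensorProduct.homTensorHomMap (RingHom.id k) _ _ _ _ ∘ₗ
        TensorProduct.map (preL k A ∘ₗ S) (preL k A ∘ₗ S'))
      (LinearMap.rTensorHom A ∘ₗ LinearMap.mul k A) ∘ₗ
    (TensorProduct.assoc k A A A).symm.toLinearMap ∘ₗ
    (TensorProduct.comm k A A).toLinearMap.lTensor A

variable (k A) in
/-- `x ⊗ y ⊗ z ↦ ((l ⊗ κ) ⊗ (a ⊗ b) ↦ (l(· S⁻¹x) ⊗ κ(· Sz)) ⊗ (a ⊗ b y))`. -/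
noncomputable def opBet₃ : A ⊗[k] (A ⊗[k] A) →ₗ[k] Module.End k (CRSpace k A) :=
  TensorProduct.homTensorHomMap (RingHom.id k) _ _ _ _ ∘ₗ
    TensorProduct.map (TensorProduct.homTensorHomMap (RingHom.id k) _ _ _ _ ∘ₗ
        TensorProduct.map (preR k A ∘ₗ S') (preR k A ∘ₗ S))
      (LinearMap.lTensorHom A ∘ₗ (LinearMap.mul k A).flip) ∘ₗ
    (TensorProduct.assoc k A A A).symm.toLinearMap ∘ₗ
    (TensorProduct.comm k A A).toLinearMap.lTensor A

@[simp] lemma opLam_tmul (l l' κ : Module.Dual k A) (q : A ⊗[k] A) :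
    opLam k A l ((l' ⊗ₜ κ) ⊗ₜ q) = (dualMul k A l' l ⊗ₜ κ) ⊗ₜ q := rfl

@[simp] lemma opKap_tmul (κ l' κ' : Module.Dual k A) (q : A ⊗[k] A) :
    opKap k A κ ((l' ⊗ₜ κ') ⊗ₜ q) = (l' ⊗ₜ dualMul k A κ κ') ⊗ₜ q := rfl

@[simp] lemma opAlp₃_tmul (x y z : A) (l κ : Module.Dual k A) (a b : A) :
    opAlp₃ k A (x ⊗ₜ (y ⊗ₜ z)) ((l ⊗ₜ κ) ⊗ₜ (a ⊗ₜ b)) =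
      (preL k A (S x) l ⊗ₜ preL k A (S' z) κ) ⊗ₜ ((y * a) ⊗ₜ b) := rfl

@[simp] lemma opBet₃_tmul (x y z : A) (l κ : Module.Dual k A) (a b : A) :
    opBet₃ k A (x ⊗ₜ (y ⊗ₜ z)) ((l ⊗ₜ κ) ⊗ₜ (a ⊗ₜ b)) =
      (preR k A (S' x) l ⊗ₜ preR k A (S z) κ) ⊗ₜ (a ⊗ₜ (b * y)) := rfl

variable (k A) in
/-- The iterated comultiplication `a ↦ ∑ a₍₁₎ ⊗ a₍₂₎ ⊗ a₍₃₎`. -/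
def comul₃ : A →ₗ[k] A ⊗[k] (A ⊗[k] A) := LinearMap.lTensor A δ ∘ₗ δ

variable (k A) in
/-- Left multiplication by `a ∈ A`:
`(l ⊗ κ) ⊗ (a' ⊗ b') ↦ ∑ (l(Sa₍₁₎ ·) ⊗ κ(S⁻¹a₍₃₎ ·)) ⊗ (a₍₂₎ a' ⊗ b')`. -/
noncomputable def opAlp : A →ₗ[k] Module.End k (CRSpace k A) := opAlp₃ k A ∘ₗ comul₃ k A

variable (k A) in
/-- Left multiplication by `b ∈ A^{op}`:
`(l ⊗ κ) ⊗ (a' ⊗ b') ↦ ∑ (l(· S⁻¹b₍₁₎) ⊗ κ(· Sb₍₃₎)) ⊗ (a' ⊗ b' b₍₂₎)`. -/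
noncomputable def opBet : A →ₗ[k] Module.End k (CRSpace k A) := opBet₃ k A ∘ₗ comul₃ k A

section Rep
variable {B : Type u} [Ring B] [Algebra k B] {lam kap : Module.Dual k A →ₗ[k] B}
    {alp bet : A →ₗ[k] B}

lemma CRRep.repMap_opLam (h : CRRep lam kap alp bet) (l : Module.Dual k A) (v : CRSpace k A) :
    repMap lam kap alp bet (opLam k A l v) = lam l * repMap lam kap alp bet v := by
  have : repMap lam kap alp bet ∘ₗ opLam k A l =
      LinearMap.mulLeft k (lam l) ∘ₗ repMap lam kap alp bet := by
    apply CRSpace.ext_hom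
    intro l' κ a b
    simp [← h.lam_mul, mul_assoc]
  exact LinearMap.congr_fun this v

lemma CRRep.repMap_opKap (h : CRRep lam kap alp bet) (l : Module.Dual k A) (v : CRSpace k A) :
    repMap lam kap alp bet (opKap k A l v) = kap l * repMap lam kap alp bet v := by
  have : repMap lam kap alp bet ∘ₗ opKap k A l =
      LinearMap.mulLeft k (kap l) ∘ₗ repMap lam kap alp bet := by
    apply CRSpace.ext_hom
    intro l' κ a b
    simp only [LinearMap.comp_apply, opKap_tmul, repMap_tmul, LinearMap.mulLeft_apply,
      ← h.kap_mul, ← mul_assoc, h.lam_kap]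
  exact LinearMap.congr_fun this v

lemma CRRep.alp_lam_kap (h : CRRep lam kap alp bet) (a : A) (l κ : Module.Dual k A) (t : B) :
    alp a * (lam l * kap κ * t) = LinearMap.mul' k B (TensorProduct.map
      (lam ∘ₗ (preL k A).flip l ∘ₗ S) (LinearMap.mul' k B ∘ₗ TensorProduct.map
        (kap ∘ₗ (preL k A).flip κ ∘ₗ S') (LinearMap.mulRight k t ∘ₗ alp) ∘ₗ
          (TensorProduct.comm k A A).toLinearMap) (comul₃ k A a)) := by
  rw [← mul_assoc, ← mul_assoc, h.alp_lam, comul₃, LinearMap.comp_apply, ← (ℛ k a).eq]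
  simp only [map_sum, Finset.sum_mul, LinearMap.lTensor_tmul, TensorProduct.map_tmul,
    LinearMap.mul'_apply, mul_assoc]
  refine Finset.sum_congr rfl fun i _ => ?_
  congr 1
  rw [← mul_assoc, h.alp_kap, LinearMap.comp_apply, LinearMap.comp_apply, LinearEquiv.coe_coe]
  rw [← (ℛ k ((ℛ k a).right i)).eq]
  simp [Finset.sum_mul, mul_assoc]

lemma CRRep.bet_lam_kap (h : CRRep lam kap alp bet) (a : A) (l κ : Module.Dual k A) (t : B) :
    bet a * (lam l * kap κ * t) = LinearMap.mul' k B (TensorProduct.map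
      (lam ∘ₗ (preR k A).flip l ∘ₗ S') (LinearMap.mul' k B ∘ₗ TensorProduct.map
        (kap ∘ₗ (preR k A).flip κ ∘ₗ S) (LinearMap.mulRight k t ∘ₗ bet) ∘ₗ
          (TensorProduct.comm k A A).toLinearMap) (comul₃ k A a)) := by
  rw [← mul_assoc, ← mul_assoc, h.bet_lam, comul₃, LinearMap.comp_apply, ← (ℛ k a).eq]
  simp only [map_sum, Finset.sum_mul, LinearMap.lTensor_tmul, TensorProduct.map_tmul,
    LinearMap.mul'_apply, mul_assoc]
  refine Finset.sum_congr rfl fun i _ => ?_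
  congr 1
  rw [← mul_assoc, h.bet_kap, LinearMap.comp_apply, LinearMap.comp_apply, LinearEquiv.coe_coe]
  rw [← (ℛ k ((ℛ k a).right i)).eq]
  simp [Finset.sum_mul, mul_assoc]

lemma CRRep.repMap_opAlp (h : CRRep lam kap alp bet) (c : A) (v : CRSpace k A) :
    repMap lam kap alp bet (opAlp k A c v) = alp c * repMap lam kap alp bet v := by
  have : repMap lam kap alp bet ∘ₗ opAlp k A c =
      LinearMap.mulLeft k (alp c) ∘ₗ repMap lam kap alp bet := by
    apply CRSpace.ext_hom
    intro l κ a b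
    simp only [LinearMap.comp_apply, repMap_tmul, LinearMap.mulLeft_apply, h.alp_lam_kap, opAlp]
    generalize comul₃ k A c = t
    induction t with
    | zero => simp
    | add a b ha hb => simp only [map_add, LinearMap.add_apply, ha, hb]
    | tmul x t =>
      induction t with
      | zero => simp
      | add a b ha hb => simp only [map_add, LinearMap.add_apply, TensorProduct.tmul_add, ha, hb]
      | tmul y z => simp [← h.alp_mul, mul_assoc]
  exact LinearMap.congr_fun this v

lemma CRRep.repMap_opBet (h : CRRep lam kap alp bet) (c : A) (v : CRSpace k A) :
    repMap lam kap alp bet (opBet k A c v) = bet c * repMap lam kap alp bet v := by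
  have : repMap lam kap alp bet ∘ₗ opBet k A c =
      LinearMap.mulLeft k (bet c) ∘ₗ repMap lam kap alp bet := by
    apply CRSpace.ext_hom
    intro l κ a b
    simp only [LinearMap.comp_apply, repMap_tmul, LinearMap.mulLeft_apply, h.bet_lam_kap, opBet]
    generalize comul₃ k A c = t
    induction t with
    | zero => simp
    | add a b ha hb => simp only [map_add, LinearMap.add_apply, ha, hb]
    | tmul x t =>
      induction t with
      | zero => simp
      | add a b ha hb => simp only [map_add, LinearMap.add_apply, TensorProduct.tmul_add, ha, hb]
      | tmul y z =>
        have := h.alp_bet a y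
        have e : alp a * (bet y * bet b) = bet y * (alp a * bet b) := by
          rw [← mul_assoc, ← mul_assoc, this]
        simp [← h.bet_mul, mul_assoc, e]
  exact LinearMap.congr_fun this v

end Rep
end Algebra
end CRHopf

namespace CRHopf
section Algebra
variable {k A : Type u} [Field k] [Ring A] [HopfAlgebra k A]
local notation "S" => HopfAlgebra.antipode k (A := A)
local notation "S'" => antipodeInv k A
local notation "δ" => Coalgebra.comul (R := k) (A := A)
local notation "ε" => Coalgebra.counit (R := k) (A := A)

lemma lTensor_comul₃ (a : A) : LinearMap.lTensor A (comul₃ k A) (δ a) =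
    TensorProduct.assoc k A A (A ⊗[k] A) (LinearMap.rTensor (A ⊗[k] A) δ (comul₃ k A a)) := by
  have h1 : ∀ t : A ⊗[k] A, TensorProduct.assoc k A A (A ⊗[k] A)
      (LinearMap.rTensor (A ⊗[k] A) δ (LinearMap.lTensor A δ t)) =
      LinearMap.lTensor A (LinearMap.lTensor A δ)
        (TensorProduct.assoc k A A A (LinearMap.rTensor A δ t)) := by
    intro t
    induction t with
    | zero => simp
    | add a b ha hb => simp only [map_add, ha, hb]
    | tmul x y =>
      simp only [LinearMap.rTensor_tmul, LinearMap.lTensor_tmul]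
      induction δ x with
      | zero => simp
      | add a b ha hb => simp only [map_add, TensorProduct.add_tmul, ha, hb]
      | tmul x z => simp
  rw [comul₃, LinearMap.comp_apply, h1, Coalgebra.coassoc_apply, LinearMap.lTensor_comp,
    LinearMap.comp_apply]

lemma rTensor_comul₃ (a : A) : LinearMap.rTensor A (comul₃ k A) (δ a) =
    (TensorProduct.assoc k A (A ⊗[k] A) A).symm (LinearMap.lTensor A
      (TensorProduct.assoc k A A A).symm.toLinearMap
        (LinearMap.lTensor A (LinearMap.lTensor A δ) (comul₃ k A a))) := by
  have h1 : ∀ t : A ⊗[k] (A ⊗[k] A), (TensorProduct.assoc k A (A ⊗[k] A) A).symm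
      (LinearMap.lTensor A (LinearMap.rTensor A δ) t) =
      LinearMap.rTensor A (LinearMap.lTensor A δ) ((TensorProduct.assoc k A A A).symm t) := by
    intro t
    induction t with
    | zero => simp
    | add a b ha hb => simp only [map_add, ha, hb]
    | tmul x y =>
      induction y with
      | zero => simp
      | add a b ha hb => simp only [map_add, TensorProduct.tmul_add, ha, hb]
      | tmul y z => simp
  rw [comul₃, LinearMap.comp_apply, ← LinearMap.lTensor_comp_apply, ← LinearMap.lTensor_comp_apply]
  have h2 : (TensorProduct.assoc k A A A).symm.toLinearMap ∘ₗ LinearMap.lTensor A δ ∘ₗ δ =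
      LinearMap.rTensor A δ ∘ₗ δ := by
    ext x; simp
  rw [LinearMap.comp_assoc, h2, LinearMap.lTensor_comp, LinearMap.comp_apply, h1,
    Coalgebra.coassoc_symm_apply, LinearMap.rTensor_comp, LinearMap.comp_apply]

lemma comul₃_mul (a b : A) : comul₃ k A (a * b) = comul₃ k A a * comul₃ k A b :=
  map_mul ((Algebra.TensorProduct.map (AlgHom.id k A) (Bialgebra.comulAlgHom k A)).comp
    (Bialgebra.comulAlgHom k A)) a b

lemma comul₃_one : comul₃ k A 1 = 1 ⊗ₜ (1 ⊗ₜ 1) :=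
  map_one ((Algebra.TensorProduct.map (AlgHom.id k A) (Bialgebra.comulAlgHom k A)).comp
    (Bialgebra.comulAlgHom k A))

lemma counit_comul₃ (a : A) : TensorProduct.lid k A (TensorProduct.map ε
    ((TensorProduct.rid k A).toLinearMap ∘ₗ LinearMap.lTensor A ε) (comul₃ k A a)) = a := by
  have : TensorProduct.map ε ((TensorProduct.rid k A).toLinearMap ∘ₗ LinearMap.lTensor A ε) ∘ₗ
      LinearMap.lTensor A δ = LinearMap.rTensor A ε := by
    ext x y
    simp
  rw [comul₃, LinearMap.comp_apply, ← LinearMap.comp_apply, this]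
  simp

variable [FiniteDimensional k A]

lemma opAlp₃_mul (s t : A ⊗[k] (A ⊗[k] A)) :
    opAlp₃ k A s * opAlp₃ k A t = opAlp₃ k A (s * t) := by
  induction s with
  | zero => simp
  | add a b ha hb => simp only [map_add, add_mul, mul_add, ha, hb]
  | tmul x s =>
  induction s with
  | zero => simp
  | add a b ha hb => simp only [TensorProduct.tmul_add, map_add, add_mul, mul_add, ha, hb]
  | tmul y z =>
  induction t with
  | zero => simp
  | add a b ha hb => simp only [map_add, add_mul, mul_add, ha, hb]
  | tmul x' t =>
  induction t with
  | zero => simp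
  | add a b ha hb => simp only [TensorProduct.tmul_add, map_add, add_mul, mul_add, ha, hb]
  | tmul y' z' =>
  apply CRSpace.ext_hom
  intro l κ a b
  simp only [LinearMap.comp_apply, LinearMap.mulLeft_apply, Module.End.mul_apply, opAlp₃_tmul,
    Algebra.TensorProduct.tmul_mul_tmul, HopfAlgebra.antipode_mul_antidistrib, antipodeInv_mul, mul_assoc]
  congr 2 <;> ext <;> simp [mul_assoc]

lemma opBet₃_mul (s t : A ⊗[k] (A ⊗[k] A)) :
    opBet₃ k A s * opBet₃ k A t = opBet₃ k A (t * s) := by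
  induction s with
  | zero => simp
  | add a b ha hb => simp only [map_add, add_mul, mul_add, ha, hb]
  | tmul x s =>
  induction s with
  | zero => simp
  | add a b ha hb => simp only [TensorProduct.tmul_add, map_add, add_mul, mul_add, ha, hb]
  | tmul y z =>
  induction t with
  | zero => simp
  | add a b ha hb => simp only [map_add, add_mul, mul_add, ha, hb]
  | tmul x' t =>
  induction t with
  | zero => simp
  | add a b ha hb => simp only [TensorProduct.tmul_add, map_add, add_mul, mul_add, ha, hb]
  | tmul y' z' =>
  apply CRSpace.ext_hom
  intro l κ a b
  simp only [LinearMap.comp_apply, LinearMap.mulLeft_apply, LinearMap.mulRight_apply,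
    Module.End.mul_apply, opBet₃_tmul,
    Algebra.TensorProduct.tmul_mul_tmul, HopfAlgebra.antipode_mul_antidistrib, antipodeInv_mul, mul_assoc]
  congr 2 <;> ext <;> simp [mul_assoc]

lemma opBet₃_opAlp₃ (s t : A ⊗[k] (A ⊗[k] A)) :
    opBet₃ k A s * opAlp₃ k A t = opAlp₃ k A t * opBet₃ k A s := by
  induction s with
  | zero => simp only [map_zero, zero_mul, mul_zero]
  | add a b ha hb => simp only [map_add, add_mul, mul_add, ha, hb]
  | tmul x s =>
  induction s with
  | zero => simp only [TensorProduct.tmul_zero, map_zero, zero_mul, mul_zero]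
  | add a b ha hb => simp only [TensorProduct.tmul_add, map_add, add_mul, mul_add, ha, hb]
  | tmul y z =>
  induction t with
  | zero => simp only [map_zero, zero_mul, mul_zero]
  | add a b ha hb => simp only [map_add, add_mul, mul_add, ha, hb]
  | tmul x' t =>
  induction t with
  | zero => simp only [TensorProduct.tmul_zero, map_zero, zero_mul, mul_zero]
  | add a b ha hb => simp only [TensorProduct.tmul_add, map_add, add_mul, mul_add, ha, hb]
  | tmul y' z' =>
  apply CRSpace.ext_hom
  intro l κ a b
  simp only [LinearMap.comp_apply, LinearMap.mulLeft_apply, LinearMap.mulRight_apply,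
    Module.End.mul_apply, opBet₃_tmul, opAlp₃_tmul, mul_assoc]
  congr 2 <;> ext <;> simp [mul_assoc]

lemma preL_antipode_dualMul (x : A) (l' l : Module.Dual k A) {ι : Type*}
    (r : Coalgebra.Repr k x ι) : preL k A (S x) (dualMul k A l' l) = ∑ i ∈ r.index,
      dualMul k A (preL k A (S (r.right i)) l') (preL k A (S (r.left i)) l) := by
  refine preL_dualMul (S x) l' l ⟨r.index, fun i => S (r.right i), fun i => S (r.left i), ?_⟩
  rw [comul_antipode, ← r.eq]
  simp

lemma preR_antipode_dualMul (x : A) (l' l : Module.Dual k A) {ι : Type*}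
    (r : Coalgebra.Repr k x ι) : preR k A (S x) (dualMul k A l' l) = ∑ i ∈ r.index,
      dualMul k A (preR k A (S (r.right i)) l') (preR k A (S (r.left i)) l) := by
  refine preR_dualMul (S x) l' l ⟨r.index, fun i => S (r.right i), fun i => S (r.left i), ?_⟩
  rw [comul_antipode, ← r.eq]
  simp

lemma preL_antipodeInv_dualMul (x : A) (l' l : Module.Dual k A) {ι : Type*}
    (r : Coalgebra.Repr k x ι) : preL k A (S' x) (dualMul k A l' l) = ∑ i ∈ r.index,
      dualMul k A (preL k A (S' (r.right i)) l') (preL k A (S' (r.left i)) l) := by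
  refine preL_dualMul (S' x) l' l ⟨r.index, fun i => S' (r.right i), fun i => S' (r.left i), ?_⟩
  rw [comul_antipodeInv, ← r.eq]
  simp

lemma preR_antipodeInv_dualMul (x : A) (l' l : Module.Dual k A) {ι : Type*}
    (r : Coalgebra.Repr k x ι) : preR k A (S' x) (dualMul k A l' l) = ∑ i ∈ r.index,
      dualMul k A (preR k A (S' (r.right i)) l') (preR k A (S' (r.left i)) l) := by
  refine preR_dualMul (S' x) l' l ⟨r.index, fun i => S' (r.right i), fun i => S' (r.left i), ?_⟩
  rw [comul_antipodeInv, ← r.eq]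
  simp

lemma comul₃_lam {B : Type u} [Ring B] [Algebra k B] {f : A →ₗ[k] B}
    {g : A ⊗[k] (A ⊗[k] A) →ₗ[k] B} {p : B}
    (h : ∀ x y z, g (x ⊗ₜ (y ⊗ₜ z)) * p = LinearMap.mul' k B (TensorProduct.map f g
      (TensorProduct.assoc k A A (A ⊗[k] A) (δ x ⊗ₜ (y ⊗ₜ z))))) (a : A) :
    g (comul₃ k A a) * p =
      LinearMap.mul' k B (TensorProduct.map f (g ∘ₗ comul₃ k A) (δ a)) := by
  have e : TensorProduct.map f (g ∘ₗ comul₃ k A) =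
      TensorProduct.map f g ∘ₗ LinearMap.lTensor A (comul₃ k A) := by
    ext; simp
  rw [e, LinearMap.comp_apply, lTensor_comul₃]
  exact triple_ind (f := LinearMap.mulRight k p ∘ₗ g)
    (g := LinearMap.mul' k B ∘ₗ TensorProduct.map f g ∘ₗ
      (TensorProduct.assoc k A A (A ⊗[k] A)).toLinearMap ∘ₗ LinearMap.rTensor (A ⊗[k] A) δ)
    (fun x y z => h x y z) (comul₃ k A a)

lemma comul₃_kap {B : Type u} [Ring B] [Algebra k B] {f : A →ₗ[k] B}
    {g : A ⊗[k] (A ⊗[k] A) →ₗ[k] B} {p : B}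
    (h : ∀ x y z, g (x ⊗ₜ (y ⊗ₜ z)) * p = LinearMap.mul' k B (TensorProduct.map f g
      (TensorProduct.comm k _ _ ((TensorProduct.assoc k A (A ⊗[k] A) A).symm (x ⊗ₜ
        (TensorProduct.assoc k A A A).symm (y ⊗ₜ δ z)))))) (a : A) :
    g (comul₃ k A a) * p = LinearMap.mul' k B (TensorProduct.map f (g ∘ₗ comul₃ k A)
      (TensorProduct.comm k A A (δ a))) := by
  have e : TensorProduct.map f (g ∘ₗ comul₃ k A) ∘ₗ (TensorProduct.comm k A A).toLinearMap =
      TensorProduct.map f g ∘ₗ (TensorProduct.comm k _ _).toLinearMap ∘ₗ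
        LinearMap.rTensor A (comul₃ k A) := by
    ext; simp
  have e' := LinearMap.congr_fun e (δ a)
  simp only [LinearMap.comp_apply, LinearEquiv.coe_coe] at e'
  rw [e', rTensor_comul₃]
  exact triple_ind (f := LinearMap.mulRight k p ∘ₗ g)
    (g := LinearMap.mul' k B ∘ₗ TensorProduct.map f g ∘ₗ
      (TensorProduct.comm k _ _).toLinearMap ∘ₗ
      (TensorProduct.assoc k A (A ⊗[k] A) A).symm.toLinearMap ∘ₗ LinearMap.lTensor A
      (TensorProduct.assoc k A A A).symm.toLinearMap ∘ₗ
        LinearMap.lTensor A (LinearMap.lTensor A δ))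
    (fun x y z => h x y z) (comul₃ k A a)

lemma opRep : CRRep (opLam k A) (opKap k A) (opAlp k A) (opBet k A) where
  lam_one := by
    apply CRSpace.ext_hom
    intro l κ a b
    simp [dualMul_counit]
  kap_one := by
    apply CRSpace.ext_hom
    intro l κ a b
    simp [counit_dualMul]
  alp_one := by
    apply CRSpace.ext_hom
    intro l κ a b
    simp only [opAlp, LinearMap.comp_apply, comul₃_one, opAlp₃_tmul, HopfAlgebra.antipode_one,
      antipodeInv_one, one_mul, Module.End.one_apply]
    congr 2 <;> ext <;> simp
  bet_one := by
    apply CRSpace.ext_hom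
    intro l κ a b
    simp only [opBet, LinearMap.comp_apply, comul₃_one, opBet₃_tmul, HopfAlgebra.antipode_one,
      antipodeInv_one, mul_one, Module.End.one_apply]
    congr 2 <;> ext <;> simp
  lam_mul l l' := by
    apply CRSpace.ext_hom
    intro l κ a b
    simp [dualMul_assoc]
  kap_mul l l' := by
    apply CRSpace.ext_hom
    intro l κ a b
    simp [dualMul_assoc]
  alp_mul a a' := by simp [opAlp, opAlp₃_mul, comul₃_mul]
  bet_mul a a' := by simp [opBet, opBet₃_mul, comul₃_mul]
  lam_kap l κ := by
    apply CRSpace.ext_hom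
    intro l κ a b
    simp
  alp_bet a b := opBet₃_opAlp₃ _ _
  alp_lam a l := by
    refine comul₃_lam (g := opAlp₃ k A) (fun x y z => ?_) a
    apply CRSpace.ext_hom
    intro l' κ a b
    rw [← (ℛ k x).eq]
    simp [preL_antipode_dualMul x _ _ (ℛ k x), TensorProduct.sum_tmul]
  alp_kap a l := by
    refine comul₃_kap (g := opAlp₃ k A) (fun x y z => ?_) a
    apply CRSpace.ext_hom
    intro l' κ a b
    rw [← (ℛ k z).eq]
    simp [preL_antipodeInv_dualMul z _ _ (ℛ k z), TensorProduct.sum_tmul, TensorProduct.tmul_sum]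
  bet_lam a l := by
    refine comul₃_lam (g := opBet₃ k A) (fun x y z => ?_) a
    apply CRSpace.ext_hom
    intro l' κ a b
    rw [← (ℛ k x).eq]
    simp [preR_antipodeInv_dualMul x _ _ (ℛ k x), TensorProduct.sum_tmul]
  bet_kap a l := by
    refine comul₃_kap (g := opBet₃ k A) (fun x y z => ?_) a
    apply CRSpace.ext_hom
    intro l' κ a b
    rw [← (ℛ k z).eq]
    simp [preR_antipode_dualMul z _ _ (ℛ k z), TensorProduct.sum_tmul, TensorProduct.tmul_sum]

lemma preL_counit (x : A) : preL k A x ε = ε x • ε := by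
  ext; simp

lemma preR_counit (x : A) : preR k A x ε = ε x • ε := by
  ext; simp [mul_comm]

lemma opAlp_counit (a a' b' : A) : opAlp k A a ((ε ⊗ₜ ε) ⊗ₜ (a' ⊗ₜ b')) =
    (ε ⊗ₜ ε) ⊗ₜ ((a * a') ⊗ₜ b') := by
  have h := triple_ind (f := (LinearMap.applyₗ ((ε ⊗ₜ ε) ⊗ₜ (a' ⊗ₜ b') : CRSpace k A)) ∘ₗ
      opAlp₃ k A) (g := TensorProduct.mk k (Module.Dual k A ⊗[k] Module.Dual k A) (A ⊗[k] A) (ε ⊗ₜ ε) ∘ₗ (TensorProduct.mk k A A).flip b' ∘ₗ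
        LinearMap.mulRight k a' ∘ₗ (TensorProduct.lid k A).toLinearMap ∘ₗ TensorProduct.map ε
        ((TensorProduct.rid k A).toLinearMap ∘ₗ LinearMap.lTensor A ε)) (fun x y z => by
      simp [preL_counit, TensorProduct.smul_tmul, TensorProduct.tmul_smul, smul_smul, mul_comm])
      (comul₃ k A a)
  simp only [LinearMap.comp_apply, LinearEquiv.coe_coe] at h
  have hc := counit_comul₃ (k := k) a
  rw [hc] at h
  exact h

lemma opBet_counit (b a' b' : A) : opBet k A b ((ε ⊗ₜ ε) ⊗ₜ (a' ⊗ₜ b')) =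
    (ε ⊗ₜ ε) ⊗ₜ (a' ⊗ₜ (b' * b)) := by
  have h := triple_ind (f := (LinearMap.applyₗ ((ε ⊗ₜ ε) ⊗ₜ (a' ⊗ₜ b') : CRSpace k A)) ∘ₗ
      opBet₃ k A) (g := TensorProduct.mk k (Module.Dual k A ⊗[k] Module.Dual k A) (A ⊗[k] A) (ε ⊗ₜ ε) ∘ₗ TensorProduct.mk k A A a' ∘ₗ
        LinearMap.mulLeft k b' ∘ₗ (TensorProduct.lid k A).toLinearMap ∘ₗ TensorProduct.map ε
        ((TensorProduct.rid k A).toLinearMap ∘ₗ LinearMap.lTensor A ε)) (fun x y z => by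
      simp [preR_counit, TensorProduct.smul_tmul, TensorProduct.tmul_smul, smul_smul, mul_comm])
      (comul₃ k A b)
  simp only [LinearMap.comp_apply, LinearEquiv.coe_coe] at h
  have hc := counit_comul₃ (k := k) b
  rw [hc] at h
  exact h

end Algebra

section CR
variable (k A : Type u) [Field k] [Ring A] [HopfAlgebra k A] [FiniteDimensional k A]
local notation "S" => HopfAlgebra.antipode k (A := A)
local notation "S'" => antipodeInv k A
local notation "ε" => Coalgebra.counit (R := k) (A := A)

/-- The Cibils–Rosso algebra `X = (A^{*op} ⊗ A^*) ⊗ (A ⊗ A^{op})`. -/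
@[nolint unusedArguments]
def CibilsRosso : Type u := CRSpace k A

noncomputable instance : AddCommGroup (CibilsRosso k A) :=
  inferInstanceAs (AddCommGroup (CRSpace k A))

noncomputable instance : Module k (CibilsRosso k A) := inferInstanceAs (Module k (CRSpace k A))

/-- Left multiplication on `X`. -/
noncomputable def crMul : CibilsRosso k A →ₗ[k] Module.End k (CibilsRosso k A) :=
  repMap (B := Module.End k (CRSpace k A)) (opLam k A) (opKap k A) (opAlp k A) (opBet k A)

/-- The unit `(ε ⊗ ε) ⊗ (1 ⊗ 1)` of `X`. -/
noncomputable def crOne : CibilsRosso k A := ((ε ⊗ₜ ε) ⊗ₜ (1 ⊗ₜ 1) : CRSpace k A)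

variable {k A}

lemma CRRep.repMap_crMul {B : Type u} [Ring B] [Algebra k B] {lam kap : Module.Dual k A →ₗ[k] B}
    {alp bet : A →ₗ[k] B} (h : CRRep lam kap alp bet) (x y : CibilsRosso k A) :
    repMap lam kap alp bet (crMul k A x y) =
      repMap lam kap alp bet x * repMap lam kap alp bet y := by
  have e : LinearMap.llcomp k _ _ _ (repMap lam kap alp bet) ∘ₗ crMul k A =
      (LinearMap.mul k B).compl₁₂ (repMap lam kap alp bet) (repMap lam kap alp bet) := by
    apply CRSpace.ext_hom
    intro l κ a b
    ext1 (v : CRSpace k A)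
    change repMap lam kap alp bet (opLam k A l (opKap k A κ (opAlp k A a (opBet k A b v)))) =
      lam l * kap κ * (alp a * bet b) * repMap lam kap alp bet v
    rw [h.repMap_opLam, h.repMap_opKap, h.repMap_opAlp, h.repMap_opBet]
    simp only [mul_assoc]
  exact LinearMap.congr_fun (LinearMap.congr_fun e x) y

lemma CRRep.repMap_crOne {B : Type u} [Ring B] [Algebra k B] {lam kap : Module.Dual k A →ₗ[k] B}
    {alp bet : A →ₗ[k] B} (h : CRRep lam kap alp bet) :
    repMap lam kap alp bet (crOne k A) = 1 := by
  rw [crOne, repMap_tmul, h.lam_one, h.kap_one, h.alp_one, h.bet_one]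
  simp

lemma crMul_crMul (x y : CibilsRosso k A) : crMul k A (crMul k A x y) =
    crMul k A x * crMul k A y := opRep.repMap_crMul x y

lemma crMul_crOne : crMul k A (crOne k A) = 1 := opRep.repMap_crOne

lemma crMul_one_right (x : CibilsRosso k A) : crMul k A x (crOne k A) = x := by
  have e : (crMul k A).flip (crOne k A) = LinearMap.id := by
    apply CRSpace.ext_hom
    intro l κ a b
    change (opLam k A l (opKap k A κ (opAlp k A a (opBet k A b
      ((ε ⊗ₜ ε) ⊗ₜ (1 ⊗ₜ 1)))))) = _
    simp only [opBet_counit, opAlp_counit, opLam_tmul, opKap_tmul, counit_dualMul, dualMul_counit,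
      mul_one, one_mul]
    rfl
  exact LinearMap.congr_fun e x

noncomputable instance : Ring (CibilsRosso k A) :=
  { (inferInstance : AddCommGroup (CibilsRosso k A)) with
    mul := fun x y => crMul k A x y
    one := crOne k A
    left_distrib := fun x y z => map_add (crMul k A x) y z
    right_distrib := fun x y z => LinearMap.congr_fun (map_add (crMul k A) x y) z
    zero_mul := fun x => LinearMap.congr_fun (map_zero (crMul k A)) x
    mul_zero := fun x => map_zero (crMul k A x)
    mul_assoc := fun x y z => LinearMap.congr_fun (crMul_crMul x y) z
    one_mul := fun x => LinearMap.congr_fun crMul_crOne x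
    mul_one := crMul_one_right }

lemma CibilsRosso.mul_def (x y : CibilsRosso k A) : x * y = crMul k A x y := rfl
lemma CibilsRosso.one_def : (1 : CibilsRosso k A) = crOne k A := rfl

noncomputable instance : Algebra k (CibilsRosso k A) :=
  Algebra.ofModule (fun r x y => LinearMap.congr_fun (map_smul (crMul k A) r x) y)
    (fun r x y => map_smul (crMul k A x) r y)

variable (k A) in
/-- The element `(l ⊗ κ) ⊗ (a ⊗ b)` of `X`. -/
def crTmul (l κ : Module.Dual k A) (a b : A) : CibilsRosso k A :=
  ((l ⊗ₜ κ) ⊗ₜ (a ⊗ₜ b) : CRSpace k A)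

/-- `A^{*op} ⊗ A^*` keeps its natural multiplication. -/
lemma crTmul_mul_left (l κ l' κ' : Module.Dual k A) (a b : A) :
    crTmul k A l κ 1 1 * crTmul k A l' κ' a b =
      crTmul k A (dualMul k A l' l) (dualMul k A κ κ') a b := by
  change (opLam k A l (opKap k A κ (opAlp k A 1 (opBet k A 1 _)))) = _
  rw [opRep.alp_one, opRep.bet_one]
  rfl

/-- `A ⊗ A^{op}` keeps its natural multiplication. -/
lemma crTmul_mul_right (a b a' b' : A) :
    crTmul k A ε ε a b * crTmul k A ε ε a' b' = crTmul k A ε ε (a * a') (b' * b) := by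
  change (opLam k A ε (opKap k A ε (opAlp k A a (opBet k A b ((ε ⊗ₜ ε) ⊗ₜ (a' ⊗ₜ b')))))) = _
  rw [opRep.lam_one, opRep.kap_one, opBet_counit, Module.End.one_apply, Module.End.one_apply,
    opAlp_counit]
  rfl

/-- `[1 ⊗ (a ⊗ b)] [(l ⊗ κ) ⊗ 1] =
∑ (l(Sa₍₁₎ · S⁻¹b₍₁₎) ⊗ κ(S⁻¹a₍₃₎ · Sb₍₃₎)) ⊗ (a₍₂₎ ⊗ b₍₂₎)`. -/
lemma crTmul_mul_cross (l κ : Module.Dual k A) (a b : A) {ι ι' : Type*} (I : Finset ι)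
    (J : Finset ι') (a₁ a₂ a₃ : ι → A) (b₁ b₂ b₃ : ι' → A)
    (ha : comul₃ k A a = ∑ i ∈ I, a₁ i ⊗ₜ (a₂ i ⊗ₜ a₃ i))
    (hb : comul₃ k A b = ∑ j ∈ J, b₁ j ⊗ₜ (b₂ j ⊗ₜ b₃ j)) :
    crTmul k A ε ε a b * crTmul k A l κ 1 1 = ∑ i ∈ I, ∑ j ∈ J,
      crTmul k A (l ∘ₗ LinearMap.mulLeft k (S (a₁ i)) ∘ₗ LinearMap.mulRight k (S' (b₁ j)))
        (κ ∘ₗ LinearMap.mulLeft k (S' (a₃ i)) ∘ₗ LinearMap.mulRight k (S (b₃ j)))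
        (a₂ i) (b₂ j) := by
  change (opLam k A ε (opKap k A ε (opAlp k A a (opBet k A b ((l ⊗ₜ κ) ⊗ₜ (1 ⊗ₜ 1)))))) = _
  rw [opRep.lam_one, opRep.kap_one, Module.End.one_apply, Module.End.one_apply, opAlp, opBet,
    LinearMap.comp_apply, LinearMap.comp_apply, ha, hb]
  simp only [map_sum, LinearMap.sum_apply, opBet₃_tmul, opAlp₃_tmul, one_mul, mul_one]
  refine Finset.sum_comm.trans ?_
  refine Finset.sum_congr rfl fun i _ => ?_
  refine Finset.sum_congr rfl fun j _ => ?_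
  rw [crTmul]
  congr 2 <;> ext <;> simp [mul_assoc]

end CR
end CRHopf

namespace CRHopf

section Cancel
variable {k A : Type u} [Field k] [Ring A] [HopfAlgebra k A]
local notation "S" => HopfAlgebra.antipode k (A := A)
local notation "S'" => antipodeInv k A
local notation "δ" => Coalgebra.comul (R := k) (A := A)
local notation "ε" => Coalgebra.counit (R := k) (A := A)

lemma cancel_left {f : A ⊗[k] A →ₗ[k] A} (hf : ∀ a, f (δ a) = algebraMap k A (ε a)) (a : A) :
    LinearMap.rTensor A f ((TensorProduct.assoc k A A A).symm (comul₃ k A a)) = 1 ⊗ₜ a := by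
  rw [comul₃, LinearMap.comp_apply, Coalgebra.coassoc_symm_apply, ← LinearMap.rTensor_comp_apply]
  have : f ∘ₗ δ = Algebra.linearMap k A ∘ₗ ε := LinearMap.ext hf
  rw [this, LinearMap.rTensor_comp_apply, Coalgebra.rTensor_counit_comul]
  simp

lemma cancel_right {f : A ⊗[k] A →ₗ[k] A} (hf : ∀ a, f (δ a) = algebraMap k A (ε a)) (a : A) :
    LinearMap.lTensor A f (comul₃ k A a) = a ⊗ₜ 1 := by
  rw [comul₃, LinearMap.comp_apply, ← LinearMap.lTensor_comp_apply]
  have : f ∘ₗ δ = Algebra.linearMap k A ∘ₗ ε := LinearMap.ext hf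
  rw [this, LinearMap.lTensor_comp_apply, Coalgebra.lTensor_counit_comul]
  simp

variable [FiniteDimensional k A]

lemma antipodeInv_algebraMap (r : k) : S' (algebraMap k A r) = algebraMap k A r := by
  rw [Algebra.algebraMap_eq_smul_one, map_smul, antipodeInv_one]

lemma mul_antipodeInv_lTensor (a : A) : (LinearMap.mul' k A ∘ₗ
    (TensorProduct.comm k A A).toLinearMap ∘ₗ LinearMap.lTensor A S') (δ a) =
      algebraMap k A (ε a) := by
  have h : ∀ t : A ⊗[k] A, (LinearMap.mul' k A ∘ₗ (TensorProduct.comm k A A).toLinearMap ∘ₗ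
      LinearMap.lTensor A S') t = S' (LinearMap.mul' k A (LinearMap.rTensor A S t)) := by
    intro t
    induction t with
    | zero => simp
    | add a b ha hb => simp only [map_add, ha, hb]
    | tmul x y => simp [antipodeInv_mul]
  rw [h, HopfAlgebra.mul_antipode_rTensor_comul_apply, antipodeInv_algebraMap]

lemma mul_antipodeInv_rTensor (a : A) : (LinearMap.mul' k A ∘ₗ
    (TensorProduct.comm k A A).toLinearMap ∘ₗ LinearMap.rTensor A S') (δ a) =
      algebraMap k A (ε a) := by
  have h : ∀ t : A ⊗[k] A, (LinearMap.mul' k A ∘ₗ (TensorProduct.comm k A A).toLinearMap ∘ₗ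
      LinearMap.rTensor A S') t = S' (LinearMap.mul' k A (LinearMap.lTensor A S t)) := by
    intro t
    induction t with
    | zero => simp
    | add a b ha hb => simp only [map_add, ha, hb]
    | tmul x y => simp [antipodeInv_mul]
  rw [h, HopfAlgebra.mul_antipode_lTensor_comul_apply, antipodeInv_algebraMap]

end Cancel

/-- A Hopf bimodule over `A`: an `A`-bimodule which is an `A`-bicomodule such that both coactions
are morphisms of bimodules, for the diagonal actions on `A ⊗ M` and `M ⊗ A`.
Here `lact a m = a m` and `ract a m = m a`. -/
structure HopfBimodule (k A : Type u) [Field k] [Ring A] [HopfAlgebra k A] where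
  carrier : Type u
  [addCommGroup : AddCommGroup carrier]
  [module : Module k carrier]
  lact : A →ₗ[k] carrier →ₗ[k] carrier
  ract : A →ₗ[k] carrier →ₗ[k] carrier
  lcoact : carrier →ₗ[k] A ⊗[k] carrier
  rcoact : carrier →ₗ[k] carrier ⊗[k] A
  lact_one : ∀ m, lact 1 m = m
  lact_mul : ∀ a b m, lact (a * b) m = lact a (lact b m)
  ract_one : ∀ m, ract 1 m = m
  ract_mul : ∀ a b m, ract (a * b) m = ract b (ract a m)
  ract_lact : ∀ a b m, ract b (lact a m) = lact a (ract b m)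
  counit_lcoact : ∀ m, TensorProduct.lid k carrier
    (LinearMap.rTensor carrier (Coalgebra.counit (R := k)) (lcoact m)) = m
  coassoc_lcoact : ∀ m, TensorProduct.assoc k A A carrier
    (LinearMap.rTensor carrier (Coalgebra.comul (R := k)) (lcoact m)) =
      LinearMap.lTensor A lcoact (lcoact m)
  counit_rcoact : ∀ m, TensorProduct.rid k carrier
    (LinearMap.lTensor carrier (Coalgebra.counit (R := k)) (rcoact m)) = m
  coassoc_rcoact : ∀ m, TensorProduct.assoc k carrier A A
    (LinearMap.rTensor A rcoact (rcoact m)) =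
      LinearMap.lTensor carrier (Coalgebra.comul (R := k)) (rcoact m)
  lcoact_rcoact : ∀ m, TensorProduct.assoc k A carrier A
    (LinearMap.rTensor A lcoact (rcoact m)) = LinearMap.lTensor A rcoact (lcoact m)
  lcoact_lact : ∀ a m, lcoact (lact a m) =
    TensorProduct.map₂ (LinearMap.mul k A) lact (Coalgebra.comul (R := k) a) (lcoact m)
  lcoact_ract : ∀ a m, lcoact (ract a m) =
    TensorProduct.map₂ (LinearMap.mul k A).flip ract (Coalgebra.comul (R := k) a) (lcoact m)
  rcoact_lact : ∀ a m, rcoact (lact a m) =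
    TensorProduct.map₂ lact (LinearMap.mul k A) (Coalgebra.comul (R := k) a) (rcoact m)
  rcoact_ract : ∀ a m, rcoact (ract a m) =
    TensorProduct.map₂ ract (LinearMap.mul k A).flip (Coalgebra.comul (R := k) a) (rcoact m)

namespace HopfBimodule
variable {k A : Type u} [Field k] [Ring A] [HopfAlgebra k A]

attribute [instance] addCommGroup module

/-- Morphisms of Hopf bimodules: linear maps commuting with both actions and both coactions. -/
def homs (M N : HopfBimodule k A) : Submodule k (M.carrier →ₗ[k] N.carrier) where
  carrier := {f | (∀ a m, f (M.lact a m) = N.lact a (f m)) ∧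
    (∀ a m, f (M.ract a m) = N.ract a (f m)) ∧
    (∀ m, LinearMap.lTensor A f (M.lcoact m) = N.lcoact (f m)) ∧
    (∀ m, LinearMap.rTensor A f (M.rcoact m) = N.rcoact (f m))}
  add_mem' := by
    rintro f g ⟨h1, h2, h3, h4⟩ ⟨h1', h2', h3', h4'⟩
    exact ⟨fun a m => by simp [h1, h1'], fun a m => by simp [h2, h2'],
      fun m => by simp [LinearMap.lTensor_add, h3, h3'],
      fun m => by simp [LinearMap.rTensor_add, h4, h4']⟩
  zero_mem' := ⟨by simp, by simp, by simp, by simp⟩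
  smul_mem' := by
    rintro c f ⟨h1, h2, h3, h4⟩
    exact ⟨fun a m => by simp [h1], fun a m => by simp [h2],
      fun m => by simp [LinearMap.lTensor_smul, h3],
      fun m => by simp [LinearMap.rTensor_smul, h4]⟩

instance : Category (HopfBimodule k A) where
  Hom M N := homs M N
  id M := ⟨LinearMap.id, by simp, by simp, by simp, by simp⟩
  comp {M N P} f g := ⟨g.1 ∘ₗ f.1, fun a m => by simp [f.2.1, g.2.1],
    fun a m => by simp [f.2.2.1, g.2.2.1],
    fun m => by rw [LinearMap.lTensor_comp_apply, f.2.2.2.1, g.2.2.2.1]; rfl,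
    fun m => by rw [LinearMap.rTensor_comp_apply, f.2.2.2.2, g.2.2.2.2]; rfl⟩

instance : Preadditive (HopfBimodule k A) where
  homGroup M N := inferInstanceAs (AddCommGroup (homs M N))
  add_comp _ _ _ _ _ g := Subtype.ext (LinearMap.comp_add _ _ g.1)
  comp_add _ _ _ f _ _ := Subtype.ext (LinearMap.add_comp f.1 _ _)

instance : Linear k (HopfBimodule k A) where
  homModule M N := inferInstanceAs (Module k (homs M N))
  smul_comp _ _ _ _ _ g := Subtype.ext (LinearMap.comp_smul g.1 _ _)
  comp_smul _ _ _ f _ _ := Subtype.ext (LinearMap.smul_comp _ _ f.1)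

/-- The linear map underlying a morphism. -/
def lin {M N : HopfBimodule k A} (f : M ⟶ N) : M.carrier →ₗ[k] N.carrier := f.1

/-- A linear map commuting with the four structures, as a morphism. -/
def mkHom {M N : HopfBimodule k A} (f : M.carrier →ₗ[k] N.carrier)
    (h1 : ∀ a m, f (M.lact a m) = N.lact a (f m)) (h2 : ∀ a m, f (M.ract a m) = N.ract a (f m))
    (h3 : ∀ m, LinearMap.lTensor A f (M.lcoact m) = N.lcoact (f m))
    (h4 : ∀ m, LinearMap.rTensor A f (M.rcoact m) = N.rcoact (f m)) : M ⟶ N := ⟨f, h1, h2, h3, h4⟩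

@[ext] lemma hom_ext {M N : HopfBimodule k A} {f g : M ⟶ N} (h : ∀ m, lin f m = lin g m) : f = g :=
  Subtype.ext (LinearMap.ext h)

@[simp] lemma lin_mkHom {M N : HopfBimodule k A} (f : M.carrier →ₗ[k] N.carrier) (h1 h2 h3 h4) :
    lin (mkHom (M := M) (N := N) f h1 h2 h3 h4) = f := rfl
@[simp] lemma lin_id (M : HopfBimodule k A) : lin (𝟙 M) = LinearMap.id := rfl
@[simp] lemma lin_comp {M N P : HopfBimodule k A} (f : M ⟶ N) (g : N ⟶ P) :
    lin (f ≫ g) = lin g ∘ₗ lin f := rfl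
@[simp] lemma lin_add {M N : HopfBimodule k A} (f g : M ⟶ N) : lin (f + g) = lin f + lin g := rfl
@[simp] lemma lin_zero (M N : HopfBimodule k A) : lin (0 : M ⟶ N) = 0 := rfl
@[simp] lemma lin_neg {M N : HopfBimodule k A} (f : M ⟶ N) : lin (-f) = -lin f := rfl
@[simp] lemma lin_sub {M N : HopfBimodule k A} (f g : M ⟶ N) : lin (f - g) = lin f - lin g := rfl
@[simp] lemma lin_smul {M N : HopfBimodule k A} (c : k) (f : M ⟶ N) : lin (c • f) = c • lin f := rfl

section
variable {M N : HopfBimodule k A} (f : M ⟶ N)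
lemma lin_lact (a : A) (m : M.carrier) : lin f (M.lact a m) = N.lact a (lin f m) := f.2.1 a m
lemma lin_ract (a : A) (m : M.carrier) : lin f (M.ract a m) = N.ract a (lin f m) := f.2.2.1 a m
lemma lin_lcoact (m : M.carrier) : LinearMap.lTensor A (lin f) (M.lcoact m) = N.lcoact (lin f m) :=
  f.2.2.2.1 m
lemma lin_rcoact (m : M.carrier) : LinearMap.rTensor A (lin f) (M.rcoact m) = N.rcoact (lin f m) :=
  f.2.2.2.2 m
end

variable (k A) in
/-- The vector space underlying a Hopf bimodule. -/
def forgetToVec : HopfBimodule k A ⥤ ModuleCat.{u} k where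
  obj M := ModuleCat.of k M.carrier
  map f := ModuleCat.ofHom (lin f)

instance : (forgetToVec k A).Additive where

/-- `l ↦ (m ↦ ∑ l(m₍₋₁₎) m₍₀₎)`. -/
def lamAct (M : HopfBimodule k A) : Module.Dual k A →ₗ[k] Module.End k M.carrier :=
  (LinearMap.llcomp k _ _ _ (TensorProduct.lid k M.carrier).toLinearMap) ∘ₗ
    (LinearMap.lcomp k _ M.lcoact) ∘ₗ LinearMap.rTensorHom M.carrier

/-- `κ ↦ (m ↦ ∑ κ(m₍₁₎) m₍₀₎)`. -/
def kapAct (M : HopfBimodule k A) : Module.Dual k A →ₗ[k] Module.End k M.carrier :=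
  (LinearMap.llcomp k _ _ _ (TensorProduct.rid k M.carrier).toLinearMap) ∘ₗ
    (LinearMap.lcomp k _ M.rcoact) ∘ₗ LinearMap.lTensorHom M.carrier

lemma lamAct_apply (M : HopfBimodule k A) (l : Module.Dual k A) (m : M.carrier) :
    M.lamAct l m = TensorProduct.lid k _ (LinearMap.rTensor M.carrier l (M.lcoact m)) := rfl

lemma kapAct_apply (M : HopfBimodule k A) (l : Module.Dual k A) (m : M.carrier) :
    M.kapAct l m = TensorProduct.rid k _ (LinearMap.lTensor M.carrier l (M.rcoact m)) := rfl

end HopfBimodule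
end CRHopf

namespace CRHopf
namespace HopfBimodule
variable {k A : Type u} [Field k] [Ring A] [HopfAlgebra k A]
local notation "S" => HopfAlgebra.antipode k (A := A)
local notation "S'" => antipodeInv k A
local notation "δ" => Coalgebra.comul (R := k) (A := A)
local notation "ε" => Coalgebra.counit (R := k) (A := A)

section
variable (M : HopfBimodule k A)

lemma lamAct_lamAct (l l' : Module.Dual k A) (m : M.carrier) :
    M.lamAct l (M.lamAct l' m) = M.lamAct (dualMul k A l' l) m := by
  have h1 : ∀ t : A ⊗[k] M.carrier, M.lamAct l (TensorProduct.lid k _ (LinearMap.rTensor _ l' t)) =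
      TensorProduct.lid k _ (LinearMap.rTensor _ (LinearMap.mul' k k ∘ₗ TensorProduct.map l' l)
        ((TensorProduct.assoc k A A M.carrier).symm (LinearMap.lTensor A M.lcoact t))) := by
    intro t
    induction t with
    | zero => simp
    | add a b ha hb => simp only [map_add, ha, hb]
    | tmul x m =>
      simp only [LinearMap.rTensor_tmul, LinearMap.lTensor_tmul, TensorProduct.lid_tmul, map_smul,
        lamAct_apply]
      induction M.lcoact m with
      | zero => simp
      | add a b ha hb => simp only [map_add, TensorProduct.tmul_add, smul_add, ha, hb]
      | tmul y z => simp [smul_smul]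
  rw [M.lamAct_apply l', h1, ← M.coassoc_lcoact, LinearEquiv.symm_apply_apply,
    ← LinearMap.rTensor_comp_apply]
  rfl

lemma kapAct_kapAct (l l' : Module.Dual k A) (m : M.carrier) :
    M.kapAct l (M.kapAct l' m) = M.kapAct (dualMul k A l l') m := by
  have h1 : ∀ t : M.carrier ⊗[k] A, M.kapAct l (TensorProduct.rid k _ (LinearMap.lTensor _ l' t)) =
      TensorProduct.rid k _ (LinearMap.lTensor _ (LinearMap.mul' k k ∘ₗ TensorProduct.map l l')
        (TensorProduct.assoc k M.carrier A A (LinearMap.rTensor A M.rcoact t))) := by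
    intro t
    induction t with
    | zero => simp
    | add a b ha hb => simp only [map_add, ha, hb]
    | tmul m x =>
      simp only [LinearMap.rTensor_tmul, LinearMap.lTensor_tmul, TensorProduct.rid_tmul, map_smul,
        kapAct_apply]
      induction M.rcoact m with
      | zero => simp
      | add a b ha hb => simp only [map_add, TensorProduct.add_tmul, smul_add, ha, hb]
      | tmul y z => simp [smul_smul, mul_comm]
  rw [M.kapAct_apply l', h1, M.coassoc_rcoact, ← LinearMap.lTensor_comp_apply]
  rfl

lemma lamAct_kapAct (l κ : Module.Dual k A) (m : M.carrier) :
    M.kapAct κ (M.lamAct l m) = M.lamAct l (M.kapAct κ m) := by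
  have h1 : ∀ t : A ⊗[k] M.carrier, M.kapAct κ (TensorProduct.lid k _ (LinearMap.rTensor _ l t)) =
      TensorProduct.lid k _ (TensorProduct.map l ((TensorProduct.rid k _).toLinearMap ∘ₗ
        LinearMap.lTensor _ κ) (LinearMap.lTensor A M.rcoact t)) := by
    intro t
    induction t with
    | zero => simp
    | add a b ha hb => simp only [map_add, ha, hb]
    | tmul x m => simp [kapAct_apply]
  have h2 : ∀ t : M.carrier ⊗[k] A, M.lamAct l (TensorProduct.rid k _ (LinearMap.lTensor _ κ t)) =
      TensorProduct.lid k _ (TensorProduct.map l ((TensorProduct.rid k _).toLinearMap ∘ₗ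
        LinearMap.lTensor _ κ) (TensorProduct.assoc k A M.carrier A
          (LinearMap.rTensor A M.lcoact t))) := by
    intro t
    induction t with
    | zero => simp
    | add a b ha hb => simp only [map_add, ha, hb]
    | tmul m x =>
      simp only [LinearMap.rTensor_tmul, LinearMap.lTensor_tmul, TensorProduct.rid_tmul, map_smul,
        lamAct_apply]
      induction M.lcoact m with
      | zero => simp
      | add a b ha hb => simp only [map_add, TensorProduct.add_tmul, smul_add, ha, hb]
      | tmul y z => simp [smul_smul, mul_comm]
  rw [M.lamAct_apply l, h1, M.kapAct_apply κ, h2, M.lcoact_rcoact]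

variable [FiniteDimensional k A]

set_option maxHeartbeats 800000 in
lemma crRep : CRRep M.lamAct M.kapAct M.lact M.ract where
  lam_one := LinearMap.ext M.counit_lcoact
  kap_one := LinearMap.ext M.counit_rcoact
  alp_one := LinearMap.ext M.lact_one
  bet_one := LinearMap.ext M.ract_one
  lam_mul l l' := LinearMap.ext fun m => M.lamAct_lamAct l l' m
  kap_mul l l' := LinearMap.ext fun m => M.kapAct_kapAct l l' m
  alp_mul a b := LinearMap.ext fun m => (M.lact_mul a b m).symm
  bet_mul a b := LinearMap.ext fun m => (M.ract_mul b a m).symm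
  lam_kap l κ := LinearMap.ext fun m => M.lamAct_kapAct l κ m
  alp_bet a b := LinearMap.ext fun m => M.ract_lact a b m
  alp_lam a l := by
    refine LinearMap.ext fun m => ?_
    have h1 : ∀ (x : A) (s : A ⊗[k] A) (t : A ⊗[k] M.carrier), TensorProduct.lid k _
        (LinearMap.rTensor _ (l ∘ₗ LinearMap.mulLeft k (S x))
          (TensorProduct.map₂ (LinearMap.mul k A) M.lact s t)) =
        TensorProduct.lid k _ (LinearMap.rTensor _ l (TensorProduct.map₂ (LinearMap.mul k A) M.lact
          (LinearMap.rTensor A (LinearMap.mul' k A ∘ₗ LinearMap.rTensor A S)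
            ((TensorProduct.assoc k A A A).symm (x ⊗ₜ s))) t)) := by
      intro x s t
      induction s with
      | zero => simp
      | add a b ha hb => simp only [map_add, LinearMap.add_apply, TensorProduct.tmul_add, ha, hb]
      | tmul y z =>
      induction t with
      | zero => simp
      | add a b ha hb => simp only [map_add, ha, hb]
      | tmul c n => simp [mul_assoc]
    have h2 : ∀ t : A ⊗[k] M.carrier, TensorProduct.lid k _ (LinearMap.rTensor _ l
        (TensorProduct.map₂ (LinearMap.mul k A) M.lact (1 ⊗ₜ a) t)) =
        M.lact a (TensorProduct.lid k _ (LinearMap.rTensor _ l t)) := by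
      intro t
      induction t with
      | zero => simp
      | add a b ha hb => simp only [map_add, ha, hb]
      | tmul c n => simp
    rw [Module.End.mul_apply, M.lamAct_apply, ← h2,
      ← cancel_left (f := LinearMap.mul' k A ∘ₗ LinearMap.rTensor A S)
        (HopfAlgebra.mul_antipode_rTensor_comul_apply (R := k)) a, comul₃,
      LinearMap.comp_apply]
    rw [← (ℛ k a).eq]
    simp only [map_sum, TensorProduct.map_tmul, LinearMap.mul'_apply, LinearMap.sum_apply,
      LinearMap.lTensor_tmul]
    refine Finset.sum_congr rfl fun i _ => ?_
    refine (h1 _ _ _).symm.trans ?_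
    rw [← M.lcoact_lact]
    rfl
  alp_kap a κ := by
    refine LinearMap.ext fun m => ?_
    have h1 : ∀ (x : A) (s : A ⊗[k] A) (t : M.carrier ⊗[k] A), TensorProduct.rid k _
        (LinearMap.lTensor _ (κ ∘ₗ LinearMap.mulLeft k (S' x))
          (TensorProduct.map₂ M.lact (LinearMap.mul k A) s t)) =
        TensorProduct.rid k _ (LinearMap.lTensor _ κ (TensorProduct.map₂ M.lact (LinearMap.mul k A)
          (LinearMap.lTensor A (LinearMap.mul' k A ∘ₗ (TensorProduct.comm k A A).toLinearMap ∘ₗ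
            LinearMap.lTensor A S') (TensorProduct.assoc k A A A (s ⊗ₜ x))) t)) := by
      intro x s t
      induction s with
      | zero => simp
      | add a b ha hb => simp only [map_add, LinearMap.add_apply, TensorProduct.add_tmul, ha, hb]
      | tmul y z =>
      induction t with
      | zero => simp
      | add a b ha hb => simp only [map_add, ha, hb]
      | tmul c n => simp [mul_assoc]
    have h2 : ∀ t : M.carrier ⊗[k] A, TensorProduct.rid k _ (LinearMap.lTensor _ κ
        (TensorProduct.map₂ M.lact (LinearMap.mul k A) (a ⊗ₜ 1) t)) =
        M.lact a (TensorProduct.rid k _ (LinearMap.lTensor _ κ t)) := by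
      intro t
      induction t with
      | zero => simp
      | add a b ha hb => simp only [map_add, ha, hb]
      | tmul c n => simp
    rw [Module.End.mul_apply, M.kapAct_apply, ← h2,
      ← cancel_right mul_antipodeInv_lTensor a, comul₃,
      LinearMap.comp_apply, ← Coalgebra.coassoc_apply]
    rw [← (ℛ k a).eq]
    simp only [map_sum, TensorProduct.map_tmul, LinearMap.mul'_apply, LinearMap.sum_apply,
      LinearMap.rTensor_tmul, TensorProduct.comm_tmul]
    refine Finset.sum_congr rfl fun i _ => ?_
    refine (h1 _ _ _).symm.trans ?_
    rw [← M.rcoact_lact]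
    rfl
  bet_lam a l := by
    refine LinearMap.ext fun m => ?_
    have h1 : ∀ (x : A) (s : A ⊗[k] A) (t : A ⊗[k] M.carrier), TensorProduct.lid k _
        (LinearMap.rTensor _ (l ∘ₗ LinearMap.mulRight k (S' x))
          (TensorProduct.map₂ (LinearMap.mul k A).flip M.ract s t)) =
        TensorProduct.lid k _ (LinearMap.rTensor _ l
          (TensorProduct.map₂ (LinearMap.mul k A).flip M.ract
          (LinearMap.rTensor A (LinearMap.mul' k A ∘ₗ (TensorProduct.comm k A A).toLinearMap ∘ₗ
            LinearMap.rTensor A S') ((TensorProduct.assoc k A A A).symm (x ⊗ₜ s))) t)) := by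
      intro x s t
      induction s with
      | zero => simp
      | add a b ha hb => simp only [map_add, LinearMap.add_apply, TensorProduct.tmul_add, ha, hb]
      | tmul y z =>
      induction t with
      | zero => simp
      | add a b ha hb => simp only [map_add, ha, hb]
      | tmul c n => simp [mul_assoc]
    have h2 : ∀ t : A ⊗[k] M.carrier, TensorProduct.lid k _ (LinearMap.rTensor _ l
        (TensorProduct.map₂ (LinearMap.mul k A).flip M.ract (1 ⊗ₜ a) t)) =
        M.ract a (TensorProduct.lid k _ (LinearMap.rTensor _ l t)) := by
      intro t
      induction t with
      | zero => simp
      | add a b ha hb => simp only [map_add, ha, hb]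
      | tmul c n => simp
    rw [Module.End.mul_apply, M.lamAct_apply, ← h2,
      ← cancel_left mul_antipodeInv_rTensor a, comul₃, LinearMap.comp_apply]
    rw [← (ℛ k a).eq]
    simp only [map_sum, TensorProduct.map_tmul, LinearMap.mul'_apply, LinearMap.sum_apply,
      LinearMap.lTensor_tmul]
    refine Finset.sum_congr rfl fun i _ => ?_
    refine (h1 _ _ _).symm.trans ?_
    rw [← M.lcoact_ract]
    rfl
  bet_kap a κ := by
    refine LinearMap.ext fun m => ?_
    have h1 : ∀ (x : A) (s : A ⊗[k] A) (t : M.carrier ⊗[k] A), TensorProduct.rid k _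
        (LinearMap.lTensor _ (κ ∘ₗ LinearMap.mulRight k (S x))
          (TensorProduct.map₂ M.ract (LinearMap.mul k A).flip s t)) =
        TensorProduct.rid k _ (LinearMap.lTensor _ κ
          (TensorProduct.map₂ M.ract (LinearMap.mul k A).flip
          (LinearMap.lTensor A (LinearMap.mul' k A ∘ₗ
            LinearMap.lTensor A S) (TensorProduct.assoc k A A A (s ⊗ₜ x))) t)) := by
      intro x s t
      induction s with
      | zero => simp
      | add a b ha hb => simp only [map_add, LinearMap.add_apply, TensorProduct.add_tmul, ha, hb]
      | tmul y z =>
      induction t with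
      | zero => simp
      | add a b ha hb => simp only [map_add, ha, hb]
      | tmul c n => simp [mul_assoc]
    have h2 : ∀ t : M.carrier ⊗[k] A, TensorProduct.rid k _ (LinearMap.lTensor _ κ
        (TensorProduct.map₂ M.ract (LinearMap.mul k A).flip (a ⊗ₜ 1) t)) =
        M.ract a (TensorProduct.rid k _ (LinearMap.lTensor _ κ t)) := by
      intro t
      induction t with
      | zero => simp
      | add a b ha hb => simp only [map_add, ha, hb]
      | tmul c n => simp
    rw [Module.End.mul_apply, M.kapAct_apply, ← h2,
      ← cancel_right (f := LinearMap.mul' k A ∘ₗ LinearMap.lTensor A S)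
        (HopfAlgebra.mul_antipode_lTensor_comul_apply (R := k)) a, comul₃,
      LinearMap.comp_apply, ← Coalgebra.coassoc_apply]
    rw [← (ℛ k a).eq]
    simp only [map_sum, TensorProduct.map_tmul, LinearMap.mul'_apply, LinearMap.sum_apply,
      LinearMap.rTensor_tmul, TensorProduct.comm_tmul]
    refine Finset.sum_congr rfl fun i _ => ?_
    refine (h1 _ _ _).symm.trans ?_
    rw [← M.rcoact_ract]
    rfl

/-- The action of `X` on a Hopf bimodule: `(l ⊗ κ) ⊗ (a ⊗ b)` acts by
`m ↦ ∑ l((a m b)₍₋₁₎) κ((a m b)₍₁₎) (a m b)₍₀₎`. -/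
noncomputable def xAction : CibilsRosso k A →+* Module.End k M.carrier where
  toFun := repMap M.lamAct M.kapAct M.lact M.ract
  map_one' := M.crRep.repMap_crOne
  map_mul' := M.crRep.repMap_crMul
  map_zero' := map_zero _
  map_add' := map_add _

noncomputable instance : Module (CibilsRosso k A) M.carrier :=
  Module.compHom M.carrier M.xAction

lemma crTmul_smul (l κ : Module.Dual k A) (a b : A) (m : M.carrier) :
    crTmul k A l κ a b • m = M.lamAct l (M.kapAct κ (M.lact a (M.ract b m))) := rfl
end

section
variable [FiniteDimensional k A]

lemma lin_smul_x {M N : HopfBimodule k A} (f : M ⟶ N) (x : CibilsRosso k A) (m : M.carrier) :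
    lin f (x • m) = x • lin f m := by
  have e : ((LinearMap.llcomp k M.carrier _ _ (lin f)) ∘ₗ
      repMap M.lamAct M.kapAct M.lact M.ract : CRSpace k A →ₗ[k] _) =
      (LinearMap.lcomp k _ (lin f)) ∘ₗ repMap N.lamAct N.kapAct N.lact N.ract := by
    apply CRSpace.ext_hom
    intro l κ a b
    refine LinearMap.ext fun m => ?_
    change lin f (M.lamAct l (M.kapAct κ (M.lact a (M.ract b m)))) =
      N.lamAct l (N.kapAct κ (N.lact a (N.ract b (lin f m))))
    rw [← lin_ract, ← lin_lact, N.kapAct_apply, ← lin_rcoact, N.lamAct_apply]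
    have h1 : ∀ m, lin f (M.kapAct κ m) = TensorProduct.rid k _
        (LinearMap.lTensor _ κ (LinearMap.rTensor A (lin f) (M.rcoact m))) := by
      intro m
      rw [M.kapAct_apply]
      induction M.rcoact m with
      | zero => simp
      | add a b ha hb => simp only [map_add, ha, hb]
      | tmul c n => simp
    have h2 : ∀ m, lin f (M.lamAct l m) = TensorProduct.lid k _
        (LinearMap.rTensor _ l (LinearMap.lTensor A (lin f) (M.lcoact m))) := by
      intro m
      rw [M.lamAct_apply]
      induction M.lcoact m with
      | zero => simp
      | add a b ha hb => simp only [map_add, ha, hb]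
      | tmul c n => simp
    rw [← h1, ← lin_lcoact, h2]
  exact LinearMap.congr_fun (LinearMap.congr_fun e x) m

variable (k A) in
/-- Hopf bimodules viewed as left modules over the Cibils–Rosso algebra. -/
noncomputable def toX : HopfBimodule k A ⥤ ModuleCat.{u} (CibilsRosso k A) where
  obj M := ModuleCat.of (CibilsRosso k A) M.carrier
  map f := ModuleCat.ofHom { toFun := lin f, map_add' := map_add _, map_smul' := lin_smul_x f }

instance : (toX k A).Additive where

end
end HopfBimodule
end CRHopf

namespace CRHopf

section Generic
variable {k : Type u} [CommSemiring k]
variable {X₁ X₂ X₃ Y₁ Y₂ Y₃ Z₁ Z₂ Z₃ U₁ U₂ W₁ W₂ V₁ V₂ : Type u}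
variable [AddCommMonoid X₁] [AddCommMonoid X₂] [AddCommMonoid X₃] [AddCommMonoid Y₁] [AddCommMonoid Y₂]
  [AddCommMonoid Y₃] [AddCommMonoid Z₁] [AddCommMonoid Z₂] [AddCommMonoid Z₃] [AddCommMonoid U₁]
  [AddCommMonoid U₂] [AddCommMonoid W₁] [AddCommMonoid W₂] [AddCommMonoid V₁] [AddCommMonoid V₂]
  [Module k X₁] [Module k X₂] [Module k X₃] [Module k Y₁] [Module k Y₂] [Module k Y₃] [Module k Z₁]
  [Module k Z₂] [Module k Z₃] [Module k U₁] [Module k U₂] [Module k W₁] [Module k W₂] [Module k V₁]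
  [Module k V₂]

lemma map₂_flip (f : X₁ →ₗ[k] Y₁ →ₗ[k] Z₁) (g : X₂ →ₗ[k] Y₂ →ₗ[k] Z₂) (s : X₁ ⊗[k] X₂)
    (t : Y₁ ⊗[k] Y₂) : TensorProduct.map₂ f g s t = TensorProduct.map₂ f.flip g.flip t s := by
  refine s.induction_on (by simp) (fun x x' => ?_) fun _ _ ha hb => by
    simp only [map_add, LinearMap.add_apply, ha, hb]
  refine t.induction_on (by simp) (fun y y' => ?_) fun _ _ ha hb => by
    simp only [map_add, LinearMap.add_apply, ha, hb]
  simp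

lemma map₂_map₂ {f : U₁ →ₗ[k] Z₁ →ₗ[k] W₁} {g : U₂ →ₗ[k] Z₂ →ₗ[k] W₂} {f₁ : X₁ →ₗ[k] Y₁ →ₗ[k] U₁}
    {g₁ : X₂ →ₗ[k] Y₂ →ₗ[k] U₂} {f₂ : X₁ →ₗ[k] V₁ →ₗ[k] W₁} {g₂ : X₂ →ₗ[k] V₂ →ₗ[k] W₂}
    {f₃ : Y₁ →ₗ[k] Z₁ →ₗ[k] V₁} {g₃ : Y₂ →ₗ[k] Z₂ →ₗ[k] V₂}
    (hf : ∀ x y z, f (f₁ x y) z = f₂ x (f₃ y z)) (hg : ∀ x y z, g (g₁ x y) z = g₂ x (g₃ y z))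
    (p : X₁ ⊗[k] X₂) (q : Y₁ ⊗[k] Y₂) (r : Z₁ ⊗[k] Z₂) :
    TensorProduct.map₂ f g (TensorProduct.map₂ f₁ g₁ p q) r =
      TensorProduct.map₂ f₂ g₂ p (TensorProduct.map₂ f₃ g₃ q r) := by
  refine p.induction_on (by simp) (fun x x' => ?_) fun _ _ ha hb => by
    simp only [map_add, LinearMap.add_apply, ha, hb]
  refine q.induction_on (by simp) (fun y y' => ?_) fun _ _ ha hb => by
    simp only [map_add, LinearMap.add_apply, ha, hb]
  refine r.induction_on (by simp) (fun z z' => ?_) fun _ _ ha hb => by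
    simp only [map_add, ha, hb]
  simp [hf, hg]

lemma map_map₂ {f : X₁ →ₗ[k] Y₁ →ₗ[k] Z₁} {g : X₂ →ₗ[k] Y₂ →ₗ[k] Z₂} {φ : Z₁ →ₗ[k] W₁}
    {ψ : Z₂ →ₗ[k] W₂} {φ₁ : X₁ →ₗ[k] U₁} {ψ₁ : X₂ →ₗ[k] U₂} {φ₂ : Y₁ →ₗ[k] V₁} {ψ₂ : Y₂ →ₗ[k] V₂}
    {f' : U₁ →ₗ[k] V₁ →ₗ[k] W₁} {g' : U₂ →ₗ[k] V₂ →ₗ[k] W₂}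
    (hf : ∀ x y, φ (f x y) = f' (φ₁ x) (φ₂ y)) (hg : ∀ x y, ψ (g x y) = g' (ψ₁ x) (ψ₂ y))
    (s : X₁ ⊗[k] X₂) (t : Y₁ ⊗[k] Y₂) : TensorProduct.map φ ψ (TensorProduct.map₂ f g s t) =
      TensorProduct.map₂ f' g' (TensorProduct.map φ₁ ψ₁ s) (TensorProduct.map φ₂ ψ₂ t) := by
  refine s.induction_on (by simp) (fun x x' => ?_) fun _ _ ha hb => by
    simp only [map_add, LinearMap.add_apply, ha, hb]
  refine t.induction_on (by simp) (fun y y' => ?_) fun _ _ ha hb => by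
    simp only [map_add, ha, hb]
  simp [hf, hg]

lemma rTensor_map₂ (f : X₁ →ₗ[k] Y₁ →ₗ[k] Z₁) {g : X₂ →ₗ[k] Y₂ →ₗ[k] Z₂} {φ : Z₁ →ₗ[k] W₁}
    {φ₁ : X₁ →ₗ[k] U₁} {φ₂ : Y₁ →ₗ[k] V₁} {f' : U₁ →ₗ[k] V₁ →ₗ[k] W₁}
    (hf : ∀ x y, φ (f x y) = f' (φ₁ x) (φ₂ y)) (s : X₁ ⊗[k] X₂) (t : Y₁ ⊗[k] Y₂) :
    LinearMap.rTensor Z₂ φ (TensorProduct.map₂ f g s t) =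
      TensorProduct.map₂ f' g (LinearMap.rTensor X₂ φ₁ s) (LinearMap.rTensor Y₂ φ₂ t) :=
  map_map₂ hf (fun _ _ => rfl) s t

lemma lTensor_map₂ {f : X₁ →ₗ[k] Y₁ →ₗ[k] Z₁} (g : X₂ →ₗ[k] Y₂ →ₗ[k] Z₂) {ψ : Z₂ →ₗ[k] W₂}
    {ψ₁ : X₂ →ₗ[k] U₂} {ψ₂ : Y₂ →ₗ[k] V₂} {g' : U₂ →ₗ[k] V₂ →ₗ[k] W₂}
    (hg : ∀ x y, ψ (g x y) = g' (ψ₁ x) (ψ₂ y)) (s : X₁ ⊗[k] X₂) (t : Y₁ ⊗[k] Y₂) :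
    LinearMap.lTensor Z₁ ψ (TensorProduct.map₂ f g s t) =
      TensorProduct.map₂ f g' (LinearMap.lTensor X₁ ψ₁ s) (LinearMap.lTensor Y₁ ψ₂ t) :=
  map_map₂ (fun _ _ => rfl) hg s t

lemma assoc_map₂ (f : X₁ →ₗ[k] Y₁ →ₗ[k] Z₁) (g : X₂ →ₗ[k] Y₂ →ₗ[k] Z₂) (h : X₃ →ₗ[k] Y₃ →ₗ[k] Z₃)
    (s : (X₁ ⊗[k] X₂) ⊗[k] X₃) (t : (Y₁ ⊗[k] Y₂) ⊗[k] Y₃) :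
    TensorProduct.assoc k Z₁ Z₂ Z₃ (TensorProduct.map₂ (TensorProduct.map₂ f g) h s t) =
      TensorProduct.map₂ f (TensorProduct.map₂ g h) (TensorProduct.assoc k X₁ X₂ X₃ s)
        (TensorProduct.assoc k Y₁ Y₂ Y₃ t) := by
  refine s.induction_on (by simp) (fun x x₃ => ?_) fun _ _ ha hb => by
    simp only [map_add, LinearMap.add_apply, ha, hb]
  refine x.induction_on (by simp) (fun x₁ x₂ => ?_) fun _ _ ha hb => by
    simp only [map_add, LinearMap.add_apply, add_tmul, ha, hb]
  refine t.induction_on (by simp) (fun y y₃ => ?_) fun _ _ ha hb => by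
    simp only [map_add, ha, hb]
  refine y.induction_on (by simp) (fun y₁ y₂ => ?_) fun _ _ ha hb => by
    simp only [map_add, add_tmul, ha, hb]
  simp

lemma map₂_comp_left (f : X₁ →ₗ[k] Y₁ →ₗ[k] Z₁) (g : X₂ →ₗ[k] Y₂ →ₗ[k] Z₂) (φ : W₁ →ₗ[k] X₁)
    (s : W₁ ⊗[k] X₂) :
    TensorProduct.map₂ (f ∘ₗ φ) g s = TensorProduct.map₂ f g (LinearMap.rTensor X₂ φ s) := by
  refine s.induction_on (by simp) (fun x x' => by simp) fun _ _ ha hb => by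
    simp only [map_add, ha, hb]

lemma map₂_comp_right (f : X₁ →ₗ[k] Y₁ →ₗ[k] Z₁) (g : X₂ →ₗ[k] Y₂ →ₗ[k] Z₂) (φ : W₂ →ₗ[k] X₂)
    (s : X₁ ⊗[k] W₂) :
    TensorProduct.map₂ f (g ∘ₗ φ) s = TensorProduct.map₂ f g (LinearMap.lTensor X₁ φ s) := by
  refine s.induction_on (by simp) (fun x x' => by simp) fun _ _ ha hb => by
    simp only [map_add, ha, hb]

variable {A : Type u} [Semiring A] [Bialgebra k A]

lemma comul_mul_map₂ (x y : A) : Coalgebra.comul (R := k) (LinearMap.mul k A x y) =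
    TensorProduct.map₂ (LinearMap.mul k A) (LinearMap.mul k A) (Coalgebra.comul (R := k) x)
      (Coalgebra.comul (R := k) y) := by
  rw [LinearMap.mul_apply', Bialgebra.comul_mul]
  refine (Coalgebra.comul (R := k) x).induction_on (by simp) (fun x x' => ?_) fun _ _ ha hb => by
    simp only [map_add, LinearMap.add_apply, add_mul, ha, hb]
  exact (Coalgebra.comul (R := k) y).induction_on (by simp) (fun y y' => by simp) fun _ _ ha hb => by
    simp only [map_add, mul_add, ha, hb]

lemma comul_mul_map₂_flip (x y : A) : Coalgebra.comul (R := k) (LinearMap.mul k A x y) =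
    TensorProduct.map₂ (LinearMap.mul k A).flip (LinearMap.mul k A).flip
      (Coalgebra.comul (R := k) y) (Coalgebra.comul (R := k) x) := by
  rw [comul_mul_map₂, map₂_flip]

end Generic

namespace HopfBimodule
variable {k A : Type u} [Field k] [Ring A] [HopfAlgebra k A]
local notation "δ" => Coalgebra.comul (R := k) (A := A)
local notation "ε" => Coalgebra.counit (R := k) (A := A)

section Bar
variable (M : HopfBimodule k A)

/-- `m ⊗ a ↦ ∑ m₍₋₁₎ a₍₁₎ ⊗ (m₍₀₎ ⊗ a₍₂₎)`. -/
def tenLcoact : M.carrier ⊗[k] A →ₗ[k] A ⊗[k] (M.carrier ⊗[k] A) :=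
  TensorProduct.lift ((TensorProduct.map₂ (LinearMap.mul k A)
    (TensorProduct.mk k M.carrier A)).compl₁₂ M.lcoact δ)

/-- `m ⊗ a ↦ ∑ (m₍₀₎ ⊗ a₍₁₎) ⊗ m₍₁₎ a₍₂₎`. -/
def tenRcoact : M.carrier ⊗[k] A →ₗ[k] (M.carrier ⊗[k] A) ⊗[k] A :=
  TensorProduct.lift ((TensorProduct.map₂ (TensorProduct.mk k M.carrier A)
    (LinearMap.mul k A)).compl₁₂ M.rcoact δ)

lemma tenLcoact_tmul (m : M.carrier) (a : A) : M.tenLcoact (m ⊗ₜ a) = TensorProduct.map₂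
    (LinearMap.mul k A) (TensorProduct.mk k M.carrier A) (M.lcoact m) (δ a) := rfl

lemma tenRcoact_tmul (m : M.carrier) (a : A) : M.tenRcoact (m ⊗ₜ a) = TensorProduct.map₂
    (TensorProduct.mk k M.carrier A) (LinearMap.mul k A) (M.rcoact m) (δ a) := rfl

/-- Linear maps on `M ⊗ A` are equal if they agree on pure tensors. -/
lemma ten_ext {M₁ M₂ W : Type u} [AddCommMonoid M₁] [Module k M₁] [AddCommMonoid M₂]
    [Module k M₂] [AddCommMonoid W] [Module k W] {f g : M₁ ⊗[k] M₂ →ₗ[k] W}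
    (h : ∀ m a, f (m ⊗ₜ a) = g (m ⊗ₜ a)) (t) : f t = g t :=
  LinearMap.congr_fun (TensorProduct.ext' h) t

set_option maxHeartbeats 1600000 in
/-- The Hopf bimodule `M ⊗ A`, with the standard actions `b (m ⊗ a) c = bm ⊗ ac` and the codiagonal
coactions. -/
def tenObj : HopfBimodule k A where
  carrier := M.carrier ⊗[k] A
  lact := LinearMap.rTensorHom A ∘ₗ M.lact
  ract := LinearMap.lTensorHom M.carrier ∘ₗ (LinearMap.mul k A).flip
  lcoact := M.tenLcoact
  rcoact := M.tenRcoact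
  lact_one := ten_ext (g := LinearMap.id) fun m x => by simp [M.lact_one]
  lact_mul a b := ten_ext (g := LinearMap.rTensor A (M.lact a) ∘ₗ LinearMap.rTensor A (M.lact b))
    fun m x => by simp [M.lact_mul]
  ract_one := ten_ext (g := LinearMap.id) fun m x => by simp
  ract_mul a b := ten_ext (g := LinearMap.lTensor M.carrier (LinearMap.mulRight k b) ∘ₗ
    LinearMap.lTensor M.carrier (LinearMap.mulRight k a)) fun m x => by simp [mul_assoc]
  ract_lact a b := ten_ext (f := LinearMap.lTensor M.carrier (LinearMap.mulRight k b) ∘ₗ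
    LinearMap.rTensor A (M.lact a)) (g := LinearMap.rTensor A (M.lact a) ∘ₗ
      LinearMap.lTensor M.carrier (LinearMap.mulRight k b)) fun m x => by simp
  counit_lcoact := ten_ext (f := (TensorProduct.lid k _).toLinearMap ∘ₗ LinearMap.rTensor _ ε ∘ₗ
      M.tenLcoact) (g := LinearMap.id) fun m a => by
    have h : ∀ s r, TensorProduct.lid k _ (LinearMap.rTensor _ ε (TensorProduct.map₂
        (LinearMap.mul k A) (TensorProduct.mk k M.carrier A) s r)) =
          TensorProduct.lid k _ (LinearMap.rTensor _ ε s) ⊗ₜ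
            TensorProduct.lid k _ (LinearMap.rTensor _ ε r) := by
      intro s r
      refine s.induction_on (by simp) (fun x x' => ?_) fun _ _ ha hb => by
        simp only [map_add, LinearMap.add_apply, add_tmul, ha, hb]
      refine r.induction_on (by simp) (fun z z' => ?_) fun _ _ ha hb => by
        simp only [map_add, tmul_add, ha, hb]
      simp [TensorProduct.smul_tmul, smul_smul, mul_comm]
    exact (h _ _).trans (by rw [M.counit_lcoact, Coalgebra.rTensor_counit_comul]; simp)
  coassoc_lcoact := ten_ext (f := (TensorProduct.assoc k A A _).toLinearMap ∘ₗ
      LinearMap.rTensor _ δ ∘ₗ M.tenLcoact) (g := LinearMap.lTensor A M.tenLcoact ∘ₗ M.tenLcoact)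
      fun m a => by
    simp only [LinearMap.comp_apply, LinearEquiv.coe_coe, tenLcoact_tmul]
    rw [rTensor_map₂ (LinearMap.mul k A) comul_mul_map₂, assoc_map₂,
      lTensor_map₂ (TensorProduct.mk k M.carrier A) M.tenLcoact_tmul, M.coassoc_lcoact,
      Coalgebra.coassoc_apply]
  counit_rcoact := ten_ext (f := (TensorProduct.rid k _).toLinearMap ∘ₗ LinearMap.lTensor _ ε ∘ₗ
      M.tenRcoact) (g := LinearMap.id) fun m a => by
    have h : ∀ s r, TensorProduct.rid k _ (LinearMap.lTensor _ ε (TensorProduct.map₂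
        (TensorProduct.mk k M.carrier A) (LinearMap.mul k A) s r)) =
          TensorProduct.rid k _ (LinearMap.lTensor _ ε s) ⊗ₜ
            TensorProduct.rid k _ (LinearMap.lTensor _ ε r) := by
      intro s r
      refine s.induction_on (by simp) (fun x x' => ?_) fun _ _ ha hb => by
        simp only [map_add, LinearMap.add_apply, add_tmul, ha, hb]
      refine r.induction_on (by simp) (fun z z' => ?_) fun _ _ ha hb => by
        simp only [map_add, tmul_add, ha, hb]
      simp [TensorProduct.smul_tmul, smul_smul, mul_comm]
    exact (h _ _).trans (by rw [M.counit_rcoact, Coalgebra.lTensor_counit_comul]; simp)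
  coassoc_rcoact := ten_ext (f := (TensorProduct.assoc k _ A A).toLinearMap ∘ₗ
      LinearMap.rTensor _ M.tenRcoact ∘ₗ M.tenRcoact) (g := LinearMap.lTensor _ δ ∘ₗ M.tenRcoact)
      fun m a => by
    simp only [LinearMap.comp_apply, LinearEquiv.coe_coe, tenRcoact_tmul]
    rw [rTensor_map₂ (TensorProduct.mk k M.carrier A) M.tenRcoact_tmul, assoc_map₂,
      lTensor_map₂ (LinearMap.mul k A) comul_mul_map₂, M.coassoc_rcoact,
      Coalgebra.coassoc_apply]
  lcoact_rcoact := ten_ext (f := (TensorProduct.assoc k A _ A).toLinearMap ∘ₗ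
      LinearMap.rTensor _ M.tenLcoact ∘ₗ M.tenRcoact)
      (g := LinearMap.lTensor _ M.tenRcoact ∘ₗ M.tenLcoact) fun m a => by
    simp only [LinearMap.comp_apply, LinearEquiv.coe_coe, tenRcoact_tmul, tenLcoact_tmul]
    rw [rTensor_map₂ (TensorProduct.mk k M.carrier A) M.tenLcoact_tmul, assoc_map₂,
      lTensor_map₂ (TensorProduct.mk k M.carrier A) M.tenRcoact_tmul, M.lcoact_rcoact,
      Coalgebra.coassoc_apply]
  lcoact_lact b := ten_ext (f := M.tenLcoact ∘ₗ LinearMap.rTensor A (M.lact b))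
    (g := TensorProduct.map₂ (LinearMap.mul k A) (LinearMap.rTensorHom A ∘ₗ M.lact) (δ b) ∘ₗ
      M.tenLcoact) fun m a => by
    rw [LinearMap.comp_apply, LinearMap.comp_apply, LinearMap.rTensor_tmul, tenLcoact_tmul,
      tenLcoact_tmul, M.lcoact_lact]
    exact map₂_map₂ (fun x y z => mul_assoc x y z) (fun _ _ _ => rfl) _ _ _
  lcoact_ract b := ten_ext (f := M.tenLcoact ∘ₗ LinearMap.lTensor _ (LinearMap.mulRight k b))
    (g := TensorProduct.map₂ (LinearMap.mul k A).flip
      (LinearMap.lTensorHom M.carrier ∘ₗ (LinearMap.mul k A).flip) (δ b) ∘ₗ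
      M.tenLcoact) fun m a => by
    rw [LinearMap.comp_apply, LinearMap.comp_apply, LinearMap.lTensor_tmul, tenLcoact_tmul,
      tenLcoact_tmul, LinearMap.mulRight_apply, ← LinearMap.mul_apply' (R := k), comul_mul_map₂,
      map₂_flip _ _ (δ b)]
    exact (map₂_map₂ (fun x y z => mul_assoc x y z) (fun _ _ _ => rfl) _ _ _).symm
  rcoact_lact b := ten_ext (f := M.tenRcoact ∘ₗ LinearMap.rTensor A (M.lact b))
    (g := TensorProduct.map₂ (LinearMap.rTensorHom A ∘ₗ M.lact) (LinearMap.mul k A) (δ b) ∘ₗ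
      M.tenRcoact) fun m a => by
    rw [LinearMap.comp_apply, LinearMap.comp_apply, LinearMap.rTensor_tmul, tenRcoact_tmul,
      tenRcoact_tmul, M.rcoact_lact]
    exact map₂_map₂ (fun _ _ _ => rfl) (fun x y z => mul_assoc x y z) _ _ _
  rcoact_ract b := ten_ext (f := M.tenRcoact ∘ₗ LinearMap.lTensor _ (LinearMap.mulRight k b))
    (g := TensorProduct.map₂ (LinearMap.lTensorHom M.carrier ∘ₗ (LinearMap.mul k A).flip)
      (LinearMap.mul k A).flip (δ b) ∘ₗ M.tenRcoact) fun m a => by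
    rw [LinearMap.comp_apply, LinearMap.comp_apply, LinearMap.lTensor_tmul, tenRcoact_tmul,
      tenRcoact_tmul, LinearMap.mulRight_apply, ← LinearMap.mul_apply' (R := k), comul_mul_map₂,
      map₂_flip _ _ (δ b)]
    exact (map₂_map₂ (fun _ _ _ => rfl) (fun x y z => mul_assoc x y z) _ _ _).symm

end Bar

section Cobar
variable (N : HopfBimodule k A)

/-- `c ⊗ n ↦ ∑ c₍₁₎ ⊗ (c₍₂₎ ⊗ n)`. -/
def cotLcoact : A ⊗[k] N.carrier →ₗ[k] A ⊗[k] (A ⊗[k] N.carrier) :=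
  (TensorProduct.assoc k A A N.carrier).toLinearMap ∘ₗ LinearMap.rTensor N.carrier δ

/-- `c ⊗ n ↦ ∑ (c ⊗ n₍₀₎) ⊗ n₍₁₎`. -/
def cotRcoact : A ⊗[k] N.carrier →ₗ[k] (A ⊗[k] N.carrier) ⊗[k] A :=
  (TensorProduct.assoc k A N.carrier A).symm.toLinearMap ∘ₗ LinearMap.lTensor A N.rcoact

/-- `b (c ⊗ n) = ∑ b₍₁₎ c ⊗ b₍₂₎ n`. -/
def cotLact : A →ₗ[k] Module.End k (A ⊗[k] N.carrier) :=
  TensorProduct.map₂ (LinearMap.mul k A) N.lact ∘ₗ δ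

/-- `(c ⊗ n) b = ∑ c b₍₁₎ ⊗ n b₍₂₎`. -/
def cotRact : A →ₗ[k] Module.End k (A ⊗[k] N.carrier) :=
  TensorProduct.map₂ (LinearMap.mul k A).flip N.ract ∘ₗ δ

lemma cotLcoact_tmul (c : A) (n : N.carrier) :
    N.cotLcoact (c ⊗ₜ n) = TensorProduct.assoc k A A N.carrier (δ c ⊗ₜ n) := rfl

lemma cotRcoact_tmul (c : A) (n : N.carrier) :
    N.cotRcoact (c ⊗ₜ n) = (TensorProduct.assoc k A N.carrier A).symm (c ⊗ₜ N.rcoact n) := rfl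

lemma cotLact_apply (b : A) (t) :
    N.cotLact b t = TensorProduct.map₂ (LinearMap.mul k A) N.lact (δ b) t := rfl

lemma cotRact_apply (b : A) (t) :
    N.cotRact b t = TensorProduct.map₂ (LinearMap.mul k A).flip N.ract (δ b) t := rfl

set_option maxHeartbeats 1600000 in
/-- The Hopf bimodule `A ⊗ N`, with the diagonal actions and the standard coactions. -/
def cotObj : HopfBimodule k A where
  carrier := A ⊗[k] N.carrier
  lact := N.cotLact
  ract := N.cotRact
  lcoact := N.cotLcoact
  rcoact := N.cotRcoact
  lact_one := ten_ext (f := N.cotLact 1) (g := LinearMap.id) fun c n => by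
    rw [cotLact_apply, Bialgebra.comul_one, Algebra.TensorProduct.one_def]
    simp [N.lact_one]
  lact_mul a b t := by
    rw [cotLact_apply, ← LinearMap.mul_apply' (R := k), comul_mul_map₂]
    exact map₂_map₂ mul_assoc N.lact_mul _ _ _
  ract_one := ten_ext (f := N.cotRact 1) (g := LinearMap.id) fun c n => by
    rw [cotRact_apply, Bialgebra.comul_one, Algebra.TensorProduct.one_def]
    simp [N.ract_one]
  ract_mul a b t := by
    rw [cotRact_apply, ← LinearMap.mul_apply' (R := k), comul_mul_map₂_flip]
    exact map₂_map₂ (fun x y z => (mul_assoc z y x).symm) (fun x y => N.ract_mul y x) _ _ _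
  ract_lact a b t := by
    rw [cotRact_apply, cotRact_apply, cotLact_apply, cotLact_apply, map₂_flip _ _ (δ b),
      map₂_flip _ _ (δ b)]
    exact map₂_map₂ mul_assoc (fun x y z => N.ract_lact x z y) _ _ _
  counit_lcoact := ten_ext (f := (TensorProduct.lid k _).toLinearMap ∘ₗ LinearMap.rTensor _ ε ∘ₗ
      N.cotLcoact) (g := LinearMap.id) fun c n => by
    have h := ten_ext (f := (TensorProduct.lid k _).toLinearMap ∘ₗ LinearMap.rTensor _ ε ∘ₗ
      (TensorProduct.assoc k A A N.carrier).toLinearMap ∘ₗ (TensorProduct.mk k _ _).flip n)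
      (g := (TensorProduct.mk k _ _).flip n ∘ₗ (TensorProduct.lid k _).toLinearMap ∘ₗ
        LinearMap.rTensor _ ε) (fun x y => by simp) (δ c)
    exact h.trans (by simp)
  coassoc_lcoact := ten_ext (f := (TensorProduct.assoc k A A _).toLinearMap ∘ₗ
      LinearMap.rTensor _ δ ∘ₗ N.cotLcoact) (g := LinearMap.lTensor A N.cotLcoact ∘ₗ N.cotLcoact)
      fun c n => by
    have h := ten_ext (f := (TensorProduct.assoc k A A _).toLinearMap ∘ₗ LinearMap.rTensor _ δ ∘ₗ
        (TensorProduct.assoc k A A N.carrier).toLinearMap ∘ₗ (TensorProduct.mk k _ _).flip n)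
      (g := LinearMap.lTensor A ((TensorProduct.assoc k A A N.carrier).toLinearMap ∘ₗ
        (TensorProduct.mk k (A ⊗[k] A) N.carrier).flip n) ∘ₗ
          (TensorProduct.assoc k A A A).toLinearMap ∘ₗ LinearMap.rTensor A δ) (fun x y => by
        simp only [LinearMap.comp_apply, LinearEquiv.coe_coe, LinearMap.flip_apply,
          TensorProduct.mk_apply, TensorProduct.assoc_tmul, LinearMap.rTensor_tmul]
        exact (δ x).induction_on (by simp) (fun _ _ => by simp) fun _ _ ha hb => by
          simp only [map_add, add_tmul, ha, hb]) (δ c)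
    have h2 := ten_ext (f := LinearMap.lTensor A N.cotLcoact ∘ₗ
        (TensorProduct.assoc k A A N.carrier).toLinearMap ∘ₗ (TensorProduct.mk k _ _).flip n)
      (g := LinearMap.lTensor A ((TensorProduct.assoc k A A N.carrier).toLinearMap ∘ₗ
        (TensorProduct.mk k (A ⊗[k] A) N.carrier).flip n) ∘ₗ LinearMap.lTensor A δ)
      (fun x y => by simp [cotLcoact_tmul]) (δ c)
    exact h.trans ((congrArg _ (Coalgebra.coassoc_apply c)).trans h2.symm)
  counit_rcoact := ten_ext (f := (TensorProduct.rid k _).toLinearMap ∘ₗ LinearMap.lTensor _ ε ∘ₗ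
      N.cotRcoact) (g := LinearMap.id) fun c n => by
    have h := ten_ext (f := (TensorProduct.rid k _).toLinearMap ∘ₗ LinearMap.lTensor _ ε ∘ₗ
      (TensorProduct.assoc k A N.carrier A).symm.toLinearMap ∘ₗ TensorProduct.mk k _ _ c)
      (g := TensorProduct.mk k _ _ c ∘ₗ (TensorProduct.rid k _).toLinearMap ∘ₗ
        LinearMap.lTensor _ ε) (fun x y => by simp) (N.rcoact n)
    exact h.trans (congrArg (c ⊗ₜ[k] ·) (N.counit_rcoact n))
  coassoc_rcoact := ten_ext (f := (TensorProduct.assoc k _ A A).toLinearMap ∘ₗ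
      LinearMap.rTensor _ N.cotRcoact ∘ₗ N.cotRcoact) (g := LinearMap.lTensor _ δ ∘ₗ N.cotRcoact)
      fun c n => by
    have h := ten_ext (f := (TensorProduct.assoc k _ A A).toLinearMap ∘ₗ
        LinearMap.rTensor _ N.cotRcoact ∘ₗ (TensorProduct.assoc k A N.carrier A).symm.toLinearMap ∘ₗ
          TensorProduct.mk k _ _ c)
      (g := (TensorProduct.assoc k A N.carrier (A ⊗[k] A)).symm.toLinearMap ∘ₗ
        TensorProduct.mk k _ _ c ∘ₗ (TensorProduct.assoc k _ A A).toLinearMap ∘ₗ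
          LinearMap.rTensor A N.rcoact) (fun x y => by
        simp only [LinearMap.comp_apply, LinearEquiv.coe_coe, TensorProduct.mk_apply,
          TensorProduct.assoc_symm_tmul, LinearMap.rTensor_tmul, cotRcoact_tmul]
        exact (N.rcoact x).induction_on (by simp) (fun _ _ => by simp) fun _ _ ha hb => by
          simp only [map_add, add_tmul, tmul_add, ha, hb]) (N.rcoact n)
    have h2 := ten_ext (f := LinearMap.lTensor _ δ ∘ₗ
        (TensorProduct.assoc k A N.carrier A).symm.toLinearMap ∘ₗ TensorProduct.mk k _ _ c)
      (g := (TensorProduct.assoc k A N.carrier (A ⊗[k] A)).symm.toLinearMap ∘ₗ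
        TensorProduct.mk k _ _ c ∘ₗ LinearMap.lTensor _ δ) (fun x y => by simp) (N.rcoact n)
    exact h.trans ((congrArg (fun z =>
      (TensorProduct.assoc k A N.carrier (A ⊗[k] A)).symm (c ⊗ₜ z)) (N.coassoc_rcoact n)).trans h2.symm)
  lcoact_rcoact := ten_ext (f := (TensorProduct.assoc k A _ A).toLinearMap ∘ₗ
      LinearMap.rTensor _ N.cotLcoact ∘ₗ N.cotRcoact)
      (g := LinearMap.lTensor A N.cotRcoact ∘ₗ N.cotLcoact) fun c n => by
    have h : ∀ (r : A ⊗[k] A) (s : N.carrier ⊗[k] A), TensorProduct.assoc k A (A ⊗[k] N.carrier) A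
        (LinearMap.rTensor A ((TensorProduct.assoc k A A N.carrier).toLinearMap ∘ₗ
          TensorProduct.mk k _ _ r) s) =
        LinearMap.lTensor A ((TensorProduct.assoc k A N.carrier A).symm.toLinearMap ∘ₗ
          (TensorProduct.mk k A (N.carrier ⊗[k] A)).flip s) r := by
      intro r s
      refine s.induction_on (by simp) (fun x y => ?_) fun _ _ ha hb => by
        simp only [map_add, LinearMap.comp_add, LinearMap.lTensor_add, LinearMap.add_apply, ha, hb]
      exact r.induction_on (by simp) (fun _ _ => by simp) fun _ _ ha hb => by
        simp only [map_add, LinearMap.comp_add, LinearMap.rTensor_add, LinearMap.add_apply, ha, hb]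
    have h1 := ten_ext (f := LinearMap.rTensor A N.cotLcoact ∘ₗ
        (TensorProduct.assoc k A N.carrier A).symm.toLinearMap ∘ₗ TensorProduct.mk k _ _ c)
      (g := LinearMap.rTensor A ((TensorProduct.assoc k A A N.carrier).toLinearMap ∘ₗ
          TensorProduct.mk k _ _ (δ c))) (fun x y => by simp [cotLcoact_tmul]) (N.rcoact n)
    have h2 := ten_ext (f := LinearMap.lTensor A N.cotRcoact ∘ₗ
        (TensorProduct.assoc k A A N.carrier).toLinearMap ∘ₗ (TensorProduct.mk k _ _).flip n)
      (g := LinearMap.lTensor A ((TensorProduct.assoc k A N.carrier A).symm.toLinearMap ∘ₗ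
        (TensorProduct.mk k A (N.carrier ⊗[k] A)).flip (N.rcoact n)))
      (fun x y => by simp [cotRcoact_tmul]) (δ c)
    exact (congrArg _ h1).trans ((h _ _).trans h2.symm)
  lcoact_lact b t := by
    rw [cotLact_apply, cotLact, map₂_comp_right, ← Coalgebra.coassoc_apply]
    change TensorProduct.assoc k A A N.carrier (LinearMap.rTensor _ δ _) =
      TensorProduct.map₂ _ _ _ (TensorProduct.assoc k A A N.carrier (LinearMap.rTensor _ δ t))
    rw [rTensor_map₂ (LinearMap.mul k A) comul_mul_map₂, assoc_map₂]
  lcoact_ract b t := by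
    rw [cotRact_apply, cotRact, map₂_comp_right, ← Coalgebra.coassoc_apply]
    change TensorProduct.assoc k A A N.carrier (LinearMap.rTensor _ δ _) =
      TensorProduct.map₂ _ _ _ (TensorProduct.assoc k A A N.carrier (LinearMap.rTensor _ δ t))
    rw [rTensor_map₂ (LinearMap.mul k A).flip (fun x y => comul_mul_map₂_flip y x), assoc_map₂]
  rcoact_lact b t := by
    rw [cotLact_apply, cotLact, map₂_comp_left]
    change (TensorProduct.assoc k A N.carrier A).symm (LinearMap.lTensor _ _ _) =
      TensorProduct.map₂ _ _ _ ((TensorProduct.assoc k A N.carrier A).symm _)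
    rw [lTensor_map₂ N.lact N.rcoact_lact, LinearEquiv.symm_apply_eq, assoc_map₂,
      LinearEquiv.apply_symm_apply, Coalgebra.coassoc_apply]
  rcoact_ract b t := by
    rw [cotRact_apply, cotRact, map₂_comp_left]
    change (TensorProduct.assoc k A N.carrier A).symm (LinearMap.lTensor _ _ _) =
      TensorProduct.map₂ _ _ _ ((TensorProduct.assoc k A N.carrier A).symm _)
    rw [lTensor_map₂ N.ract N.rcoact_ract, LinearEquiv.symm_apply_eq, assoc_map₂,
      LinearEquiv.apply_symm_apply, Coalgebra.coassoc_apply]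

end Cobar

variable (k A) in
/-- The functor `M ↦ M ⊗ A`. -/
def tenFunctor : HopfBimodule k A ⥤ HopfBimodule k A where
  obj M := M.tenObj
  map {M N} f := mkHom (M := M.tenObj) (N := N.tenObj) (LinearMap.rTensor A (lin f))
    (fun a => ten_ext (f := LinearMap.rTensor A (lin f) ∘ₗ LinearMap.rTensor A (M.lact a))
      (g := LinearMap.rTensor A (N.lact a) ∘ₗ LinearMap.rTensor A (lin f))
      fun m x => congrArg (fun z => z ⊗ₜ[k] x) (lin_lact f a m))
    (fun a => ten_ext (f := LinearMap.rTensor A (lin f) ∘ₗ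
      LinearMap.lTensor _ (LinearMap.mulRight k a))
      (g := LinearMap.lTensor _ (LinearMap.mulRight k a) ∘ₗ LinearMap.rTensor A (lin f))
      fun m x => rfl)
    (ten_ext (f := LinearMap.lTensor A (LinearMap.rTensor A (lin f)) ∘ₗ M.tenLcoact)
      (g := N.tenLcoact ∘ₗ LinearMap.rTensor A (lin f)) fun m x =>
      (map_map₂ (φ₁ := LinearMap.id) (φ₂ := LinearMap.id) (ψ₁ := lin f) (ψ₂ := LinearMap.id)
        (fun _ _ => rfl) (fun _ _ => rfl) (M.lcoact m) (δ x)).trans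
        (congrArg₂ (fun z w => TensorProduct.map₂ _ _ z w) (lin_lcoact f m)
          (LinearMap.congr_fun TensorProduct.map_id _)))
    (ten_ext (f := LinearMap.rTensor A (LinearMap.rTensor A (lin f)) ∘ₗ M.tenRcoact)
      (g := N.tenRcoact ∘ₗ LinearMap.rTensor A (lin f)) fun m x =>
      (map_map₂ (φ₁ := lin f) (φ₂ := LinearMap.id) (ψ₁ := LinearMap.id) (ψ₂ := LinearMap.id)
        (fun _ _ => rfl) (fun _ _ => rfl) (M.rcoact m) (δ x)).trans
        (congrArg₂ (fun z w => TensorProduct.map₂ _ _ z w) (lin_rcoact f m)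
          (LinearMap.congr_fun TensorProduct.map_id _)))
  map_id M := hom_ext fun t => LinearMap.congr_fun (LinearMap.rTensor_id _ _) t
  map_comp f g := hom_ext fun t => LinearMap.congr_fun (LinearMap.rTensor_comp A (lin g) (lin f)) t

variable (k A) in
/-- The functor `N ↦ A ⊗ N`. -/
def cotFunctor : HopfBimodule k A ⥤ HopfBimodule k A where
  obj N := N.cotObj
  map {M N} f := mkHom (M := M.cotObj) (N := N.cotObj) (LinearMap.lTensor A (lin f))
    (fun a t => (map_map₂ (φ₁ := LinearMap.id) (ψ₁ := LinearMap.id) (φ₂ := LinearMap.id)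
      (fun _ _ => rfl) (lin_lact f) (δ a) t).trans
        (congrArg (fun z => TensorProduct.map₂ _ _ z _) (LinearMap.congr_fun TensorProduct.map_id _)))
    (fun a t => (map_map₂ (φ₁ := LinearMap.id) (ψ₁ := LinearMap.id) (φ₂ := LinearMap.id)
      (fun _ _ => rfl) (lin_ract f) (δ a) t).trans
        (congrArg (fun z => TensorProduct.map₂ _ _ z _) (LinearMap.congr_fun TensorProduct.map_id _)))
    (ten_ext (f := LinearMap.lTensor A (LinearMap.lTensor A (lin f)) ∘ₗ M.cotLcoact)
      (g := N.cotLcoact ∘ₗ LinearMap.lTensor A (lin f)) fun c n =>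
        ten_ext (f := LinearMap.lTensor A (LinearMap.lTensor A (lin f)) ∘ₗ
          (TensorProduct.assoc k A A M.carrier).toLinearMap ∘ₗ (TensorProduct.mk k _ _).flip n)
          (g := (TensorProduct.assoc k A A N.carrier).toLinearMap ∘ₗ
            (TensorProduct.mk k _ _).flip (lin f n)) (fun _ _ => rfl) (δ c))
    (ten_ext (f := LinearMap.rTensor A (LinearMap.lTensor A (lin f)) ∘ₗ M.cotRcoact)
      (g := N.cotRcoact ∘ₗ LinearMap.lTensor A (lin f)) fun c n =>
        (ten_ext (f := LinearMap.rTensor A (LinearMap.lTensor A (lin f)) ∘ₗ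
          (TensorProduct.assoc k A M.carrier A).symm.toLinearMap ∘ₗ TensorProduct.mk k _ _ c)
          (g := (TensorProduct.assoc k A N.carrier A).symm.toLinearMap ∘ₗ
            TensorProduct.mk k _ _ c ∘ₗ LinearMap.rTensor A (lin f)) (fun _ _ => rfl)
          (M.rcoact n)).trans (congrArg (fun z => (TensorProduct.assoc k A N.carrier A).symm
            (c ⊗ₜ z)) (lin_rcoact f n)))
  map_id M := hom_ext fun t => LinearMap.congr_fun (LinearMap.lTensor_id _ _) t
  map_comp f g := hom_ext fun t => LinearMap.congr_fun (LinearMap.lTensor_comp A (lin g) (lin f)) t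

instance : (tenFunctor k A).Additive where
  map_add {_ _ f g} := hom_ext fun t => LinearMap.congr_fun (LinearMap.rTensor_add A (lin f) (lin g)) t

instance : (cotFunctor k A).Additive where
  map_add {_ _ f g} := hom_ext fun t => LinearMap.congr_fun (LinearMap.lTensor_add A (lin f) (lin g)) t

variable (k A) in
/-- The right action `M ⊗ A ⟶ M`. -/
def tenCounit : tenFunctor k A ⟶ 𝟭 (HopfBimodule k A) where
  app M := mkHom (M := M.tenObj) (N := M) (TensorProduct.lift M.ract.flip)
    (fun a => ten_ext (f := TensorProduct.lift M.ract.flip ∘ₗ LinearMap.rTensor A (M.lact a))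
      (g := M.lact a ∘ₗ TensorProduct.lift M.ract.flip) fun m x => by simp [M.ract_lact])
    (fun a => ten_ext (f := TensorProduct.lift M.ract.flip ∘ₗ
      LinearMap.lTensor _ (LinearMap.mulRight k a))
      (g := M.ract a ∘ₗ TensorProduct.lift M.ract.flip) fun m x => by simp [M.ract_mul])
    (ten_ext (f := LinearMap.lTensor A (TensorProduct.lift M.ract.flip) ∘ₗ M.tenLcoact)
      (g := M.lcoact ∘ₗ TensorProduct.lift M.ract.flip) fun m x => by
      refine (map_map₂ (φ₁ := LinearMap.id) (φ₂ := LinearMap.id) (ψ₁ := LinearMap.id)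
        (ψ₂ := LinearMap.id) (f' := LinearMap.mul k A) (g' := M.ract.flip)
        (fun _ _ => rfl) (fun _ _ => by simp) (M.lcoact m) (δ x)).trans ?_
      rw [LinearMap.comp_apply, TensorProduct.lift.tmul, LinearMap.flip_apply, M.lcoact_ract,
        map₂_flip, TensorProduct.map_id, TensorProduct.map_id]
      rfl)
    (ten_ext (f := LinearMap.rTensor A (TensorProduct.lift M.ract.flip) ∘ₗ M.tenRcoact)
      (g := M.rcoact ∘ₗ TensorProduct.lift M.ract.flip) fun m x => by
      refine (map_map₂ (φ₁ := LinearMap.id) (φ₂ := LinearMap.id) (ψ₁ := LinearMap.id)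
        (ψ₂ := LinearMap.id) (f' := M.ract.flip) (g' := LinearMap.mul k A)
        (fun _ _ => by simp) (fun _ _ => rfl) (M.rcoact m) (δ x)).trans ?_
      rw [LinearMap.comp_apply, TensorProduct.lift.tmul, LinearMap.flip_apply, M.rcoact_ract,
        map₂_flip, TensorProduct.map_id, TensorProduct.map_id]
      rfl)
  naturality M N f := hom_ext (ten_ext (f := TensorProduct.lift N.ract.flip ∘ₗ
    LinearMap.rTensor A (lin f)) (g := lin f ∘ₗ TensorProduct.lift M.ract.flip)
    fun m x => by simp [lin_ract])

variable (k A) in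
/-- The left coaction `N ⟶ A ⊗ N`. -/
def cotUnit : 𝟭 (HopfBimodule k A) ⟶ cotFunctor k A where
  app N := mkHom (M := N) (N := N.cotObj) N.lcoact N.lcoact_lact N.lcoact_ract
    (fun n => (N.coassoc_lcoact n).symm)
    (fun n => by
      refine ((LinearEquiv.eq_symm_apply _).2 (N.lcoact_rcoact n)))
  naturality M N f := hom_ext fun m => (lin_lcoact f m).symm

@[simp] lemma lin_tenCounit_app (M : HopfBimodule k A) (m : M.carrier) (a : A) :
    lin ((tenCounit k A).app M) (m ⊗ₜ a) = M.ract a m := rfl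

@[simp] lemma lin_cotUnit_app (N : HopfBimodule k A) (n : N.carrier) :
    lin ((cotUnit k A).app N) n = N.lcoact n := rfl

end HopfBimodule
end CRHopf

namespace CRHopf
section DoubleComplex
variable {k : Type u} [Field k] {K : ℕ → ℕ → Type u} [∀ p q, AddCommGroup (K p q)]
  [∀ p q, Module k (K p q)] {K' : ℕ → ℕ → Type u} [∀ p q, AddCommGroup (K' p q)]
  [∀ p q, Module k (K' p q)]

/-- The degree `n` part of the total complex of a double complex `K`: families of `αᵖ𐞥 ∈ K^{pq}`,
`p + q = n`. -/
abbrev DTot (K : ℕ → ℕ → Type u) (n : ℕ) : Type u :=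
  (x : {x : ℕ × ℕ // x.1 + x.2 = n}) → K x.1.1 x.1.2

variable (dh : ∀ p q, K p q →ₗ[k] K p (q + 1)) (dc : ∀ p q, K p q →ₗ[k] K (p + 1) q)

/-- The component of `d_h α` in `K^{pq}`. -/
def dtotH {n : ℕ} (α : DTot K n) : (p q : ℕ) → p + q = n + 1 → K p q
  | _, 0, _ => 0
  | p, q + 1, h => dh p q (α ⟨(p, q), by omega⟩)

/-- The component of `d_c α` in `K^{pq}`. -/
def dtotC {n : ℕ} (α : DTot K n) : (p q : ℕ) → p + q = n + 1 → K p q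
  | 0, _, _ => 0
  | p + 1, q, h => dc p q (α ⟨(p, q), by omega⟩)

/-- The differential `d_h + d_c` of the total complex. -/
def dtotD (n : ℕ) : DTot K n →ₗ[k] DTot K (n + 1) where
  toFun α x := dtotH dh α x.1.1 x.1.2 x.2 + dtotC dc α x.1.1 x.1.2 x.2
  map_add' α β := by
    funext ⟨⟨p, q⟩, h⟩
    rcases p with _ | p <;> rcases q with _ | q <;> simp [dtotH, dtotC, add_add_add_comm]
  map_smul' c α := by
    funext ⟨⟨p, q⟩, h⟩
    rcases p with _ | p <;> rcases q with _ | q <;> simp [dtotH, dtotC]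

lemma dtotD_dtotD (h1 : ∀ p q α, dh p (q + 1) (dh p q α) = 0)
    (h2 : ∀ p q α, dc (p + 1) q (dc p q α) = 0)
    (h3 : ∀ p q α, dh (p + 1) q (dc p q α) + dc p (q + 1) (dh p q α) = 0) (n : ℕ)
    (α : DTot K n) : dtotD dh dc (n + 1) (dtotD dh dc n α) = 0 := by
  funext ⟨⟨p, q⟩, h⟩
  rcases p with _ | _ | p <;> rcases q with _ | _ | q <;>
    simp_all [dtotD, dtotH, dtotC]

/-- The map induced by a map of double complexes. -/
def dtotMap (φ : ∀ p q, K p q →ₗ[k] K' p q) (n : ℕ) : DTot K n →ₗ[k] DTot K' n where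
  toFun α x := φ x.1.1 x.1.2 (α x)
  map_add' α β := by funext x; simp
  map_smul' c α := by funext x; simp

lemma dtotD_dtotMap {dh : ∀ p q, K p q →ₗ[k] K p (q + 1)}
    {dc : ∀ p q, K p q →ₗ[k] K (p + 1) q} {dh' : ∀ p q, K' p q →ₗ[k] K' p (q + 1)}
    {dc' : ∀ p q, K' p q →ₗ[k] K' (p + 1) q} (φ : ∀ p q, K p q →ₗ[k] K' p q)
    (h1 : ∀ p q (α : K p q), dh' p q (φ p q α) = φ p (q + 1) (dh p q α))
    (h2 : ∀ p q (α : K p q), dc' p q (φ p q α) = φ (p + 1) q (dc p q α)) (n : ℕ) (α : DTot K n) :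
    dtotD dh' dc' n (dtotMap φ n α) = dtotMap φ (n + 1) (dtotD dh dc n α) := by
  funext ⟨⟨p, q⟩, h⟩
  rcases p with _ | p <;> rcases q with _ | q <;> simp [dtotD, dtotH, dtotC, dtotMap, h1, h2]

end DoubleComplex

namespace HopfBimodule
section Resolutions
variable {k A : Type u} [Field k] [Ring A] [HopfAlgebra k A]

/-- `f ⊗ 1 : M ⊗ A ⟶ N ⊗ A`. -/
def tenMap {M N : HopfBimodule k A} (f : M ⟶ N) : M.tenObj ⟶ N.tenObj := (tenFunctor k A).map f

/-- `1 ⊗ f : A ⊗ M ⟶ A ⊗ N`. -/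
def cotMap {M N : HopfBimodule k A} (f : M ⟶ N) : M.cotObj ⟶ N.cotObj := (cotFunctor k A).map f

/-- The right action `M ⊗ A ⟶ M`. -/
def act (M : HopfBimodule k A) : M.tenObj ⟶ M := (tenCounit k A).app M

/-- The left coaction `N ⟶ A ⊗ N`. -/
def coact (N : HopfBimodule k A) : N ⟶ N.cotObj := (cotUnit k A).app N

section
variable {M N P : HopfBimodule k A}

lemma tenMap_id : tenMap (𝟙 M) = 𝟙 M.tenObj := (tenFunctor k A).map_id M
lemma cotMap_id : cotMap (𝟙 M) = 𝟙 M.cotObj := (cotFunctor k A).map_id M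
lemma tenMap_comp (f : M ⟶ N) (g : N ⟶ P) : tenMap (f ≫ g) = tenMap f ≫ tenMap g :=
  (tenFunctor k A).map_comp f g
lemma cotMap_comp (f : M ⟶ N) (g : N ⟶ P) : cotMap (f ≫ g) = cotMap f ≫ cotMap g :=
  (cotFunctor k A).map_comp f g
lemma tenMap_add (f g : M ⟶ N) : tenMap (f + g) = tenMap f + tenMap g := (tenFunctor k A).map_add
lemma cotMap_add (f g : M ⟶ N) : cotMap (f + g) = cotMap f + cotMap g := (cotFunctor k A).map_add
lemma tenMap_zero : tenMap (0 : M ⟶ N) = 0 := (tenFunctor k A).map_zero M N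
lemma cotMap_zero : cotMap (0 : M ⟶ N) = 0 := (cotFunctor k A).map_zero M N
lemma act_nat (f : M ⟶ N) : tenMap f ≫ act N = act M ≫ f := (tenCounit k A).naturality f
lemma coact_nat (f : M ⟶ N) : f ≫ coact N = coact M ≫ cotMap f := (cotUnit k A).naturality f
end

/-- `M ⊗ A^{⊗ n}`. -/
def barObj (M : HopfBimodule k A) : ℕ → HopfBimodule k A
  | 0 => M
  | n + 1 => (barObj M n).tenObj

/-- `A^{⊗ n} ⊗ N`. -/
def cobObj (N : HopfBimodule k A) : ℕ → HopfBimodule k A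
  | 0 => N
  | n + 1 => (cobObj N n).cotObj

/-- `f ⊗ 1 : M ⊗ A^{⊗ n} ⟶ N ⊗ A^{⊗ n}`. -/
def barMap {M N : HopfBimodule k A} (f : M ⟶ N) : (n : ℕ) → (barObj M n ⟶ barObj N n)
  | 0 => f
  | n + 1 => tenMap (barMap f n)

/-- `1 ⊗ f : A^{⊗ n} ⊗ M ⟶ A^{⊗ n} ⊗ N`. -/
def cobMap {M N : HopfBimodule k A} (f : M ⟶ N) : (n : ℕ) → (cobObj M n ⟶ cobObj N n)
  | 0 => f
  | n + 1 => cotMap (cobMap f n)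

/-- `f ⊗ 1`, for `f : M ⊗ A^{⊗ i} ⟶ N ⊗ A^{⊗ j}`. -/
def barS {M N : HopfBimodule k A} {i j : ℕ} (f : barObj M i ⟶ barObj N j) :
    barObj M (i + 1) ⟶ barObj N (j + 1) := tenMap f

/-- `1 ⊗ f`, for `f : A^{⊗ i} ⊗ M ⟶ A^{⊗ j} ⊗ N`. -/
def cobS {M N : HopfBimodule k A} {i j : ℕ} (f : cobObj M i ⟶ cobObj N j) :
    cobObj M (i + 1) ⟶ cobObj N (j + 1) := cotMap f

/-- The right action `M ⊗ A^{⊗ n} ⊗ A ⟶ M ⊗ A^{⊗ n}`. -/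
def barA (M : HopfBimodule k A) (n : ℕ) : barObj M (n + 1) ⟶ barObj M n := act (barObj M n)

/-- The left coaction `A^{⊗ n} ⊗ N ⟶ A ⊗ A^{⊗ n} ⊗ N`. -/
def cobA (N : HopfBimodule k A) (n : ℕ) : cobObj N n ⟶ cobObj N (n + 1) := coact (cobObj N n)

section
variable {M N P : HopfBimodule k A} {i j l : ℕ}

lemma barS_comp (f : barObj M i ⟶ barObj N j) (g : barObj N j ⟶ barObj P l) :
    barS (f ≫ g) = barS f ≫ barS g := tenMap_comp _ _
lemma cobS_comp (f : cobObj M i ⟶ cobObj N j) (g : cobObj N j ⟶ cobObj P l) :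
    cobS (f ≫ g) = cobS f ≫ cobS g := cotMap_comp _ _
lemma barS_zero : barS (0 : barObj M i ⟶ barObj N j) = 0 := tenMap_zero
lemma cobS_zero : cobS (0 : cobObj M i ⟶ cobObj N j) = 0 := cotMap_zero
lemma barA_nat (f : barObj M i ⟶ barObj N j) : barS f ≫ barA N j = barA M i ≫ f := act_nat f
lemma cobA_nat (f : cobObj M i ⟶ cobObj N j) : f ≫ cobA N j = cobA M i ≫ cobS f := coact_nat f
end

/-- The bar differential `M ⊗ A^{⊗ n+1} ⟶ M ⊗ A^{⊗ n}`, `m ⊗ a₀ ⊗ ⋯ ⊗ aₙ ↦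
m a₀ ⊗ ⋯ ⊗ aₙ + ∑ (-1)^{i+1} m ⊗ ⋯ ⊗ aᵢ aᵢ₊₁ ⊗ ⋯ ⊗ aₙ`. -/
def barD (M : HopfBimodule k A) : (n : ℕ) → (barObj M (n + 1) ⟶ barObj M n)
  | 0 => barA M 0
  | n + 1 => barS (barD M n) + (-1 : ℤ) ^ (n + 1) • barA M (n + 1)

/-- The cobar differential `A^{⊗ n} ⊗ N ⟶ A^{⊗ n+1} ⊗ N`, `a₀ ⊗ ⋯ ⊗ aₙ₋₁ ⊗ x ↦
∑ (-1)^i a₀ ⊗ ⋯ ⊗ Δ aᵢ ⊗ ⋯ ⊗ x + (-1)^n a₀ ⊗ ⋯ ⊗ aₙ₋₁ ⊗ δ_L(x)`. -/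
def cobD (N : HopfBimodule k A) : (n : ℕ) → (cobObj N n ⟶ cobObj N (n + 1))
  | 0 => cobA N 0
  | n + 1 => cobA N (n + 1) - cobS (cobD N n)

lemma barMap_id (M : HopfBimodule k A) (n : ℕ) : barMap (𝟙 M) n = 𝟙 (barObj M n) := by
  induction n with
  | zero => rfl
  | succ n ih => rw [barMap, ih, tenMap_id]; rfl

lemma cobMap_id (M : HopfBimodule k A) (n : ℕ) : cobMap (𝟙 M) n = 𝟙 (cobObj M n) := by
  induction n with
  | zero => rfl
  | succ n ih => rw [cobMap, ih, cotMap_id]; rfl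

section
variable {M N P : HopfBimodule k A}

lemma barMap_comp (f : M ⟶ N) (g : N ⟶ P) (n : ℕ) :
    barMap (f ≫ g) n = barMap f n ≫ barMap g n := by
  induction n with
  | zero => rfl
  | succ n ih => rw [barMap, ih, tenMap_comp]; rfl

lemma cobMap_comp (f : M ⟶ N) (g : N ⟶ P) (n : ℕ) :
    cobMap (f ≫ g) n = cobMap f n ≫ cobMap g n := by
  induction n with
  | zero => rfl
  | succ n ih => rw [cobMap, ih, cotMap_comp]; rfl

lemma barMap_add (f g : M ⟶ N) (n : ℕ) : barMap (f + g) n = barMap f n + barMap g n := by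
  induction n with
  | zero => rfl
  | succ n ih => rw [barMap, ih, tenMap_add]; rfl

lemma cobMap_add (f g : M ⟶ N) (n : ℕ) : cobMap (f + g) n = cobMap f n + cobMap g n := by
  induction n with
  | zero => rfl
  | succ n ih => rw [cobMap, ih, cotMap_add]; rfl

lemma barD_nat (f : M ⟶ N) (n : ℕ) : barMap f (n + 1) ≫ barD N n = barD M n ≫ barMap f n := by
  induction n with
  | zero => exact act_nat f
  | succ n ih =>
    have h : barS (barMap f (n + 1)) ≫ barS (barD N n) = barS (barD M n) ≫ barMap f (n + 1) := by
      rw [← barS_comp, ih, barS_comp]; rfl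
    change barS (barMap f (n + 1)) ≫ _ = _
    rw [barD, barD, Preadditive.comp_add, Preadditive.add_comp, Preadditive.comp_zsmul,
      Preadditive.zsmul_comp, barA_nat, h]

lemma cobD_nat (f : M ⟶ N) (n : ℕ) : cobMap f n ≫ cobD N n = cobD M n ≫ cobMap f (n + 1) := by
  induction n with
  | zero => exact coact_nat f
  | succ n ih =>
    have h : cobMap f (n + 1) ≫ cobS (cobD N n) = cobS (cobD M n) ≫ cobS (cobMap f (n + 1)) := by
      rw [← cobS_comp, ← ih, cobS_comp]; rfl
    change _ = _ ≫ cobS (cobMap f (n + 1))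
    rw [cobD, cobD, Preadditive.comp_sub, Preadditive.sub_comp, cobA_nat, h]
end

lemma barD_barD (M : HopfBimodule k A) (n : ℕ) : barD M (n + 1) ≫ barD M n = 0 := by
  induction n with
  | zero =>
    rw [barD, barD, Preadditive.add_comp, barA_nat, Preadditive.zsmul_comp]
    change _ + ((-1 : ℤ) ^ 1) • _ = 0
    rw [pow_one, neg_smul, one_smul]
    exact add_neg_cancel _
  | succ n ih =>
    have h : barS (barD M (n + 1)) ≫ barD M (n + 1) =
        (-1 : ℤ) ^ (n + 1) • (barA M (n + 2) ≫ barD M (n + 1)) := by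
      rw [← barA_nat]
      conv_lhs => rw [barD.eq_2 M n]
      rw [Preadditive.comp_add, ← barD.eq_2 M n, ← barS_comp, ih, barS_zero, zero_add,
        Preadditive.comp_zsmul]
    rw [barD.eq_2 M (n + 1), Preadditive.add_comp, h, Preadditive.zsmul_comp,
      pow_succ (-1 : ℤ) (n + 1), mul_neg_one, neg_smul, add_neg_cancel]

lemma cobD_cobD (N : HopfBimodule k A) (n : ℕ) : cobD N n ≫ cobD N (n + 1) = 0 := by
  induction n with
  | zero =>
    rw [cobD, cobD, Preadditive.comp_sub, cobA_nat]
    exact sub_self _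
  | succ n ih =>
    have h : cobD N (n + 1) ≫ cobS (cobD N (n + 1)) = cobA N (n + 1) ≫ cobS (cobD N (n + 1)) := by
      conv_lhs => arg 1; rw [cobD.eq_2 N n]
      rw [Preadditive.sub_comp, ← cobS_comp, ih, cobS_zero, sub_zero]
    rw [cobD.eq_2 N (n + 1), Preadditive.comp_sub, h, cobA_nat, sub_self]

/-- `K^{pq}(M, N)`, the space of morphisms `M ⊗ A^{⊗ q+1} ⟶ A^{⊗ p+1} ⊗ N`. -/
abbrev K (M N : HopfBimodule k A) (p q : ℕ) : Type u :=
  barObj M (q + 1) ⟶ cobObj N (p + 1)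

/-- `α ↦ α ∘ λ`. -/
def dH (M N : HopfBimodule k A) (p q : ℕ) : K M N p q →ₗ[k] K M N p (q + 1) :=
  Linear.leftComp k _ (barD M (q + 1))

/-- `α ↦ (-1)^q ρ ∘ α`. -/
def dC (M N : HopfBimodule k A) (p q : ℕ) : K M N p q →ₗ[k] K M N (p + 1) q :=
  (-1 : k) ^ q • Linear.rightComp k _ (cobD N (p + 1))

/-- The degree `n` part of the total complex of `K^{••}(M, N)`. -/
abbrev Tot (M N : HopfBimodule k A) (n : ℕ) : Type u := DTot (K M N) n

/-- The differential `d_h + d_c` of the total complex. -/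
def totD (M N : HopfBimodule k A) (n : ℕ) : Tot M N n →ₗ[k] Tot M N (n + 1) :=
  dtotD (dH M N) (dC M N) n

lemma dH_apply (M N : HopfBimodule k A) (p q : ℕ) (α : K M N p q) :
    dH M N p q α = barD M (q + 1) ≫ α := rfl

lemma dC_apply (M N : HopfBimodule k A) (p q : ℕ) (α : K M N p q) :
    dC M N p q α = (-1 : k) ^ q • (α ≫ cobD N (p + 1)) := rfl

lemma dH_dH (M N : HopfBimodule k A) (p q : ℕ) (α : K M N p q) :
    dH M N p (q + 1) (dH M N p q α) = 0 := by
  rw [dH_apply, dH_apply, ← Category.assoc, barD_barD, Limits.zero_comp]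

lemma dC_dC (M N : HopfBimodule k A) (p q : ℕ) (α : K M N p q) :
    dC M N (p + 1) q (dC M N p q α) = 0 := by
  rw [dC_apply, dC_apply, Linear.smul_comp, Category.assoc, cobD_cobD, Limits.comp_zero, smul_zero,
    smul_zero]

lemma dH_dC (M N : HopfBimodule k A) (p q : ℕ) (α : K M N p q) :
    dH M N (p + 1) q (dC M N p q α) + dC M N p (q + 1) (dH M N p q α) = 0 := by
  rw [dH_apply, dH_apply, dC_apply, dC_apply, Linear.comp_smul, Category.assoc, pow_succ,
    mul_neg_one, neg_smul, add_neg_cancel]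

lemma totD_totD (M N : HopfBimodule k A) (n : ℕ) (α : Tot M N n) :
    totD M N (n + 1) (totD M N n α) = 0 :=
  dtotD_dtotD (dH M N) (dC M N) (dH_dH M N) (dC_dC M N) (dH_dC M N) n α

end Resolutions
end HopfBimodule
end CRHopf

namespace CRHopf
namespace HopfBimodule
section Total
variable {k A : Type u} [Field k] [Ring A] [HopfAlgebra k A]

/-- The map `K^{pq}(M, N) ⟶ K^{pq}(M', N')` induced by `f : M' ⟶ M` and `g : N ⟶ N'`. -/
def kMap {M M' N N' : HopfBimodule k A} (f : M' ⟶ M) (g : N ⟶ N') (p q : ℕ) :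
    K M N p q →ₗ[k] K M' N' p q :=
  Linear.leftComp k _ (barMap f (q + 1)) ∘ₗ Linear.rightComp k _ (cobMap g (p + 1))

/-- The map `Tot M N n ⟶ Tot M' N' n` induced by `f : M' ⟶ M` and `g : N ⟶ N'`. -/
def totMap {M M' N N' : HopfBimodule k A} (f : M' ⟶ M) (g : N ⟶ N') (n : ℕ) :
    Tot M N n →ₗ[k] Tot M' N' n := dtotMap (kMap f g) n

lemma totD_totMap {M M' N N' : HopfBimodule k A} (f : M' ⟶ M) (g : N ⟶ N') (n : ℕ)
    (α : Tot M N n) : totD M' N' n (totMap f g n α) = totMap f g (n + 1) (totD M N n α) := by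
  refine dtotD_dtotMap (kMap f g) (fun p q α => ?_) (fun p q α => ?_) n α
  · change barD M' (q + 1) ≫ barMap f (q + 1) ≫ α ≫ cobMap g (p + 1) =
      barMap f (q + 2) ≫ (barD M (q + 1) ≫ α) ≫ cobMap g (p + 1)
    rw [← Category.assoc, ← barD_nat, Category.assoc, Category.assoc]
  · change (-1 : k) ^ q • ((barMap f (q + 1) ≫ α ≫ cobMap g (p + 1)) ≫ cobD N' (p + 1)) =
      barMap f (q + 1) ≫ ((-1 : k) ^ q • (α ≫ cobD N (p + 1))) ≫ cobMap g (p + 2)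
    rw [Linear.smul_comp, Linear.comp_smul, Category.assoc, Category.assoc, Category.assoc,
      cobD_nat]

variable (k A)

/-- `Tot M N n` as an object of the category of vector spaces. -/
def totObj (M N : HopfBimodule k A) (n : ℕ) : ModuleCat.{u} k := ModuleCat.of k (Tot M N n)

/-- The differential of the total complex. -/
def totObjD (M N : HopfBimodule k A) (n : ℕ) : totObj k A M N n ⟶ totObj k A M N (n + 1) :=
  ModuleCat.ofHom (totD M N n)

lemma totObjD_comp (M N : HopfBimodule k A) (n : ℕ) :
    totObjD k A M N n ≫ totObjD k A M N (n + 1) = 0 :=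
  ModuleCat.hom_ext (LinearMap.ext (totD_totD M N n))

/-- The map of degree `n` parts induced by `f : M' ⟶ M` and `g : N ⟶ N'`. -/
def totObjMap {M M' N N' : HopfBimodule k A} (f : M' ⟶ M) (g : N ⟶ N') (n : ℕ) :
    totObj k A M N n ⟶ totObj k A M' N' n := ModuleCat.ofHom (totMap f g n)

lemma totObjMap_comp {M M' N N' : HopfBimodule k A} (f : M' ⟶ M) (g : N ⟶ N') (n : ℕ) :
    totObjMap k A f g n ≫ totObjD k A M' N' n = totObjD k A M N n ≫ totObjMap k A f g (n + 1) :=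
  ModuleCat.hom_ext (LinearMap.ext (totD_totMap f g n))

section
attribute [local irreducible] totObj

lemma of_d_succ {X : ℕ → ModuleCat.{u} k} (d : ∀ n, X n ⟶ X (n + 1)) (h : ∀ n, d n ≫ d (n + 1) = 0)
    (n : ℕ) : (CochainComplex.of X d h).d n (n + 1) = d n :=
  CochainComplex.of_d X d n

/-- The total complex of the double complex `K^{••}(M, N)`. -/
def totComplex (M N : HopfBimodule k A) : CochainComplex (ModuleCat.{u} k) ℕ :=
  CochainComplex.of (totObj k A M N) (totObjD k A M N) (totObjD_comp k A M N)

lemma totComplex_d (M N : HopfBimodule k A) (n : ℕ) :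
    (totComplex k A M N).d n (n + 1) = totObjD k A M N n := by
  unfold totComplex
  exact of_d_succ k (totObjD k A M N) (totObjD_comp k A M N) n

/-- Functoriality of the total complex. -/
noncomputable def totComplexMap {M M' N N' : HopfBimodule k A} (f : M' ⟶ M) (g : N ⟶ N') :
    totComplex k A M N ⟶ totComplex k A M' N' :=
  CochainComplex.ofHom (totObjMap k A f g) fun n => by
    rw [totComplex_d, totComplex_d]
    exact totObjMap_comp k A f g n

end

/-- The total complex as a functor of the first variable. -/
noncomputable def totFunctor₁ (N : HopfBimodule k A) :
    (HopfBimodule k A)ᵒᵖ ⥤ CochainComplex (ModuleCat.{u} k) ℕ where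
  obj M := totComplex k A M.unop N
  map f := totComplexMap k A f.unop (𝟙 N)
  map_id M := by
    ext n α
    funext x
    change barMap (𝟙 M.unop) _ ≫ α x ≫ cobMap (𝟙 N) _ = α x
    rw [barMap_id, cobMap_id, Category.id_comp, Category.comp_id]
  map_comp f g := by
    ext n α
    funext x
    change barMap (g.unop ≫ f.unop) _ ≫ α x ≫ cobMap (𝟙 N) _ =
      barMap g.unop _ ≫ (barMap f.unop _ ≫ α x ≫ cobMap (𝟙 N) _) ≫ cobMap (𝟙 N) _
    simp only [barMap_comp, cobMap_id, Category.comp_id, Category.assoc]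

/-- The total complex as a functor of the second variable. -/
noncomputable def totFunctor₂ (M : HopfBimodule k A) :
    HopfBimodule k A ⥤ CochainComplex (ModuleCat.{u} k) ℕ where
  obj N := totComplex k A M N
  map g := totComplexMap k A (𝟙 M) g
  map_id N := by
    ext n α
    funext x
    change barMap (𝟙 M) _ ≫ α x ≫ cobMap (𝟙 N) _ = α x
    rw [barMap_id, cobMap_id, Category.id_comp, Category.comp_id]
  map_comp f g := by
    ext n α
    funext x
    change barMap (𝟙 M) _ ≫ α x ≫ cobMap (f ≫ g) _ =
      barMap (𝟙 M) _ ≫ (barMap (𝟙 M) _ ≫ α x ≫ cobMap f _) ≫ cobMap g _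
    simp only [cobMap_comp, barMap_id, Category.id_comp, Category.assoc]

instance (N : HopfBimodule k A) : (totFunctor₁ k A N).Additive where
  map_add {M M' f g} := by
    ext n α
    funext x
    change barMap (f.unop + g.unop) _ ≫ α x ≫ cobMap (𝟙 N) _ =
      barMap f.unop _ ≫ α x ≫ cobMap (𝟙 N) _ + barMap g.unop _ ≫ α x ≫ cobMap (𝟙 N) _
    rw [barMap_add, Preadditive.add_comp]

instance (M : HopfBimodule k A) : (totFunctor₂ k A M).Additive where
  map_add {N N' f g} := by
    ext n α
    funext x
    change barMap (𝟙 M) _ ≫ α x ≫ cobMap (f + g) _ =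
      barMap (𝟙 M) _ ≫ α x ≫ cobMap f _ + barMap (𝟙 M) _ ≫ α x ≫ cobMap g _
    rw [cobMap_add, Preadditive.comp_add, Preadditive.comp_add]

variable {k A}

/-- The Hopf bimodule cohomology `H_{A4}^n(M, N)`. -/
noncomputable def hopfCohomology (M N : HopfBimodule k A) (n : ℕ) : ModuleCat.{u} k :=
  (totComplex k A M N).homology n

/-- The components of the augmentation: `β ↦ δ_L ∘ β ∘ μ_R : M ⊗ A ⟶ A ⊗ N` in bidegree `(0, 0)`. -/
def augK (M N : HopfBimodule k A) : (p q : ℕ) → (M ⟶ N) →ₗ[k] K M N p q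
  | 0, 0 => (Linear.leftComp k _ (barD M 0)) ∘ₗ (Linear.rightComp k _ (cobD N 0))
  | _, _ => 0

/-- The augmentation `Hom(M, N) ⟶ Tot⁰`. -/
def augTot (M N : HopfBimodule k A) : (M ⟶ N) →ₗ[k] Tot M N 0 :=
  LinearMap.pi fun x => augK M N x.1.1 x.1.2

lemma totD_augTot (M N : HopfBimodule k A) (β : M ⟶ N) : totD M N 0 (augTot M N β) = 0 := by
  let β₀ : barObj M 0 ⟶ cobObj N 0 := β
  let β' : barObj M 0 ⟶ cobObj N 1 := β₀ ≫ cobD N 0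
  funext ⟨⟨p, q⟩, h⟩
  rcases p with _ | p <;> rcases q with _ | q <;> dsimp only at h <;> try omega
  · obtain rfl : q = 0 := by omega
    change barD M 1 ≫ barD M 0 ≫ β' + 0 = 0
    rw [add_zero, ← Category.assoc, barD_barD, Limits.zero_comp]
  · obtain rfl : p = 0 := by omega
    have e : barD M 0 ≫ β' = (barD M 0 ≫ β₀) ≫ cobD N 0 := (Category.assoc _ _ _).symm
    change 0 + (-1 : k) ^ 0 • ((barD M 0 ≫ β') ≫ cobD N 1) = 0
    rw [e, Category.assoc, cobD_cobD, Limits.comp_zero, smul_zero]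
    exact add_zero _

/-- The map `Hom_{A4}(M, N) ⟶ H_{A4}⁰(M, N)` sending `β` to the class of the cocycle
`δ_L ∘ β ∘ μ_R` of bidegree `(0, 0)`. -/
noncomputable def homToH (M N : HopfBimodule k A) :
    ModuleCat.of k (M ⟶ N) ⟶ hopfCohomology M N 0 :=
  (totComplex k A M N).liftCycles (ModuleCat.ofHom (augTot M N)) 1 (by simp) (by
    rw [totComplex_d k A M N 0]
    exact ModuleCat.hom_ext (LinearMap.ext (totD_augTot M N))) ≫ (totComplex k A M N).homologyπ 0

/-- A sequence `0 ⟶ M' ⟶ M ⟶ M'' ⟶ 0` of Hopf bimodules is exact if the sequence of underlying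
vector spaces is. -/
def IsShortExact (S : ShortComplex (HopfBimodule k A)) : Prop :=
  (S.map (forgetToVec k A)).ShortExact

variable (k A) in
/-- The short exact sequences, in the opposite category. -/
def IsShortExactOp (S : ShortComplex (HopfBimodule k A)ᵒᵖ) : Prop := IsShortExact S.unop

lemma isShortExact_toX [FiniteDimensional k A] (S : ShortComplex (HopfBimodule k A))
    (h : IsShortExact S) : (S.map (toX k A)).ShortExact := by
  have := h.moduleCat_injective_f
  have := h.moduleCat_surjective_g
  have h2 := (ShortComplex.ShortExact.moduleCat_exact_iff_function_exact _).1 h.exact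
  exact ModuleCat.shortComplex_shortExact _ h2 ‹_› ‹_›
end Total
end HopfBimodule

section Delta

/-- A sequence of functors `Tⁿ : C ⥤ Vect_k` together with maps `δ : Tⁿ(X₃) ⟶ Tⁿ⁺¹(X₁)` for every
sequence `X₁ ⟶ X₂ ⟶ X₃` in the class `E` of short exact sequences. -/
structure DeltaData (k : Type u) [Field k] {C : Type v} [Category.{w} C] [Preadditive C]
    (E : ShortComplex C → Prop) where
  T : ℕ → C ⥤ ModuleCat.{u} k
  δ : (S : ShortComplex C) → E S → (n : ℕ) → ((T n).obj S.X₃ ⟶ (T (n + 1)).obj S.X₁)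

namespace DeltaData
variable {k : Type u} [Field k] {C : Type v} [Category.{w} C] [Preadditive C]
  {E : ShortComplex C → Prop}

/-- The axioms of a (cohomological) `δ`-functor: the functors are additive, the sequences
`0 ⟶ T⁰(X₁) ⟶ T⁰(X₂) ⟶ T⁰(X₃) ⟶ T¹(X₁) ⟶ ⋯` are exact and natural. -/
structure IsDeltaFunctor (D : DeltaData k E) : Prop where
  additive : ∀ n, (D.T n).Additive
  injective : ∀ S, E S → Function.Injective ((D.T 0).map S.f)
  exact₂ : ∀ S, E S → ∀ n, Function.Exact ((D.T n).map S.f) ((D.T n).map S.g)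
  exact₃ : ∀ S (h : E S) n, Function.Exact ((D.T n).map S.g) (D.δ S h n)
  exact₁ : ∀ S (h : E S) n, Function.Exact (D.δ S h n) ((D.T (n + 1)).map S.f)
  natural : ∀ (S S' : ShortComplex C) (h : E S) (h' : E S') (τ : S ⟶ S') n,
    D.δ S h n ≫ (D.T (n + 1)).map τ.τ₁ = (D.T n).map τ.τ₃ ≫ D.δ S' h' n

/-- A map of `δ`-functors: natural transformations commuting with the maps `δ`. -/
@[ext] structure Hom (D D' : DeltaData k E) where
  app : ∀ n, D.T n ⟶ D'.T n
  comm : ∀ S (h : E S) n, D.δ S h n ≫ (app (n + 1)).app S.X₁ = (app n).app S.X₃ ≫ D'.δ S h n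

open Classical in
/-- The cohomology of a functor `F` with values in complexes, with the connecting maps given by the
snake lemma (when `F` sends the sequence to a short exact sequence of complexes). -/
noncomputable def ofComplex (E : ShortComplex C → Prop)
    (F : C ⥤ CochainComplex (ModuleCat.{u} k) ℕ) [F.Additive] : DeltaData k E where
  T n := F ⋙ HomologicalComplex.homologyFunctor _ _ n
  δ S _ n := if h : (S.map F).ShortExact then h.δ n (n + 1) rfl else 0

end DeltaData
end Delta

namespace HopfBimodule
section ExtX
variable {k A : Type u} [Field k] [Ring A] [HopfAlgebra k A]

/-- `H_{A4}^*(-, N)`. -/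
noncomputable def hopfDelta₁ (N : HopfBimodule k A) : DeltaData k (IsShortExactOp k A) :=
  DeltaData.ofComplex _ (totFunctor₁ k A N)

/-- `H_{A4}^*(M, -)`. -/
noncomputable def hopfDelta₂ (M : HopfBimodule k A) :
    DeltaData k (IsShortExact (k := k) (A := A)) :=
  DeltaData.ofComplex _ (totFunctor₂ k A M)

variable [FiniteDimensional k A]

/-- `Ext_X^n(M, N)`. -/
noncomputable abbrev ExtX (M N : HopfBimodule k A) (n : ℕ) : Type u :=
  Abelian.Ext.{u} ((toX k A).obj M) ((toX k A).obj N) n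

/-- `Ext_X^*(-, N)`, with the connecting maps given by the Yoneda product with the class of the
extension. -/
noncomputable def extDelta₁ (N : HopfBimodule k A) : DeltaData k (IsShortExactOp k A) where
  T n :=
    { obj M := ModuleCat.of k (ExtX M.unop N n)
      map f := ModuleCat.ofHom ((Abelian.Ext.mk₀ ((toX k A).map f.unop)).precompOfLinear k
        ((toX k A).obj N) (zero_add n))
      map_id M := by ext x; simp
      map_comp f g := by
        ext x
        change (Abelian.Ext.mk₀ ((toX k A).map (g.unop ≫ f.unop))).comp x (zero_add n) = _
        rw [Functor.map_comp, ← Abelian.Ext.mk₀_comp_mk₀_assoc]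
        rfl }
  δ S h n := ModuleCat.ofHom ((isShortExact_toX S.unop h).extClass.precompOfLinear k
    ((toX k A).obj N) (add_comm 1 n))

/-- `Ext_X^*(M, -)`, with the connecting maps given by the Yoneda product with the class of the
extension. -/
noncomputable def extDelta₂ (M : HopfBimodule k A) :
    DeltaData k (IsShortExact (k := k) (A := A)) where
  T n :=
    { obj N := ModuleCat.of k (ExtX M N n)
      map f := ModuleCat.ofHom ((Abelian.Ext.mk₀ ((toX k A).map f)).postcompOfLinear k
        ((toX k A).obj M) (add_zero n))
      map_id M := by ext x; simp
      map_comp f g := by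
        ext x
        change x.comp (Abelian.Ext.mk₀ ((toX k A).map (f ≫ g))) (add_zero n) = _
        rw [Functor.map_comp, ← Abelian.Ext.mk₀_comp_mk₀, ← Abelian.Ext.comp_assoc_of_third_deg_zero]
        rfl }
  δ S h n := ModuleCat.ofHom ((isShortExact_toX S h).extClass.postcompOfLinear k
    ((toX k A).obj M) rfl)

/-- `φ` restricts to the identity of `Hom_{A4}(M, N)` in degree `0`, where `Hom_{A4}(M, N)` is
identified with `H_{A4}⁰(M, N)` through `homToH` and with `Ext_X⁰(M, N)` through `Ext.mk₀`. -/
def ExtendsId₁ {N : HopfBimodule k A} (φ : DeltaData.Hom (hopfDelta₁ N) (extDelta₁ N)) : Prop :=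
  ∀ (M : HopfBimodule k A) (β : M ⟶ N),
    (φ.app 0).app (Opposite.op M) (homToH M N β) = Abelian.Ext.mk₀ ((toX k A).map β)

/-- `φ` restricts to the identity of `Hom_{A4}(M, N)` in degree `0`. -/
def ExtendsId₂ {M : HopfBimodule k A} (φ : DeltaData.Hom (hopfDelta₂ M) (extDelta₂ M)) : Prop :=
  ∀ (N : HopfBimodule k A) (β : M ⟶ N),
    (φ.app 0).app N (homToH M N β) = Abelian.Ext.mk₀ ((toX k A).map β)

end ExtX
end HopfBimodule
end CRHopf

open CRHopf CRHopf.HopfBimodule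

/-! Both families of groups are universal δ-functors with the same degree-zero term. A δ-functor
that vanishes in positive degrees on injectives (in the contravariant variable: on projectives) is
determined by its degree-zero part through dimension shifting: any map out of it extends uniquely
from degree 0, and an isomorphism in degree 0 is one in all degrees if the target vanishes there as
well (`exists_hom`, `hom_eq_of_app_zero_eq`, `isIso_app`). For Ext over `X` the vanishing is
standard, so the work lies in the ambient category and in three properties of the double complex.

The ambient category. Since `A` is finite-dimensional, a coaction of `A` is the same thing as an
action of the dual algebra: it is recovered from the operators of the functionals by means of a
basis and its dual basis. The compatibility of actions with coactions becomes, after solving for the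
other order of the factors with the antipode or its inverse, the commutation rule defining `X`.
Hence `toX` is an equivalence of Hopf bimodules with all left `X`-modules. Hopf bimodules therefore
form an abelian category with enough projectives and injectives, in which exactness is exactness of
vector spaces.

Vanishing and degree 0. The bar complex of `M` and the cobar complex of `N` are exact, as they are
contractible over `k` (`barD_exact`, `cobD_exact`). If `M` is projective, the action `M ⊗ A ⟶ M`
splits by a morphism `s` of Hopf bimodules, and the maps `s ⊗ 1` contract the augmented rows of the
double complex; what is left is the complex of the `Hom(M, A^{⊗ p+1} ⊗ N)`, exact in positive
degrees because `M` is projective. For `N` injective the two directions are exchanged. In degree 0 a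
cocycle `M ⊗ A ⟶ A ⊗ N` factors through the cokernel `M` of the bar differential and through the
kernel `N` of the cobar differential, for every `M` and `N`.

Exactness in each variable. An entry of the double complex has the form `Hom(V ⊗ A, A ⊗ W)`, where
`V ⊗ A` is free for the right action and `A ⊗ W` is cofree for the left coaction. Such a morphism
amounts to a linear map `V ⟶ W` commuting with the left actions and the right coactions (`core`,
`extend`, `lin_tmul_one`). With these two structures a Hopf bimodule is an ordinary Hopf module, so
by the fundamental theorem it is rebuilt from its coinvariants, and any linear splitting can be
averaged into a compatible one (`reynolds`). Thus `Hom(V ⊗ A, A ⊗ W)` is exact in `V` and in `W`,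
although neither `V ⊗ A` is assumed projective nor `A ⊗ W` injective. -/

namespace CRHopf
-- Separating tensors by functionals on `A`
section DualSeparation
variable {k A V : Type u} [Field k] [Ring A] [HopfAlgebra k A] [FiniteDimensional k A]
  [AddCommGroup V] [Module k V]

/-- A tensor is the sum of its slices along the dual basis, each put back against the matching basis
vector. Identities between coactions are reduced in this way to identities between operators. -/
lemma eq_of_rTensor_dual {t s : A ⊗[k] V} (h : ∀ l : Module.Dual k A,
    TensorProduct.lid k V (LinearMap.rTensor V l t) =
      TensorProduct.lid k V (LinearMap.rTensor V l s)) : t = s := by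
  let b := Module.finBasis k A
  have e : ∀ t : A ⊗[k] V,
      ∑ i, b i ⊗ₜ[k] TensorProduct.lid k V (LinearMap.rTensor V (b.coord i) t) = t := by
    intro t
    induction t with
    | zero => simp
    | add x y hx hy =>
      simp only [map_add, TensorProduct.tmul_add, Finset.sum_add_distrib, hx, hy]
    | tmul a v =>
      conv_rhs => rw [← b.sum_repr a]
      simp [TensorProduct.sum_tmul, TensorProduct.smul_tmul, -Module.Basis.sum_repr]
  rw [← e t, ← e s]
  exact Finset.sum_congr rfl fun i _ => by rw [h]

lemma eq_of_lTensor_dual {t s : V ⊗[k] A} (h : ∀ l : Module.Dual k A,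
    TensorProduct.rid k V (LinearMap.lTensor V l t) =
      TensorProduct.rid k V (LinearMap.lTensor V l s)) : t = s := by
  apply (TensorProduct.comm k V A).injective
  apply eq_of_rTensor_dual
  have e : ∀ (l : Module.Dual k A) (t : V ⊗[k] A),
      TensorProduct.lid k V (LinearMap.rTensor V l (TensorProduct.comm k V A t)) =
        TensorProduct.rid k V (LinearMap.lTensor V l t) := by
    intro l t
    induction t with
    | zero => simp
    | add x y hx hy => simp only [map_add, hx, hy]
    | tmul a v => simp
  intro l
  rw [e, e, h]

end DualSeparation

/-! ### Solving the commutation relations for the opposite order -/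

section Inversion
variable {k A B : Type u} [Field k] [Ring A] [HopfAlgebra k A] [Ring B] [Algebra k B]
local notation "δ" => Coalgebra.comul (R := k) (A := A)
local notation "ε" => Coalgebra.counit (R := k) (A := A)

/-- Applying `h` to each factor of `∑ alp(a₍₂₎) lam(pre(a₍₁₎) l)` gives `∑ lam(pre(T a₍₂₎) pre(a₍₁₎)
l) alp(a₍₃₎)`. By `hm` the two operators `pre` merge into `pre(m(a₍₁₎ ⊗ a₍₂₎))`, which collapses by
the antipode identity `hε` and leaves `lam(l) alp(a)`. Here `T` stands for the antipode or its
inverse, and `m` for the twisted product that makes it cancel. -/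
lemma mul_eq_of_comul_mul {lam : Module.Dual k A →ₗ[k] B} {alp : A →ₗ[k] B}
    {pre : A →ₗ[k] Module.Dual k A →ₗ[k] Module.Dual k A} {T : A →ₗ[k] A} {m : A ⊗[k] A →ₗ[k] A}
    (hm : ∀ x y f, pre (T y) (pre x f) = pre (m (x ⊗ₜ y)) f)
    (hε : ∀ a, m (δ a) = algebraMap k A (ε a)) (h1 : ∀ f, pre 1 f = f)
    (h : ∀ a l, alp a * lam l =
      LinearMap.mul' k B (TensorProduct.map (lam ∘ₗ pre.flip l ∘ₗ T) alp (δ a)))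
    (l : Module.Dual k A) (a : A) : lam l * alp a = LinearMap.mul' k B
      (TensorProduct.map alp (lam ∘ₗ pre.flip l) (TensorProduct.comm k A A (δ a))) := by
  -- `F` sends `x ⊗ y ⊗ z` to `lam(pre(m(x ⊗ y)) l) alp(z)`. Its value on the iterated coproduct of
  -- `a` is computed twice: collapsing the first two factors, and using `h` on the last two.
  let F : (A ⊗[k] A) ⊗[k] A →ₗ[k] B :=
    LinearMap.mul' k B ∘ₗ TensorProduct.map (lam ∘ₗ pre.flip l) alp ∘ₗ LinearMap.rTensor A m
  have e1 : F ((TensorProduct.assoc k A A A).symm (comul₃ k A a)) = lam l * alp a := by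
    simp only [F, LinearMap.comp_apply]
    rw [cancel_left hε]
    simp [h1]
  have e2 : ∀ x (t : A ⊗[k] A), F ((TensorProduct.assoc k A A A).symm (x ⊗ₜ t)) =
      LinearMap.mul' k B (TensorProduct.map (lam ∘ₗ pre.flip (pre x l) ∘ₗ T) alp t) := by
    intro x t
    induction t with
    | zero => simp
    | add x y hx hy => simp only [map_add, TensorProduct.tmul_add, hx, hy]
    | tmul y z => simp [F, hm]
  have e0 : comul₃ k A a = LinearMap.lTensor A δ (δ a) := rfl
  rw [← e1, e0, ← (ℛ k a).eq]
  simp only [map_sum, LinearMap.lTensor_tmul, e2, ← h, TensorProduct.comm_tmul,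
    TensorProduct.map_tmul]
  rfl

/-- The mirror image, for relations in which the functional is moved by the last factor of the
coproduct: here the factors `a₍₂₎` and `a₍₃₎` cancel and `a₍₁₎` survives. -/
lemma mul_eq_of_comul_comm_mul {lam : Module.Dual k A →ₗ[k] B} {alp : A →ₗ[k] B}
    {pre : A →ₗ[k] Module.Dual k A →ₗ[k] Module.Dual k A} {T : A →ₗ[k] A} {m : A ⊗[k] A →ₗ[k] A}
    (hm : ∀ x y f, pre (T x) (pre y f) = pre (m (x ⊗ₜ y)) f)
    (hε : ∀ a, m (δ a) = algebraMap k A (ε a)) (h1 : ∀ f, pre 1 f = f)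
    (h : ∀ a l, alp a * lam l = LinearMap.mul' k B
      (TensorProduct.map (lam ∘ₗ pre.flip l ∘ₗ T) alp (TensorProduct.comm k A A (δ a))))
    (l : Module.Dual k A) (a : A) : lam l * alp a = LinearMap.mul' k B
      (TensorProduct.map alp (lam ∘ₗ pre.flip l) (δ a)) := by
  let F : A ⊗[k] (A ⊗[k] A) →ₗ[k] B :=
    LinearMap.mul' k B ∘ₗ TensorProduct.map (lam ∘ₗ pre.flip l) alp ∘ₗ
      (TensorProduct.comm k A A).toLinearMap ∘ₗ LinearMap.lTensor A m
  have e1 : F (comul₃ k A a) = lam l * alp a := by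
    simp only [F, LinearMap.comp_apply]
    rw [cancel_right hε]
    simp [h1]
  have e2 : ∀ x (t : A ⊗[k] A), F (TensorProduct.assoc k A A A (t ⊗ₜ x)) =
      LinearMap.mul' k B (TensorProduct.map (lam ∘ₗ pre.flip (pre x l) ∘ₗ T) alp
        (TensorProduct.comm k A A t)) := by
    intro x t
    induction t with
    | zero => simp
    | add x y hx hy => simp only [map_add, TensorProduct.add_tmul, hx, hy]
    | tmul y z => simp [F, hm]
  have e0 : comul₃ k A a = TensorProduct.assoc k A A A (LinearMap.rTensor A δ (δ a)) :=
    (Coalgebra.coassoc_apply a).symm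
  rw [← e1, e0, ← (ℛ k a).eq]
  simp only [map_sum, LinearMap.rTensor_tmul, e2, ← h, TensorProduct.map_tmul]
  rfl

end Inversion

section RepInversion
variable {k A B : Type u} [Field k] [Ring A] [HopfAlgebra k A] [FiniteDimensional k A]
  [Ring B] [Algebra k B] {lam kap : Module.Dual k A →ₗ[k] B} {alp bet : A →ₗ[k] B}
local notation "S" => HopfAlgebra.antipode k (A := A)
local notation "S'" => antipodeInv k A
local notation "δ" => Coalgebra.comul (R := k) (A := A)

namespace CRRep
variable (h : CRRep lam kap alp bet)
include h

/-- The relations of `X` move functionals to the left of elements of `A`. The four lemmas here move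
them to the right, where no antipode remains: applied to a vector, they are the slices of the four
compatibilities between actions and coactions. -/
lemma lam_mul_alp (l : Module.Dual k A) (a : A) : lam l * alp a = LinearMap.mul' k B
    (TensorProduct.map alp (lam ∘ₗ (preL k A).flip l) (TensorProduct.comm k A A (δ a))) :=
  mul_eq_of_comul_mul (T := S) (m := LinearMap.mul' k A ∘ₗ LinearMap.lTensor A S)
    (fun x y f => by ext; simp [mul_assoc])
    (fun a => HopfAlgebra.mul_antipode_lTensor_comul_apply a) (fun f => by ext; simp) h.alp_lam l a

lemma lam_mul_bet (l : Module.Dual k A) (b : A) : lam l * bet b = LinearMap.mul' k B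
    (TensorProduct.map bet (lam ∘ₗ (preR k A).flip l) (TensorProduct.comm k A A (δ b))) :=
  mul_eq_of_comul_mul (T := S')
    (m := LinearMap.mul' k A ∘ₗ (TensorProduct.comm k A A).toLinearMap ∘ₗ LinearMap.lTensor A S')
    (fun x y f => by ext; simp [mul_assoc])
    mul_antipodeInv_lTensor (fun f => by ext; simp) h.bet_lam l b

lemma kap_mul_alp (l : Module.Dual k A) (a : A) : kap l * alp a = LinearMap.mul' k B
    (TensorProduct.map alp (kap ∘ₗ (preL k A).flip l) (δ a)) :=
  mul_eq_of_comul_comm_mul (T := S')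
    (m := LinearMap.mul' k A ∘ₗ (TensorProduct.comm k A A).toLinearMap ∘ₗ LinearMap.rTensor A S')
    (fun x y f => by ext; simp [mul_assoc])
    mul_antipodeInv_rTensor (fun f => by ext; simp) h.alp_kap l a

lemma kap_mul_bet (l : Module.Dual k A) (b : A) : kap l * bet b = LinearMap.mul' k B
    (TensorProduct.map bet (kap ∘ₗ (preR k A).flip l) (δ b)) :=
  mul_eq_of_comul_comm_mul (T := S) (m := LinearMap.mul' k A ∘ₗ LinearMap.rTensor A S)
    (fun x y f => by ext; simp [mul_assoc])
    (fun a => HopfAlgebra.mul_antipode_rTensor_comul_apply a) (fun f => by ext; simp) h.bet_kap l b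

end CRRep
end RepInversion

/-! ### Hopf bimodules from representations of the relations -/

section OfRep
variable {k A V : Type u} [Field k] [Ring A] [HopfAlgebra k A] [FiniteDimensional k A]
  [AddCommGroup V] [Module k V]
local notation "δ" => Coalgebra.comul (R := k) (A := A)
local notation "ε" => Coalgebra.counit (R := k) (A := A)

/-- The map `V ⟶ A ⊗ V` with `(l ⊗ 1) (lcoactOf lam v) = lam l v`. -/
noncomputable def lcoactOf (lam : Module.Dual k A →ₗ[k] Module.End k V) : V →ₗ[k] A ⊗[k] V :=
  ∑ i, TensorProduct.mk k A V (Module.finBasis k A i) ∘ₗ lam ((Module.finBasis k A).coord i)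

/-- The map `V ⟶ V ⊗ A` with `(1 ⊗ κ) (rcoactOf kap v) = kap κ v`. -/
noncomputable def rcoactOf (kap : Module.Dual k A →ₗ[k] Module.End k V) : V →ₗ[k] V ⊗[k] A :=
  ∑ i, (TensorProduct.mk k V A).flip (Module.finBasis k A i) ∘ₗ kap ((Module.finBasis k A).coord i)

/-- This is the expansion of `l` in the dual basis. It makes `lcoactOf lam` the only coaction whose
slices are the operators `lam l`. -/
lemma lid_rTensor_lcoactOf (lam : Module.Dual k A →ₗ[k] Module.End k V) (l : Module.Dual k A)
    (v : V) : TensorProduct.lid k V (LinearMap.rTensor V l (lcoactOf lam v)) = lam l v := by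
  have e := congrArg (fun f => lam f v) ((Module.finBasis k A).sum_dual_apply_smul_coord l)
  simp only [map_sum, map_smul, LinearMap.sum_apply, LinearMap.smul_apply] at e
  rw [← e]
  simp [lcoactOf, LinearMap.sum_apply]

lemma rid_lTensor_rcoactOf (kap : Module.Dual k A →ₗ[k] Module.End k V) (l : Module.Dual k A)
    (v : V) : TensorProduct.rid k V (LinearMap.lTensor V l (rcoactOf kap v)) = kap l v := by
  have e := congrArg (fun f => kap f v) ((Module.finBasis k A).sum_dual_apply_smul_coord l)
  simp only [map_sum, map_smul, LinearMap.sum_apply, LinearMap.smul_apply] at e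
  rw [← e]
  simp [rcoactOf, LinearMap.sum_apply]

omit [FiniteDimensional k A] in
lemma lid_rTensor_lTensor {W : Type u} [AddCommGroup W] [Module k W] (l : Module.Dual k A)
    (f : V →ₗ[k] W) (t : A ⊗[k] V) :
    TensorProduct.lid k W (LinearMap.rTensor W l (LinearMap.lTensor A f t)) =
      f (TensorProduct.lid k V (LinearMap.rTensor V l t)) := by
  induction t with
  | zero => simp
  | add x y hx hy => simp only [map_add, hx, hy]
  | tmul a v => simp

omit [FiniteDimensional k A] in
lemma rid_lTensor_rTensor {W : Type u} [AddCommGroup W] [Module k W] (l : Module.Dual k A)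
    (f : V →ₗ[k] W) (t : V ⊗[k] A) :
    TensorProduct.rid k W (LinearMap.lTensor W l (LinearMap.rTensor A f t)) =
      f (TensorProduct.rid k V (LinearMap.lTensor V l t)) := by
  induction t with
  | zero => simp
  | add x y hx hy => simp only [map_add, hx, hy]
  | tmul a v => simp

/-- For `s` a coproduct, the left side is a slice of the diagonal action on the coaction of `v`, and
the right side is the one appearing in `CRRep.lam_mul_alp` or `CRRep.lam_mul_bet`. The parameters
`pre` and `μ` cover the left and the right action at once. -/
lemma lid_rTensor_map₂ (lam : Module.Dual k A →ₗ[k] Module.End k V) (alp : A →ₗ[k] Module.End k V)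
    (pre : A →ₗ[k] Module.Dual k A →ₗ[k] Module.Dual k A) (μ : A →ₗ[k] A →ₗ[k] A)
    (hμ : ∀ x y (l : Module.Dual k A), l (μ x y) = pre x l y)
    (l : Module.Dual k A) (v : V) (s : A ⊗[k] A) :
    TensorProduct.lid k V (LinearMap.rTensor V l (TensorProduct.map₂ μ alp s (lcoactOf lam v))) =
      LinearMap.mul' k (Module.End k V)
        (TensorProduct.map alp (lam ∘ₗ pre.flip l) (TensorProduct.comm k A A s)) v := by
  induction s with
  | zero => simp
  | add x y hx hy => simp only [map_add, LinearMap.add_apply, hx, hy]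
  | tmul x y =>
    have e : ∀ t : A ⊗[k] V, TensorProduct.lid k V (LinearMap.rTensor V l
        (TensorProduct.map₂ μ alp (x ⊗ₜ y) t)) =
          alp y (TensorProduct.lid k V (LinearMap.rTensor V (pre x l) t)) := by
      intro t
      induction t with
      | zero => simp
      | add x y hx hy => simp only [map_add, hx, hy]
      | tmul a v => simp [hμ]
    rw [e, lid_rTensor_lcoactOf]
    rfl

lemma rid_lTensor_map₂ (kap : Module.Dual k A →ₗ[k] Module.End k V) (alp : A →ₗ[k] Module.End k V)
    (pre : A →ₗ[k] Module.Dual k A →ₗ[k] Module.Dual k A) (μ : A →ₗ[k] A →ₗ[k] A)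
    (hμ : ∀ x y (l : Module.Dual k A), l (μ x y) = pre x l y)
    (l : Module.Dual k A) (v : V) (s : A ⊗[k] A) :
    TensorProduct.rid k V (LinearMap.lTensor V l (TensorProduct.map₂ alp μ s (rcoactOf kap v))) =
      LinearMap.mul' k (Module.End k V) (TensorProduct.map alp (kap ∘ₗ pre.flip l) s) v := by
  induction s with
  | zero => simp
  | add x y hx hy => simp only [map_add, LinearMap.add_apply, hx, hy]
  | tmul x y =>
    have e : ∀ t : V ⊗[k] A, TensorProduct.rid k V (LinearMap.lTensor V l
        (TensorProduct.map₂ alp μ (x ⊗ₜ y) t)) =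
          alp x (TensorProduct.rid k V (LinearMap.lTensor V (pre y l) t)) := by
      intro t
      induction t with
      | zero => simp
      | add x y hx hy => simp only [map_add, hx, hy]
      | tmul a v => simp [hμ]
    rw [e, rid_lTensor_rcoactOf]
    rfl

/-- Slicing by `l` and then by `l'` turns the side with the coproduct into the operator of the
convolution product, and the other side into a composite of two operators. The order reversal in `h`
reflects that a left comodule is a module over the opposite of the dual algebra. -/
lemma coassoc_lcoactOf {lam : Module.Dual k A →ₗ[k] Module.End k V}
    (h : ∀ l l', lam l * lam l' = lam (dualMul k A l' l)) (v : V) :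
    TensorProduct.assoc k A A V (LinearMap.rTensor V δ (lcoactOf lam v)) =
      LinearMap.lTensor A (lcoactOf lam) (lcoactOf lam v) := by
  refine eq_of_rTensor_dual fun l => eq_of_rTensor_dual fun l' => ?_
  have e1 : ∀ t : A ⊗[k] V, TensorProduct.lid k V (LinearMap.rTensor V l'
      (TensorProduct.lid k (A ⊗[k] V) (LinearMap.rTensor (A ⊗[k] V) l
        (TensorProduct.assoc k A A V (LinearMap.rTensor V δ t))))) =
          TensorProduct.lid k V (LinearMap.rTensor V (dualMul k A l l') t) := by
    intro t
    induction t with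
    | zero => simp
    | add x y hx hy => simp only [map_add, hx, hy]
    | tmul a v =>
      change _ = TensorProduct.lid k V (LinearMap.mul' k k (TensorProduct.map l l' (δ a)) ⊗ₜ v)
      rw [LinearMap.rTensor_tmul]
      induction δ a with
      | zero => simp
      | add x y hx hy => simp only [map_add, TensorProduct.add_tmul, hx, hy]
      | tmul a b => simp [smul_smul]
  rw [e1, lid_rTensor_lTensor, lid_rTensor_lcoactOf, lid_rTensor_lcoactOf, lid_rTensor_lcoactOf,
    ← h]
  rfl

lemma coassoc_rcoactOf {kap : Module.Dual k A →ₗ[k] Module.End k V}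
    (h : ∀ l l', kap l * kap l' = kap (dualMul k A l l')) (v : V) :
    TensorProduct.assoc k V A A (LinearMap.rTensor A (rcoactOf kap) (rcoactOf kap v)) =
      LinearMap.lTensor V δ (rcoactOf kap v) := by
  -- Reassociating puts a factor `A` at the far right on both levels, where `eq_of_lTensor_dual` can
  -- slice it off.
  rw [← LinearEquiv.eq_symm_apply]
  refine eq_of_lTensor_dual fun l => eq_of_lTensor_dual fun l' => ?_
  have e1 : ∀ t : V ⊗[k] A, TensorProduct.rid k V (LinearMap.lTensor V l'
      (TensorProduct.rid k (V ⊗[k] A) (LinearMap.lTensor (V ⊗[k] A) l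
        ((TensorProduct.assoc k V A A).symm (LinearMap.lTensor V δ t))))) =
          TensorProduct.rid k V (LinearMap.lTensor V (dualMul k A l' l) t) := by
    intro t
    induction t with
    | zero => simp
    | add x y hx hy => simp only [map_add, hx, hy]
    | tmul v a =>
      change _ = TensorProduct.rid k V (v ⊗ₜ LinearMap.mul' k k (TensorProduct.map l' l (δ a)))
      rw [LinearMap.lTensor_tmul]
      induction δ a with
      | zero => simp
      | add x y hx hy => simp only [map_add, TensorProduct.tmul_add, hx, hy]
      | tmul a b => simp [smul_smul, mul_comm]
  rw [e1, rid_lTensor_rTensor, rid_lTensor_rcoactOf, rid_lTensor_rcoactOf, rid_lTensor_rcoactOf,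
    ← h]
  rfl

/-- Slicing on both outer factors turns the commutation of the two coactions into that of the
operators `lam l` and `kap κ`. -/
lemma lcoactOf_rcoactOf {lam kap : Module.Dual k A →ₗ[k] Module.End k V}
    (h : ∀ l κ, kap κ * lam l = lam l * kap κ) (v : V) :
    TensorProduct.assoc k A V A (LinearMap.rTensor A (lcoactOf lam) (rcoactOf kap v)) =
      LinearMap.lTensor A (rcoactOf kap) (lcoactOf lam v) := by
  refine eq_of_rTensor_dual fun l => eq_of_lTensor_dual fun κ => ?_
  have e1 : ∀ t : V ⊗[k] A, TensorProduct.lid k (V ⊗[k] A) (LinearMap.rTensor (V ⊗[k] A) l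
        (TensorProduct.assoc k A V A (LinearMap.rTensor A (lcoactOf lam) t))) =
      LinearMap.rTensor A (lam l) t := by
    intro t
    induction t with
    | zero => simp
    | add x y hx hy => simp only [map_add, hx, hy]
    | tmul v a =>
      rw [LinearMap.rTensor_tmul, LinearMap.rTensor_tmul, ← lid_rTensor_lcoactOf]
      induction lcoactOf lam v with
      | zero => simp
      | add x y hx hy => simp only [map_add, TensorProduct.add_tmul, hx, hy]
      | tmul a b => simp [TensorProduct.smul_tmul']
  rw [e1, rid_lTensor_rTensor, lid_rTensor_lTensor, lid_rTensor_lcoactOf, rid_lTensor_rcoactOf,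
    rid_lTensor_rcoactOf]
  exact (LinearMap.congr_fun (h l κ) v).symm

/-- The Hopf bimodule attached to a representation of the Cibils–Rosso relations on `V`. -/
noncomputable def CRRep.toHopfBimodule {lam kap : Module.Dual k A →ₗ[k] Module.End k V}
    {alp bet : A →ₗ[k] Module.End k V} (h : CRRep lam kap alp bet) : HopfBimodule k A where
  carrier := V
  lact := alp
  ract := bet
  lcoact := lcoactOf lam
  rcoact := rcoactOf kap
  lact_one m := LinearMap.congr_fun h.alp_one m
  lact_mul a b m := LinearMap.congr_fun (h.alp_mul a b).symm m
  ract_one m := LinearMap.congr_fun h.bet_one m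
  ract_mul a b m := LinearMap.congr_fun (h.bet_mul b a).symm m
  ract_lact a b m := LinearMap.congr_fun (h.alp_bet a b) m
  counit_lcoact m := (lid_rTensor_lcoactOf lam ε m).trans (LinearMap.congr_fun h.lam_one m)
  coassoc_lcoact := coassoc_lcoactOf h.lam_mul
  counit_rcoact m := (rid_lTensor_rcoactOf kap ε m).trans (LinearMap.congr_fun h.kap_one m)
  coassoc_rcoact := coassoc_rcoactOf h.kap_mul
  lcoact_rcoact := lcoactOf_rcoactOf h.lam_kap
  lcoact_lact a m := eq_of_rTensor_dual fun l => by
    rw [lid_rTensor_lcoactOf, lid_rTensor_map₂ lam alp (preL k A) _ (fun _ _ _ => rfl),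
      ← h.lam_mul_alp]
    rfl
  lcoact_ract a m := eq_of_rTensor_dual fun l => by
    rw [lid_rTensor_lcoactOf, lid_rTensor_map₂ lam bet (preR k A) _ (fun _ _ _ => rfl),
      ← h.lam_mul_bet]
    rfl
  rcoact_lact a m := eq_of_lTensor_dual fun l => by
    rw [rid_lTensor_rcoactOf, rid_lTensor_map₂ kap alp (preL k A) _ (fun _ _ _ => rfl),
      ← h.kap_mul_alp]
    rfl
  rcoact_ract a m := eq_of_lTensor_dual fun l => by
    rw [rid_lTensor_rcoactOf, rid_lTensor_map₂ kap bet (preR k A) _ (fun _ _ _ => rfl),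
      ← h.kap_mul_bet]
    rfl

end OfRep
end CRHopf

/-! ### Generators of the Cibils–Rosso algebra -/

namespace CRHopf
section Universal
variable {k A : Type u} [Field k] [Ring A] [HopfAlgebra k A] [FiniteDimensional k A]
local notation "δ" => Coalgebra.comul (R := k) (A := A)
local notation "ε" => Coalgebra.counit (R := k) (A := A)

lemma map_mul'_map {B B' V W : Type u} [Ring B] [Algebra k B] [Ring B'] [Algebra k B']
    [AddCommGroup V] [Module k V] [AddCommGroup W] [Module k W] (ρ : B →ₐ[k] B')
    (f : V →ₗ[k] B) (g : W →ₗ[k] B) (t : V ⊗[k] W) :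
    ρ (LinearMap.mul' k B (TensorProduct.map f g t)) =
      LinearMap.mul' k B' (TensorProduct.map (ρ.toLinearMap ∘ₗ f) (ρ.toLinearMap ∘ₗ g) t) := by
  induction t with
  | zero => simp
  | add x y hx hy => simp only [map_add, hx, hy]
  | tmul a v => simp

section
variable {B B' : Type u} [Ring B] [Algebra k B] [Ring B'] [Algebra k B']
  {lam kap : Module.Dual k A →ₗ[k] B} {alp bet : A →ₗ[k] B}

lemma CRRep.map (h : CRRep lam kap alp bet) (ρ : B →ₐ[k] B') :
    CRRep (ρ.toLinearMap ∘ₗ lam) (ρ.toLinearMap ∘ₗ kap) (ρ.toLinearMap ∘ₗ alp)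
      (ρ.toLinearMap ∘ₗ bet) where
  lam_one := by simp [h.lam_one]
  kap_one := by simp [h.kap_one]
  alp_one := by simp [h.alp_one]
  bet_one := by simp [h.bet_one]
  lam_mul l l' := by simp [← h.lam_mul]
  kap_mul l l' := by simp [← h.kap_mul]
  alp_mul l l' := by simp [← h.alp_mul]
  bet_mul l l' := by simp [← h.bet_mul]
  lam_kap l κ := by simp only [LinearMap.comp_apply, AlgHom.toLinearMap_apply, ← map_mul, h.lam_kap]
  alp_bet a b := by simp only [LinearMap.comp_apply, AlgHom.toLinearMap_apply, ← map_mul, h.alp_bet]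
  alp_lam a l := by
    simp only [LinearMap.comp_apply, AlgHom.toLinearMap_apply, ← map_mul, h.alp_lam, map_mul'_map]
    rfl
  alp_kap a l := by
    simp only [LinearMap.comp_apply, AlgHom.toLinearMap_apply, ← map_mul, h.alp_kap, map_mul'_map]
    rfl
  bet_lam a l := by
    simp only [LinearMap.comp_apply, AlgHom.toLinearMap_apply, ← map_mul, h.bet_lam, map_mul'_map]
    rfl
  bet_kap a l := by
    simp only [LinearMap.comp_apply, AlgHom.toLinearMap_apply, ← map_mul, h.bet_kap, map_mul'_map]
    rfl

/-- All the relations are equations in the algebra, so they may be tested in a faithful image. It is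
used for the left regular representation, where they are already known as `opRep`. -/
lemma CRRep.of_injective (ρ : B →ₐ[k] B') (hρ : Function.Injective ρ)
    (h : CRRep (ρ.toLinearMap ∘ₗ lam) (ρ.toLinearMap ∘ₗ kap) (ρ.toLinearMap ∘ₗ alp)
      (ρ.toLinearMap ∘ₗ bet)) : CRRep lam kap alp bet where
  lam_one := hρ (by simpa using h.lam_one)
  kap_one := hρ (by simpa using h.kap_one)
  alp_one := hρ (by simpa using h.alp_one)
  bet_one := hρ (by simpa using h.bet_one)
  lam_mul l l' := hρ (by simpa using h.lam_mul l l')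
  kap_mul l l' := hρ (by simpa using h.kap_mul l l')
  alp_mul l l' := hρ (by simpa using h.alp_mul l l')
  bet_mul l l' := hρ (by simpa using h.bet_mul l l')
  lam_kap l κ := hρ (by simpa using h.lam_kap l κ)
  alp_bet a b := hρ (by simpa using h.alp_bet a b)
  alp_lam a l := hρ (by
    rw [map_mul'_map]
    exact (map_mul ρ _ _).trans (h.alp_lam a l))
  alp_kap a l := hρ (by
    rw [map_mul'_map]
    exact (map_mul ρ _ _).trans (h.alp_kap a l))
  bet_lam a l := hρ (by
    rw [map_mul'_map]
    exact (map_mul ρ _ _).trans (h.bet_lam a l))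
  bet_kap a l := hρ (by
    rw [map_mul'_map]
    exact (map_mul ρ _ _).trans (h.bet_kap a l))

end

variable (k A) in
/-- Left multiplication of `X` on itself, as a map of algebras. -/
noncomputable def crMulHom : CibilsRosso k A →ₐ[k] Module.End k (CibilsRosso k A) :=
  AlgHom.ofLinearMap (crMul k A) crMul_crOne crMul_crMul

lemma crMulHom_injective : Function.Injective (crMulHom k A) := fun x y h => by
  have := LinearMap.congr_fun h (crOne k A)
  change crMul k A x _ = crMul k A y _ at this
  rwa [crMul_one_right, crMul_one_right] at this

variable (k A) in
/-- `l ↦ (l ⊗ ε) ⊗ (1 ⊗ 1)`. -/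
noncomputable def crLam : Module.Dual k A →ₗ[k] CibilsRosso k A :=
  (TensorProduct.mk k (Module.Dual k A ⊗[k] Module.Dual k A) (A ⊗[k] A)).flip (1 ⊗ₜ 1) ∘ₗ
    (TensorProduct.mk k _ _).flip ε

variable (k A) in
/-- `κ ↦ (ε ⊗ κ) ⊗ (1 ⊗ 1)`. -/
noncomputable def crKap : Module.Dual k A →ₗ[k] CibilsRosso k A :=
  (TensorProduct.mk k (Module.Dual k A ⊗[k] Module.Dual k A) (A ⊗[k] A)).flip (1 ⊗ₜ 1) ∘ₗ
    TensorProduct.mk k _ _ ε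

variable (k A) in
/-- `a ↦ (ε ⊗ ε) ⊗ (a ⊗ 1)`. -/
noncomputable def crAlp : A →ₗ[k] CibilsRosso k A :=
  TensorProduct.mk k (Module.Dual k A ⊗[k] Module.Dual k A) (A ⊗[k] A) (ε ⊗ₜ ε) ∘ₗ
    (TensorProduct.mk k _ _).flip 1

variable (k A) in
/-- `b ↦ (ε ⊗ ε) ⊗ (1 ⊗ b)`. -/
noncomputable def crBet : A →ₗ[k] CibilsRosso k A :=
  TensorProduct.mk k (Module.Dual k A ⊗[k] Module.Dual k A) (A ⊗[k] A) (ε ⊗ₜ ε) ∘ₗ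
    TensorProduct.mk k _ _ 1

/-- The generators of `X` satisfy the Cibils–Rosso relations. -/
lemma crGenRep : CRRep (crLam k A) (crKap k A) (crAlp k A) (crBet k A) := by
  refine CRRep.of_injective (crMulHom k A) crMulHom_injective ?_
  have h := opRep (k := k) (A := A)
  -- Left multiplication by a pure tensor is the product of four operators, and for a generator
  -- three of them are the identity.
  have e1 : (crMulHom k A).toLinearMap ∘ₗ crLam k A = opLam k A := LinearMap.ext fun l => by
    change opLam k A l * opKap k A ε * (opAlp k A 1 * opBet k A 1) = opLam k A l
    rw [h.kap_one, h.alp_one, h.bet_one, mul_one, mul_one, mul_one]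
  have e2 : (crMulHom k A).toLinearMap ∘ₗ crKap k A = opKap k A := LinearMap.ext fun l => by
    change opLam k A ε * opKap k A l * (opAlp k A 1 * opBet k A 1) = opKap k A l
    rw [h.lam_one, h.alp_one, h.bet_one, mul_one, mul_one, one_mul]
  have e3 : (crMulHom k A).toLinearMap ∘ₗ crAlp k A = opAlp k A := LinearMap.ext fun a => by
    change opLam k A ε * opKap k A ε * (opAlp k A a * opBet k A 1) = opAlp k A a
    rw [h.lam_one, h.kap_one, h.bet_one, mul_one, one_mul, mul_one]
  have e4 : (crMulHom k A).toLinearMap ∘ₗ crBet k A = opBet k A := LinearMap.ext fun a => by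
    change opLam k A ε * opKap k A ε * (opAlp k A 1 * opBet k A a) = opBet k A a
    rw [h.lam_one, h.kap_one, h.alp_one, one_mul, one_mul, one_mul]
  rw [e1, e2, e3, e4]
  exact h

/-- The four families generate `X`: an `X`-module structure is determined by the operators they
induce. -/
lemma crGen_mul (l κ : Module.Dual k A) (a b : A) :
    crLam k A l * crKap k A κ * (crAlp k A a * crBet k A b) = crTmul k A l κ a b := by
  have h1 : crAlp k A a * crBet k A b = crTmul k A ε ε a b :=
    (crTmul_mul_right a 1 1 b).trans (by rw [mul_one, mul_one])
  have h2 : crLam k A l * crKap k A κ = crTmul k A l κ 1 1 :=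
    (crTmul_mul_left l ε ε κ 1 1).trans (by rw [counit_dualMul, counit_dualMul])
  rw [h1, h2, crTmul_mul_left, counit_dualMul, dualMul_counit]

end Universal

/-! ### The equivalence with `X`-modules -/

namespace HopfBimodule
section Equivalence
variable {k A : Type u} [Field k] [Ring A] [HopfAlgebra k A] [FiniteDimensional k A]
local notation "ε" => Coalgebra.counit (R := k) (A := A)

lemma crAlp_smul (M : HopfBimodule k A) (a : A) (m : M.carrier) :
    crAlp k A a • m = M.lact a m := by
  change crTmul k A ε ε a 1 • m = _
  rw [crTmul_smul, M.crRep.lam_one, M.crRep.kap_one, M.crRep.bet_one]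
  rfl

lemma crBet_smul (M : HopfBimodule k A) (a : A) (m : M.carrier) :
    crBet k A a • m = M.ract a m := by
  change crTmul k A ε ε 1 a • m = _
  rw [crTmul_smul, M.crRep.lam_one, M.crRep.kap_one, M.crRep.alp_one]
  rfl

lemma crLam_smul (M : HopfBimodule k A) (l : Module.Dual k A) (m : M.carrier) :
    crLam k A l • m = M.lamAct l m := by
  change crTmul k A l ε 1 1 • m = _
  rw [crTmul_smul, M.crRep.kap_one, M.crRep.alp_one, M.crRep.bet_one]
  rfl

lemma crKap_smul (M : HopfBimodule k A) (l : Module.Dual k A) (m : M.carrier) :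
    crKap k A l • m = M.kapAct l m := by
  change crTmul k A ε l 1 1 • m = _
  rw [crTmul_smul, M.crRep.lam_one, M.crRep.alp_one, M.crRep.bet_one]
  rfl

/-- The scalars of `X` act through the given vector space structure, because they lie in the image
of `A`. This is why an `X`-linear map is automatically `k`-linear. -/
lemma algebraMap_smul_carrier (M : HopfBimodule k A) (c : k) (m : M.carrier) :
    algebraMap k (CibilsRosso k A) c • m = c • m := by
  have h : algebraMap k (CibilsRosso k A) c = crAlp k A (c • 1) := by
    rw [Algebra.algebraMap_eq_smul_one, map_smul, crGenRep.alp_one]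
  rw [h, crAlp_smul, map_smul, LinearMap.smul_apply, M.lact_one]

lemma map_smul_of_xLinear {M N : HopfBimodule k A} (f : M.carrier →ₗ[CibilsRosso k A] N.carrier)
    (c : k) (m : M.carrier) : f (c • m) = c • f m := by
  rw [← algebraMap_smul_carrier, map_smul, algebraMap_smul_carrier]

/-- A map of `X`-modules between Hopf bimodules is a map of Hopf bimodules. -/
noncomputable def homOfXLinear {M N : HopfBimodule k A} (f : M.carrier →ₗ[CibilsRosso k A] N.carrier) :
    M ⟶ N :=
  let g : M.carrier →ₗ[k] N.carrier :=
    { toFun := f, map_add' := map_add f, map_smul' := map_smul_of_xLinear f }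
  mkHom g
    (fun a m => by
      change f _ = N.lact a (f m)
      rw [← crAlp_smul, map_smul, crAlp_smul])
    (fun a m => by
      change f _ = N.ract a (f m)
      rw [← crBet_smul, map_smul, crBet_smul])
    (fun m => eq_of_rTensor_dual fun l => by
      rw [lid_rTensor_lTensor]
      change f (M.lamAct l m) = N.lamAct l (f m)
      rw [← crLam_smul, map_smul, crLam_smul])
    (fun m => eq_of_lTensor_dual fun l => by
      rw [rid_lTensor_rTensor]
      change f (M.kapAct l m) = N.kapAct l (f m)
      rw [← crKap_smul, map_smul, crKap_smul])

/-- The actions of `A` are actions of elements of `X`, and a coaction is determined by its slices,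
which are also such actions. Hence `X`-linearity forces compatibility with all four structures. -/
instance : (toX k A).Full where
  map_surjective f := ⟨homOfXLinear f.hom, rfl⟩

instance : (toX k A).Faithful where
  map_injective h := hom_ext fun m =>
    LinearMap.congr_fun (congrArg ModuleCat.Hom.hom h) m

lemma lamAct_toHopfBimodule {V : Type u} [AddCommGroup V] [Module k V]
    {lam kap : Module.Dual k A →ₗ[k] Module.End k V} {alp bet : A →ₗ[k] Module.End k V}
    (h : CRRep lam kap alp bet) : h.toHopfBimodule.lamAct = lam :=
  LinearMap.ext fun l => LinearMap.ext fun v => lid_rTensor_lcoactOf lam l v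

lemma kapAct_toHopfBimodule {V : Type u} [AddCommGroup V] [Module k V]
    {lam kap : Module.Dual k A →ₗ[k] Module.End k V} {alp bet : A →ₗ[k] Module.End k V}
    (h : CRRep lam kap alp bet) : h.toHopfBimodule.kapAct = kap :=
  LinearMap.ext fun l => LinearMap.ext fun v => rid_lTensor_rcoactOf kap l v

lemma smul_toHopfBimodule {V : Type u} [AddCommGroup V] [Module k V]
    {lam kap : Module.Dual k A →ₗ[k] Module.End k V} {alp bet : A →ₗ[k] Module.End k V}
    (h : CRRep lam kap alp bet) (x : CibilsRosso k A) (v : h.toHopfBimodule.carrier) :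
    x • v = repMap lam kap alp bet x v := by
  change repMap h.toHopfBimodule.lamAct h.toHopfBimodule.kapAct alp bet x v = _
  rw [lamAct_toHopfBimodule, kapAct_toHopfBimodule]
  rfl

/-- The generators of `X` act on `V` by operators satisfying the relations, which makes `V` a Hopf
bimodule. The `X`-action built from this bimodule is the original one, as the two agree on products
of generators. -/
instance : (toX k A).EssSurj where
  mem_essImage V := by
    let : Module k V := Module.compHom V (algebraMap k (CibilsRosso k A))
    have : IsScalarTower k (CibilsRosso k A) V := ⟨fun c x v => by
      rw [Algebra.smul_def, mul_smul]; rfl⟩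
    let ρ : CibilsRosso k A →ₐ[k] Module.End k V := Algebra.lsmul k k V
    have h := (crGenRep (k := k) (A := A)).map ρ
    have e : repMap (ρ.toLinearMap ∘ₗ crLam k A) (ρ.toLinearMap ∘ₗ crKap k A)
        (ρ.toLinearMap ∘ₗ crAlp k A) (ρ.toLinearMap ∘ₗ crBet k A) = ρ.toLinearMap := by
      apply CRSpace.ext_hom
      intro l κ a b
      change ρ (crLam k A l) * ρ (crKap k A κ) * (ρ (crAlp k A a) * ρ (crBet k A b)) =
        ρ (crTmul k A l κ a b)
      rw [← crGen_mul, map_mul, map_mul, map_mul]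
    let i : h.toHopfBimodule.carrier ≃ₗ[CibilsRosso k A] V :=
      { toFun := fun v => v
        invFun := fun v => v
        map_add' := fun _ _ => rfl
        left_inv := fun _ => rfl
        right_inv := fun _ => rfl
        map_smul' := fun x v =>
          (smul_toHopfBimodule h x v).trans (LinearMap.congr_fun (LinearMap.congr_fun e x) v) }
    exact ⟨h.toHopfBimodule, ⟨LinearEquiv.toModuleIso i⟩⟩

instance : (toX k A).IsEquivalence where

instance : Limits.HasFiniteProducts (HopfBimodule k A) :=
  ⟨fun _ => Adjunction.hasLimitsOfShape_of_equivalence (toX k A)⟩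

/-- The category of Hopf bimodules is abelian. -/
noncomputable instance : Abelian (HopfBimodule k A) := abelianOfEquivalence (toX k A)

/-- Projectives and injectives are transported along the equivalence in both directions: they are
needed among Hopf bimodules to compute the double complex, and over `X` to make Ext vanish. -/
instance : EnoughProjectives (HopfBimodule k A) :=
  (Equivalence.enoughProjectives_iff (toX k A).asEquivalence).2 inferInstance

instance : EnoughInjectives (HopfBimodule k A) := EnoughInjectives.of_equivalence (toX k A)

instance {P : HopfBimodule k A} [Projective P] : Projective ((toX k A).obj P) :=
  ((toX k A).asEquivalence.map_projective_iff P).2 inferInstance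

instance {I : HopfBimodule k A} [Injective I] : Injective ((toX k A).obj I) :=
  ((toX k A).asEquivalence.map_injective_iff I).2 inferInstance

/-- The equivalence preserves and reflects exactness, and exactness of modules is a statement about
underlying maps. -/
lemma exact_iff (S : ShortComplex (HopfBimodule k A)) :
    S.Exact ↔ Function.Exact (lin S.f) (lin S.g) := by
  rw [← S.exact_map_iff_of_faithful (toX k A),
    ShortComplex.ShortExact.moduleCat_exact_iff_function_exact]
  rfl

lemma mono_iff {M N : HopfBimodule k A} (f : M ⟶ N) : Mono f ↔ Function.Injective (lin f) := by
  rw [← (toX k A).mono_map_iff_mono, ModuleCat.mono_iff_injective]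
  rfl

lemma epi_iff {M N : HopfBimodule k A} (f : M ⟶ N) : Epi f ↔ Function.Surjective (lin f) := by
  rw [← (toX k A).epi_map_iff_epi, ModuleCat.epi_iff_surjective]
  rfl

/-- The notion of exactness chosen in the theorem agrees with the intrinsic one of the abelian
category, so homological algebra applies to it. -/
lemma isShortExact_iff (S : ShortComplex (HopfBimodule k A)) : IsShortExact S ↔ S.ShortExact := by
  constructor
  · intro h
    have := (mono_iff S.f).2 h.moduleCat_injective_f
    have := (epi_iff S.g).2 h.moduleCat_surjective_g
    exact ShortComplex.ShortExact.mk ((exact_iff S).2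
      ((ShortComplex.ShortExact.moduleCat_exact_iff_function_exact _).1 h.exact))
  · intro h
    exact ModuleCat.shortComplex_shortExact _ ((exact_iff S).1 h.exact)
      ((mono_iff S.f).1 h.mono_f) ((epi_iff S.g).1 h.epi_g)

instance : (toX k A).Linear k where
  map_smul f c := by
    ext m
    exact (algebraMap_smul_carrier _ c _).symm

end Equivalence
end HopfBimodule
end CRHopf

/-! ### Exactness and contractions of the bar and cobar complexes -/

namespace CRHopf
namespace HopfBimodule
section Contractions
variable {k A : Type u} [Field k] [Ring A] [HopfAlgebra k A]

section
variable (M : HopfBimodule k A)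

/-- The linear map `v ↦ v ⊗ 1`. -/
def barUnit (n : ℕ) : (barObj M n).carrier →ₗ[k] (barObj M (n + 1)).carrier :=
  (TensorProduct.mk k (barObj M n).carrier A).flip 1

/-- The linear map `a ⊗ v ↦ ε(a) v`. -/
def cobCounit (n : ℕ) : (cobObj M (n + 1)).carrier →ₗ[k] (cobObj M n).carrier :=
  (TensorProduct.lid k (cobObj M n).carrier).toLinearMap ∘ₗ
    LinearMap.rTensor (cobObj M n).carrier (Coalgebra.counit (R := k) (A := A))

lemma barA_barUnit (n : ℕ) (v) : lin (barA M n) (barUnit M n v) = v :=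
  (barObj M n).ract_one v

lemma cobCounit_cobA (n : ℕ) (v) : cobCounit M n (lin (cobA M n) v) = v :=
  (cobObj M n).counit_lcoact v

lemma barD_zero_barUnit (v) : lin (barD M 0) (barUnit M 0 v) = v := barA_barUnit M 0 v

lemma lin_zsmul {M N : HopfBimodule k A} (c : ℤ) (f : M ⟶ N) : lin (c • f) = c • lin f := by
  induction c using Int.induction_on with
  | zero => simp
  | succ n ih => rw [add_smul, add_smul, lin_add, ih, one_smul, one_smul]
  | pred n ih => rw [sub_smul, sub_smul, lin_sub, ih, one_smul, one_smul]

/-- Inserting `1` at the right end is a contracting homotopy up to the sign `(-1)^(n+1)` that the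
last face carries. It is only linear, so it proves exactness but does not contract the double
complex. -/
lemma barD_succ_barUnit (n : ℕ) (v) : lin (barD M (n + 1)) (barUnit M (n + 1) v) =
    barUnit M n (lin (barD M n) v) + (-1 : ℤ) ^ (n + 1) • v := by
  rw [barD, lin_add, LinearMap.add_apply, lin_zsmul, LinearMap.smul_apply, barA_barUnit]
  rfl

lemma cobCounit_cobD_zero (v) : cobCounit M 0 (lin (cobD M 0) v) = v := cobCounit_cobA M 0 v

/-- The counit on the first factor is a contracting homotopy. No sign occurs, since the coface
applied to the first factor has sign `+1`. -/
lemma cobCounit_cobD_succ (n : ℕ) (v) : cobCounit M (n + 1) (lin (cobD M (n + 1)) v) =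
    v - lin (cobD M n) (cobCounit M n v) := by
  rw [cobD, lin_sub, LinearMap.sub_apply, map_sub, cobCounit_cobA]
  congr 1
  refine ten_ext (f := cobCounit M (n + 1) ∘ₗ lin (cobS (cobD M n)))
    (g := lin (cobD M n) ∘ₗ cobCounit M n) (fun a x => ?_) v
  change ((Coalgebra.counit (R := k) a) • lin (cobD M n) x) =
    lin (cobD M n) ((Coalgebra.counit (R := k) a) • x)
  rw [map_smul]

lemma barD_exact (n : ℕ) : Function.Exact (lin (barD M (n + 1))) (lin (barD M n)) := by
  intro v
  constructor
  · intro h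
    have := barD_succ_barUnit M n v
    rw [h, map_zero, zero_add] at this
    refine ⟨(-1 : ℤ) ^ (n + 1) • barUnit M (n + 1) v, ?_⟩
    rw [map_zsmul, this, smul_smul, ← mul_pow]
    simp
  · rintro ⟨w, rfl⟩
    exact LinearMap.congr_fun (congrArg lin (barD_barD M n)) w

lemma cobD_exact (n : ℕ) : Function.Exact (lin (cobD M n)) (lin (cobD M (n + 1))) := by
  intro v
  constructor
  · intro h
    have := cobCounit_cobD_succ M n v
    rw [h, map_zero] at this
    exact ⟨_, (sub_eq_zero.1 this.symm).symm⟩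
  · rintro ⟨w, rfl⟩
    exact LinearMap.congr_fun (congrArg lin (cobD_cobD M n)) w

lemma barD_zero_surjective : Function.Surjective (lin (barD M 0)) :=
  fun v => ⟨_, barD_zero_barUnit M v⟩

lemma cobD_zero_injective : Function.Injective (lin (cobD M 0)) :=
  Function.LeftInverse.injective (cobCounit_cobD_zero M)

/-- The maps `s ⊗ 1 : M ⊗ A^{⊗ n} ⟶ M ⊗ A^{⊗ n+1}`, for `s : M ⟶ M ⊗ A`. -/
def barHtpy (s : barObj M 0 ⟶ barObj M 1) : (n : ℕ) → (barObj M n ⟶ barObj M (n + 1))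
  | 0 => s
  | n + 1 => barS (barHtpy s n)

/-- The maps `1 ⊗ r : A^{⊗ n+1} ⊗ M ⟶ A^{⊗ n} ⊗ M`, for `r : A ⊗ M ⟶ M`. -/
def cobHtpy (r : cobObj M 1 ⟶ cobObj M 0) : (n : ℕ) → (cobObj M (n + 1) ⟶ cobObj M n)
  | 0 => r
  | n + 1 => cobS (cobHtpy r n)

variable {M}

lemma barS_id (n : ℕ) : barS (𝟙 (barObj M n)) = 𝟙 (barObj M (n + 1)) := tenMap_id
lemma cobS_id (n : ℕ) : cobS (𝟙 (cobObj M n)) = 𝟙 (cobObj M (n + 1)) := cotMap_id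
lemma barS_sub {n m : ℕ} (f g : barObj M n ⟶ barObj M m) : barS (f - g) = barS f - barS g :=
  (tenFunctor k A).map_sub
lemma cobS_add {n m : ℕ} (f g : cobObj M n ⟶ cobObj M m) : cobS (f + g) = cobS f + cobS g :=
  cotMap_add f g
lemma cobS_zsmul {n m : ℕ} (c : ℤ) (f : cobObj M n ⟶ cobObj M m) : cobS (c • f) = c • cobS f :=
  (cotFunctor k A).map_zsmul

/-- A section `s` of the action that is a morphism gives a contraction by morphisms of Hopf
bimodules. Inductively, tensoring with `A` carries the identity one step up, and the last face
commutes with `s ⊗ 1` by naturality of the action. -/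
lemma barHtpy_barD {s : barObj M 0 ⟶ barObj M 1} (hs : s ≫ barD M 0 = 𝟙 _) (n : ℕ) :
    barHtpy M s (n + 1) ≫ barD M (n + 1) = 𝟙 _ - barD M n ≫ barHtpy M s n := by
  induction n with
  | zero =>
    rw [barD.eq_2, Preadditive.comp_add, Preadditive.comp_zsmul]
    change barS s ≫ barS (barD M 0) + (-1 : ℤ) ^ 1 • (barS s ≫ barA M 1) = _
    rw [← barS_comp, hs, barS_id, barA_nat, pow_one, neg_smul, one_smul, sub_eq_add_neg]
    rfl
  | succ n ih =>
    rw [barD, Preadditive.comp_add, Preadditive.comp_zsmul]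
    conv_rhs => rw [barD]
    change barS (barHtpy M s (n + 1)) ≫ barS (barD M (n + 1)) +
      (-1 : ℤ) ^ (n + 2) • (barS (barHtpy M s (n + 1)) ≫ barA M (n + 2)) =
        𝟙 _ - (barS (barD M n) + _) ≫ barS (barHtpy M s n)
    rw [← barS_comp, ih, barA_nat, barS_sub, barS_id, barS_comp, Preadditive.add_comp,
      Preadditive.zsmul_comp, pow_succ _ (n + 1), mul_neg_one, neg_smul]
    change _ = 𝟙 _ - (_ + (-1 : ℤ) ^ (n + 1) • (barA M (n + 1) ≫ barHtpy M s (n + 1)))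
    abel

/-- The dual contraction. The sign `(-1)^(n+1)` arises because `r` acts at the right end, whereas
the recursion for `cobD` adds factors on the left with a minus sign. -/
lemma cobD_cobHtpy {r : cobObj M 1 ⟶ cobObj M 0} (hr : cobD M 0 ≫ r = 𝟙 _) (n : ℕ) :
    cobD M (n + 1) ≫ cobHtpy M r (n + 1) =
      cobHtpy M r n ≫ cobD M n + (-1 : ℤ) ^ (n + 1) • 𝟙 _ := by
  induction n with
  | zero =>
    rw [cobD.eq_2, Preadditive.sub_comp]
    change cobA M 1 ≫ cobS r - cobS (cobD M 0) ≫ cobS r = r ≫ cobA M 0 + (-1 : ℤ) ^ 1 • _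
    rw [← cobS_comp, hr, cobS_id, cobA_nat, pow_one, neg_smul, one_smul, sub_eq_add_neg]
  | succ n ih =>
    rw [cobD, Preadditive.sub_comp]
    conv_rhs => rw [cobD]
    change cobA M (n + 2) ≫ cobS (cobHtpy M r (n + 1)) -
      cobS (cobD M (n + 1)) ≫ cobS (cobHtpy M r (n + 1)) =
        cobHtpy M r (n + 1) ≫ (cobA M (n + 1) - cobS (cobD M n)) + _
    rw [← cobS_comp, ih, ← cobA_nat, cobS_add, cobS_zsmul, cobS_id, cobS_comp,
      Preadditive.comp_sub, pow_succ _ (n + 1), mul_neg_one, neg_smul]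
    change _ - (cobHtpy M r (n + 1) ≫ cobS (cobD M n) + _) = _
    abel

end
end Contractions
end HopfBimodule

/-! ### Acyclic assembly for first-quadrant double complexes -/

section AcyclicAssembly
variable {k : Type u} [Field k] {K : ℕ → ℕ → Type u} [∀ p q, AddCommGroup (K p q)]
  [∀ p q, Module k (K p q)] {dh : ∀ p q, K p q →ₗ[k] K p (q + 1)}
  {dc : ∀ p q, K p q →ₗ[k] K (p + 1) q}

lemma dtotD_apply {n : ℕ} (α : DTot K n) (p q : ℕ) (h : p + q = n + 1) :
    dtotD dh dc n α ⟨(p, q), h⟩ = dtotH dh α p q h + dtotC dc α p q h := rfl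

open Classical in
/-- The element of the total complex with a single component. -/
noncomputable def dtotSingle {n : ℕ} (p q : ℕ) (h : p + q = n) (β : K p q) : DTot K n :=
  Pi.single (M := fun x : {x : ℕ × ℕ // x.1 + x.2 = n} => K x.1.1 x.1.2) ⟨(p, q), h⟩ β

lemma dtotSingle_same {n : ℕ} (p q : ℕ) (h h' : p + q = n) (β : K p q) :
    dtotSingle p q h β ⟨(p, q), h'⟩ = β := by
  rw [dtotSingle, Pi.single_eq_same]

lemma dtotSingle_ne {n : ℕ} (p q p' q' : ℕ) (h : p + q = n) (h' : p' + q' = n) (β : K p q)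
    (hn : q' ≠ q) : dtotSingle p q h β ⟨(p', q'), h'⟩ = 0 := by
  rw [dtotSingle, Pi.single_eq_of_ne]
  intro e
  exact hn (congrArg (fun x => x.1.2) e)

/-- If the rows of a first quadrant double complex are exact in positive degrees, and the complex of
the kernels of the first maps is exact in positive degrees, then the total complex is exact in
positive degrees. -/
lemma exists_dtotD_eq (hrow : ∀ p q (α : K p (q + 1)), dh p (q + 1) α = 0 → ∃ β, dh p q β = α)
    (hcol : ∀ p (α : K (p + 1) 0), dh (p + 1) 0 α = 0 → dc (p + 1) 0 α = 0 →
      ∃ β, dh p 0 β = 0 ∧ dc p 0 β = α)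
    (hdd : ∀ n (α : DTot K n), dtotD dh dc (n + 1) (dtotD dh dc n α) = 0) (n : ℕ) (α : DTot K (n + 1))
    (hα : dtotD dh dc (n + 1) α = 0) : ∃ β, dtotD dh dc n β = α := by
  -- Induction on a bound `j` for the row degrees `q` in which the cocycle has components: row
  -- exactness removes the top component, until only `q = 0` is left.
  suffices H : ∀ j, j ≤ n + 1 → ∀ α : DTot K (n + 1), dtotD dh dc (n + 1) α = 0 →
      (∀ p q (h : p + q = n + 1), j < q → α ⟨(p, q), h⟩ = 0) → ∃ β, dtotD dh dc n β = α by
    exact H (n + 1) le_rfl α hα fun p q h hq => by omega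
  intro j
  induction j with
  | zero =>
    intro _ α hα h0
    -- The cocycle is concentrated in bidegree `(n + 1, 0)`. The two adjacent components of its
    -- differential say that it is a cycle in the complex of kernels, to which `hcol` applies.
    have h1 : dh (n + 1) 0 (α ⟨(n + 1, 0), rfl⟩) = 0 := by
      have := congrFun hα ⟨(n + 1, 1), rfl⟩
      rw [dtotD_apply] at this
      simp only [dtotH, dtotC] at this
      rw [h0 n 1 rfl one_pos, map_zero, add_zero] at this
      exact this
    have h2 : dc (n + 1) 0 (α ⟨(n + 1, 0), rfl⟩) = 0 := by
      have := congrFun hα ⟨(n + 2, 0), rfl⟩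
      rw [dtotD_apply] at this
      simp only [dtotH, dtotC] at this
      rw [zero_add] at this
      exact this
    obtain ⟨β, hβ, hβ'⟩ := hcol n _ h1 h2
    refine ⟨dtotSingle n 0 rfl β, ?_⟩
    funext ⟨⟨p, q⟩, h⟩
    rw [dtotD_apply]
    rcases q with _ | q
    · obtain rfl : p = n + 1 := h
      simp only [dtotH, dtotC]
      rw [zero_add, dtotSingle_same]
      exact hβ'
    · refine Eq.trans ?_ (h0 p (q + 1) h q.succ_pos).symm
      have e1 : dtotH dh (dtotSingle n 0 rfl β) p (q + 1) h = 0 := by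
        simp only [dtotH]
        rcases q with _ | q
        · obtain rfl : p = n := by omega
          rw [dtotSingle_same, hβ]
        · rw [dtotSingle_ne _ _ _ _ _ _ _ (by omega), map_zero]
      have e2 : dtotC dc (dtotSingle n 0 rfl β) p (q + 1) h = 0 := by
        rcases p with _ | p
        · rfl
        · simp only [dtotC]
          rw [dtotSingle_ne _ _ _ _ _ _ _ (by omega), map_zero]
      rw [e1, e2, add_zero]
  | succ j ih =>
    intro hj α hα h0
    obtain ⟨p, hp⟩ : ∃ p, p + (j + 1) = n + 1 := ⟨n - j, by omega⟩
    -- In bidegree `(p, j + 2)` the vertical contribution comes from a component with `q = j + 2`,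
    -- which is zero; so the top component is a horizontal cycle.
    have h1 : dh p (j + 1) (α ⟨(p, j + 1), hp⟩) = 0 := by
      have h' : p + (j + 2) = n + 1 + 1 := by omega
      have := congrFun hα ⟨(p, j + 2), h'⟩
      rw [dtotD_apply] at this
      have e2 : dtotC dc α p (j + 2) h' = 0 := by
        rcases p with _ | p
        · rfl
        · simp only [dtotC]
          rw [h0 _ _ _ (by omega), map_zero]
      rw [e2, add_zero] at this
      exact this
    obtain ⟨β, hβ⟩ := hrow p j _ h1
    have hp' : p + j = n := by omega
    -- Subtracting this coboundary kills the component with `q = j + 1`. The only other component it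
    -- affects has `q = j`, within the bound of the induction hypothesis.
    obtain ⟨γ, hγ⟩ := ih (by omega) (α - dtotD dh dc n (dtotSingle p j hp' β))
      (by rw [map_sub, hα, hdd, sub_zero]) (fun p' q h hq => by
        rw [Pi.sub_apply, dtotD_apply]
        have e2 : dtotC dc (dtotSingle p j hp' β) p' q h = 0 := by
          rcases p' with _ | p'
          · rfl
          · simp only [dtotC]
            rw [dtotSingle_ne _ _ _ _ _ _ _ (by omega), map_zero]
        rw [e2, add_zero]
        rcases q with _ | q
        · omega
        · simp only [dtotH]
          by_cases hqj : q = j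
          · subst hqj
            obtain rfl : p' = p := by omega
            rw [dtotSingle_same, hβ, sub_self]
          · rw [dtotSingle_ne _ _ _ _ _ _ _ hqj, map_zero, h0 _ _ _ (by omega), sub_zero])
    exact ⟨γ + dtotSingle p j hp' β, by rw [map_add, hγ, sub_add_cancel]⟩

/-- Transposition of total complexes. -/
def dtotSwap {n : ℕ} (α : DTot K n) : DTot (fun p q => K q p) n :=
  fun x => α ⟨(x.1.2, x.1.1), (add_comm _ _).trans x.2⟩

/-- No sign is needed: the signs are built into the two differentials, and the total one is their
plain sum. -/
lemma dtotD_dtotSwap (n : ℕ) (α : DTot K n) :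
    dtotD (K := fun p q => K q p) (fun p q => dc q p) (fun p q => dh q p) n (dtotSwap α) =
      dtotSwap (dtotD dh dc n α) := by
  funext ⟨⟨p, q⟩, h⟩
  rcases p with _ | p <;> rcases q with _ | q <;> exact add_comm _ _

/-- The transpose of `exists_dtotD_eq`. -/
lemma exists_dtotD_eq' (hcol : ∀ p q (α : K (p + 1) q), dc (p + 1) q α = 0 → ∃ β, dc p q β = α)
    (hrow : ∀ q (α : K 0 (q + 1)), dc 0 (q + 1) α = 0 → dh 0 (q + 1) α = 0 →
      ∃ β, dc 0 q β = 0 ∧ dh 0 q β = α)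
    (hdd : ∀ n (α : DTot K n), dtotD dh dc (n + 1) (dtotD dh dc n α) = 0) (n : ℕ) (α : DTot K (n + 1))
    (hα : dtotD dh dc (n + 1) α = 0) : ∃ β, dtotD dh dc n β = α := by
  obtain ⟨β, hβ⟩ := exists_dtotD_eq (K := fun p q => K q p) (dh := fun p q => dc q p)
    (dc := fun p q => dh q p) (fun p q => hcol q p) hrow
    (fun n α => (congrArg _ (dtotD_dtotSwap (K := K) (dh := dh) (dc := dc) n (dtotSwap α))).trans
      ((dtotD_dtotSwap (K := K) (dh := dh) (dc := dc) (n + 1) _).trans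
        (congrArg dtotSwap (hdd n (dtotSwap α))))) n (dtotSwap α)
    ((dtotD_dtotSwap (n + 1) α).trans (congrArg dtotSwap hα))
  refine ⟨dtotSwap β, ?_⟩
  exact (dtotD_dtotSwap (K := fun p q => K q p) (dh := fun p q => dc q p)
    (dc := fun p q => dh q p) n β).trans (congrArg dtotSwap hβ)

end AcyclicAssembly
end CRHopf

/-! ### Vanishing in positive degrees and the computation of degree zero -/

namespace CRHopf
namespace HopfBimodule
section Vanishing
variable {k A : Type u} [Field k] [Ring A] [HopfAlgebra k A]
  (M N : HopfBimodule k A)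

lemma dC_eq_zero_iff (p q : ℕ) (α : K M N p q) : dC M N p q α = 0 ↔ α ≫ cobD N (p + 1) = 0 := by
  rw [dC_apply, smul_eq_zero_iff_right (pow_ne_zero _ (neg_ne_zero.2 one_ne_zero))]

lemma exists_dC_eq {p q : ℕ} {α : K M N (p + 1) q}
    (h : ∃ γ : barObj M (q + 1) ⟶ cobObj N (p + 1), γ ≫ cobD N (p + 1) = α) :
    ∃ β, dC M N p q β = α := by
  obtain ⟨γ, rfl⟩ := h
  refine ⟨(-1 : k) ^ q • γ, ?_⟩
  rw [dC_apply, Linear.smul_comp, smul_smul, ← mul_pow, neg_one_mul, neg_neg, one_pow, one_smul]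

/-- The sequence `M ⊗ A^{⊗ n+2} ⟶ M ⊗ A^{⊗ n+1} ⟶ M ⊗ A^{⊗ n}`. -/
noncomputable abbrev barShort (n : ℕ) : ShortComplex (HopfBimodule k A) :=
  ShortComplex.mk (barD M (n + 1)) (barD M n) (barD_barD M n)

/-- The sequence `A^{⊗ n} ⊗ N ⟶ A^{⊗ n+1} ⊗ N ⟶ A^{⊗ n+2} ⊗ N`. -/
noncomputable abbrev cobShort (n : ℕ) : ShortComplex (HopfBimodule k A) :=
  ShortComplex.mk (cobD N n) (cobD N (n + 1)) (cobD_cobD N n)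

variable [FiniteDimensional k A]

lemma barShort_exact (n : ℕ) : (barShort M n).Exact := (exact_iff _).2 (barD_exact M n)
lemma cobShort_exact (n : ℕ) : (cobShort N n).Exact := (exact_iff _).2 (cobD_exact N n)

instance : Epi (barD M 0) := (epi_iff _).2 (barD_zero_surjective M)
instance : Mono (cobD N 0) := (mono_iff _).2 (cobD_zero_injective N)

section
variable {M N}

/-- Projectivity is used twice: to split the action `M ⊗ A ⟶ M`, which contracts the rows, and to
make the remaining complex of the `Hom(M, A^{⊗ p+1} ⊗ N)` exact in positive degrees. -/
lemma exists_totD_eq_of_projective [h : Projective M] (n : ℕ) (α : Tot M N (n + 1))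
    (hα : totD M N (n + 1) α = 0) : ∃ β, totD M N n β = α := by
  have : Projective (barObj M 0) := h
  let s : barObj M 0 ⟶ barObj M 1 := Projective.factorThru (𝟙 _) (barD M 0)
  have hs : s ≫ barD M 0 = 𝟙 _ := Projective.factorThru_comp _ _
  -- A map killed by the bar differential factors through the next one; for `q = 0` this says that
  -- it factors through the action onto `M`.
  have key : ∀ (q : ℕ) {W : HopfBimodule k A} (α : barObj M (q + 1) ⟶ W),
      barD M (q + 1) ≫ α = 0 → barD M q ≫ barHtpy M s q ≫ α = α := by
    intro q W α hα
    have := congrArg (· ≫ α) (barHtpy_barD hs q)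
    simp only [Category.assoc, hα, Limits.comp_zero, Preadditive.sub_comp, Category.id_comp] at this
    exact (sub_eq_zero.1 this.symm).symm
  refine exists_dtotD_eq (K := K M N) (dh := dH M N) (dc := dC M N)
    (fun p q α hα => ⟨barHtpy M s (q + 1) ≫ α, key (q + 1) α hα⟩)
    (fun p α hα hα' => ?_) (totD_totD M N) n α hα
  rw [dC_eq_zero_iff] at hα'
  -- The horizontal kernel in column 0 is identified with maps out of `M`: here `α` comes from `γ`,
  -- and lifting `γ` through the exact cobar complex gives the required preimage.
  let γ : barObj M 0 ⟶ cobObj N (p + 2) := s ≫ α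
  have hγ : barD M 0 ≫ γ = α := key 0 α hα
  have hγ' : γ ≫ cobD N (p + 2) = 0 := by
    rw [← cancel_epi (barD M 0), ← Category.assoc, hγ, Limits.comp_zero]
    exact hα'
  let β : barObj M 0 ⟶ cobObj N (p + 1) := (cobShort_exact N (p + 1)).liftFromProjective γ hγ'
  have hβ : β ≫ cobD N (p + 1) = γ := (cobShort_exact N (p + 1)).liftFromProjective_comp γ hγ'
  refine ⟨barD M 0 ≫ β, ?_, ?_⟩
  · rw [dH_apply, ← Category.assoc, barD_barD, Limits.zero_comp]
  · rw [dC_apply, pow_zero, one_smul, Category.assoc, hβ, hγ]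

/-- The dual argument, with the directions exchanged. A retraction of `δ_L` contracts the cobar
direction, and exactness of the bar complex together with injectivity of `N` handles the remaining
complex of maps into `N`. -/
lemma exists_totD_eq_of_injective [h : Injective N] (n : ℕ) (α : Tot M N (n + 1))
    (hα : totD M N (n + 1) α = 0) : ∃ β, totD M N n β = α := by
  have : Injective (cobObj N 0) := h
  let r : cobObj N 1 ⟶ cobObj N 0 := Injective.factorThru (𝟙 _) (cobD N 0)
  have hr : cobD N 0 ≫ r = 𝟙 _ := Injective.comp_factorThru _ _
  have key : ∀ (p : ℕ) {V : HopfBimodule k A} (α : V ⟶ cobObj N (p + 1)),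
      α ≫ cobD N (p + 1) = 0 →
        -- The sign compensates the one in `cobD_cobHtpy`.
        ((-1 : ℤ) ^ p • (α ≫ cobHtpy N r p)) ≫ cobD N p = α := by
    intro p V α hα
    have := congrArg (α ≫ ·) (cobD_cobHtpy hr p)
    simp only [← Category.assoc, hα, Limits.zero_comp, Preadditive.comp_add,
      Preadditive.comp_zsmul, Category.comp_id] at this
    rw [Preadditive.zsmul_comp, eq_neg_of_add_eq_zero_left this.symm, pow_succ, mul_neg_one,
      neg_smul, neg_neg, smul_smul, ← mul_pow, neg_one_mul, neg_neg, one_pow, one_smul]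
  refine exists_dtotD_eq' (K := K M N) (dh := dH M N) (dc := dC M N)
    (fun p q α hα => exists_dC_eq M N
    ⟨_, key (p + 1) α ((dC_eq_zero_iff M N _ _ α).1 hα)⟩)
    (fun q α hα hα' => ?_) (totD_totD M N) n α hα
  rw [dC_eq_zero_iff] at hα
  obtain ⟨γ, hγ⟩ : ∃ γ : barObj M (q + 2) ⟶ cobObj N 0, γ ≫ cobD N 0 = α := ⟨_, key 0 α hα⟩
  have hγ' : barD M (q + 2) ≫ γ = 0 := by
    rw [← cancel_mono (cobD N 0), Category.assoc, hγ, Limits.zero_comp]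
    exact hα'
  let β : barObj M (q + 1) ⟶ cobObj N 0 := (barShort_exact M (q + 1)).descToInjective γ hγ'
  have hβ : barD M (q + 1) ≫ β = γ := (barShort_exact M (q + 1)).comp_descToInjective γ hγ'
  refine ⟨β ≫ cobD N 0, ?_, ?_⟩
  · rw [dC_eq_zero_iff, Category.assoc, cobD_cobD, Limits.comp_zero]
  · rw [dH_apply, ← Category.assoc, hβ, hγ]

/-- The two components of the cocycle condition say that `α₀` descends to the cokernel `M` of the
bar differential and lands in the kernel `N` of the cobar differential. No projectivity or
injectivity is involved, since the maps in question are an epimorphism and a monomorphism. -/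
lemma exists_augTot_eq (α : Tot M N 0) (hα : totD M N 0 α = 0) : ∃ β, augTot M N β = α := by
  let α₀ : barObj M 1 ⟶ cobObj N 1 := α ⟨(0, 0), rfl⟩
  have h1 : barD M 1 ≫ α₀ = 0 := (add_zero _).symm.trans (congrFun hα ⟨(0, 1), rfl⟩)
  have h2 : α₀ ≫ cobD N 1 = 0 :=
    (dC_eq_zero_iff M N 0 0 α₀).1 ((zero_add _).symm.trans (congrFun hα ⟨(1, 0), rfl⟩))
  obtain ⟨γ, hγ⟩ := (barShort_exact M 0).desc' α₀ h1
  have h3 : γ ≫ cobD N 1 = 0 := by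
    rw [← cancel_epi (barD M 0), Limits.comp_zero, ← h2, ← hγ, Category.assoc]
  obtain ⟨β, hβ⟩ := (cobShort_exact N 0).lift' γ h3
  refine ⟨β, ?_⟩
  funext ⟨⟨p, q⟩, h⟩
  obtain rfl : p = 0 := by dsimp only at h; omega
  obtain rfl : q = 0 := by dsimp only at h; omega
  change barD M 0 ≫ (β ≫ cobD N 0) = α₀
  exact (congrArg _ hβ).trans hγ

lemma augTot_injective : Function.Injective (augTot M N) := by
  intro β β' h
  have h1 : barD M 0 ≫ ((β : barObj M 0 ⟶ cobObj N 0) ≫ cobD N 0) =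
    barD M 0 ≫ ((β' : barObj M 0 ⟶ cobObj N 0) ≫ cobD N 0) := congrFun h ⟨(0, 0), rfl⟩
  exact (cancel_mono (cobD N 0)).1 ((cancel_epi (barD M 0)).1 h1)

end

lemma homologyFunctor_subsingleton {C : CochainComplex (ModuleCat.{u} k) ℕ} {n : ℕ}
    (h : ∀ α : C.X (n + 1), C.d (n + 1) (n + 2) α = 0 → ∃ β, C.d n (n + 1) β = α) :
    Subsingleton (C.homology (n + 1)) := by
  have e : C.ExactAt (n + 1) := by
    rw [C.exactAt_iff' n (n + 1) (n + 2) (by simp) (by simp)]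
    exact (ShortComplex.moduleCat_exact_iff _).2 h
  exact ModuleCat.subsingleton_of_isZero ((C.exactAt_iff_isZero_homology _).1 e)

lemma hopfCohomology_subsingleton_of_projective [Projective M] (n : ℕ) :
    Subsingleton (hopfCohomology M N (n + 1)) := by
  refine homologyFunctor_subsingleton fun α hα => ?_
  rw [totComplex_d] at hα ⊢
  exact exists_totD_eq_of_projective n α hα

lemma hopfCohomology_subsingleton_of_injective [Injective N] (n : ℕ) :
    Subsingleton (hopfCohomology M N (n + 1)) := by
  refine homologyFunctor_subsingleton fun α hα => ?_
  rw [totComplex_d] at hα ⊢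
  exact exists_totD_eq_of_injective n α hα

/-- Nothing maps into degree 0, so the cohomology there is the space of cocycles, which the
augmentation identifies with the morphisms. -/
lemma homToH_bijective : Function.Bijective (homToH M N) := by
  have : IsIso ((totComplex k A M N).homologyπ 0) :=
    (totComplex k A M N).isIso_homologyπ _ 0 rfl (by simp)
  have hπ : Function.Bijective ((totComplex k A M N).homologyπ 0) :=
    (ConcreteCategory.isIso_iff_bijective _).1 this
  have hi : Function.Injective ((totComplex k A M N).iCycles 0) :=
    (ModuleCat.mono_iff_injective _).1 inferInstance
  have haug : (totComplex k A M N).liftCycles (ModuleCat.ofHom (augTot M N)) 1 (by simp) (by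
      rw [totComplex_d k A M N 0]
      exact ModuleCat.hom_ext (LinearMap.ext (totD_augTot M N))) ≫
        (totComplex k A M N).iCycles 0 = ModuleCat.ofHom (augTot M N) :=
    (totComplex k A M N).liftCycles_i _ _ _ _
  have haug' := fun β => ConcreteCategory.congr_hom haug β
  refine hπ.comp (f := (totComplex k A M N).liftCycles (ModuleCat.ofHom (augTot M N)) 1 _ _)
    ⟨fun β β' h => ?_, fun z => ?_⟩
  · refine augTot_injective ?_
    refine (haug' β).symm.trans (Eq.trans ?_ (haug' β'))
    exact congrArg ((totComplex k A M N).iCycles 0) h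
  · have hz := ConcreteCategory.congr_hom ((totComplex k A M N).iCycles_d 0 1) z
    rw [totComplex_d] at hz
    obtain ⟨β, hβ⟩ := exists_augTot_eq _ hz
    exact ⟨β, hi ((haug' β).trans hβ)⟩

end Vanishing
end HopfBimodule
end CRHopf

/-! ### Hopf modules, coinvariants and averaging -/

namespace CRHopf
namespace HopfBimodule
section Reynolds
variable {k A : Type u} [Field k] [Ring A] [HopfAlgebra k A]
local notation "S'" => antipodeInv k A
local notation "δ" => Coalgebra.comul (R := k) (A := A)
local notation "ε" => Coalgebra.counit (R := k) (A := A)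

/-- Linear maps commuting with the left actions and the right coactions. -/
structure IsRelHopf {V W : HopfBimodule k A} (f : V.carrier →ₗ[k] W.carrier) : Prop where
  lact : ∀ a v, f (V.lact a v) = W.lact a (f v)
  rcoact : ∀ v, LinearMap.rTensor A f (V.rcoact v) = W.rcoact (f v)

lemma isRelHopf_lin {V W : HopfBimodule k A} (f : V ⟶ W) : IsRelHopf (lin f) :=
  ⟨lin_lact f, lin_rcoact f⟩

lemma IsRelHopf.comp {V W U : HopfBimodule k A} {g : W.carrier →ₗ[k] U.carrier}
    {f : V.carrier →ₗ[k] W.carrier} (hg : IsRelHopf g) (hf : IsRelHopf f) :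
    IsRelHopf (V := V) (W := U) (g ∘ₗ f) where
  lact a v := by rw [LinearMap.comp_apply, hf.lact, hg.lact]; rfl
  rcoact v := by
    rw [LinearMap.rTensor_comp_apply, hf.rcoact, hg.rcoact]; rfl

/-- `v ⊗ a ↦ a g(v)`. -/
noncomputable def actOn {V : Type u} [AddCommGroup V] [Module k V] {W : HopfBimodule k A}
    (g : V →ₗ[k] W.carrier) : V ⊗[k] A →ₗ[k] W.carrier :=
  TensorProduct.lift (W.lact.flip ∘ₗ g)

lemma actOn_tmul {V : Type u} [AddCommGroup V] [Module k V] {W : HopfBimodule k A}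
    (g : V →ₗ[k] W.carrier) (v : V) (a : A) : actOn g (v ⊗ₜ a) = W.lact a (g v) := rfl

lemma actOn_rTensor {V U : Type u} [AddCommGroup V] [Module k V] [AddCommGroup U] [Module k U]
    {W : HopfBimodule k A} (g : V →ₗ[k] W.carrier) (f : U →ₗ[k] V) (t : U ⊗[k] A) :
    actOn g (LinearMap.rTensor A f t) = actOn (g ∘ₗ f) t :=
  ten_ext (f := actOn g ∘ₗ LinearMap.rTensor A f) (g := actOn (g ∘ₗ f)) (fun _ _ => rfl) t

lemma map_actOn {V : Type u} [AddCommGroup V] [Module k V] {W U : HopfBimodule k A}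
    {h : W.carrier →ₗ[k] U.carrier} (hh : ∀ a v, h (W.lact a v) = U.lact a (h v))
    (g : V →ₗ[k] W.carrier) (t : V ⊗[k] A) : h (actOn g t) = actOn (h ∘ₗ g) t :=
  ten_ext (f := h ∘ₗ actOn g) (g := actOn (h ∘ₗ g)) (fun _ _ => hh _ _) t

/-- `v ↦ ∑ v₍₁₎ g(v₍₀₎)`. -/
noncomputable def recon {V W : HopfBimodule k A} (g : V.carrier →ₗ[k] W.carrier) :
    V.carrier →ₗ[k] W.carrier := actOn g ∘ₗ V.rcoact

lemma lact_algebraMap (V : HopfBimodule k A) (r : k) (v : V.carrier) :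
    V.lact (algebraMap k A r) v = r • v := by
  rw [Algebra.algebraMap_eq_smul_one, map_smul, LinearMap.smul_apply, V.lact_one]

/-- The hypotheses say that `g` kills the augmentation ideal and takes coinvariant values. Then `∑
a₍₂₎ v₍₁₎ g(a₍₁₎ v₍₀₎) = a ∑ v₍₁₎ g(v₍₀₎)`, and the coaction of `∑ v₍₁₎ g(v₍₀₎)` is `∑ v₍₁₎ g(v₍₀₎)
⊗ v₍₂₎`. -/
lemma isRelHopf_recon {V W : HopfBimodule k A} {g : V.carrier →ₗ[k] W.carrier}
    (hl : ∀ a v, g (V.lact a v) = ε a • g v) (hr : ∀ v, W.rcoact (g v) = g v ⊗ₜ 1) :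
    IsRelHopf (recon g) where
  lact a v := by
    have e : ∀ (s : A ⊗[k] A) (t : V.carrier ⊗[k] A),
        actOn g (TensorProduct.map₂ V.lact (LinearMap.mul k A) s t) =
          W.lact (TensorProduct.lid k A (LinearMap.rTensor A ε s)) (actOn g t) := by
      intro s t
      induction s with
      | zero => simp
      | add x y hx hy => simp only [map_add, LinearMap.add_apply, hx, hy]
      | tmul x y =>
        induction t with
        | zero => simp
        | add x y hx hy => simp only [map_add, hx, hy]
        | tmul v b => simp [actOn_tmul, hl, W.lact_mul]
    rw [recon, LinearMap.comp_apply, V.rcoact_lact, e]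
    simp
  rcoact v := by
    have e1 : ∀ (v : V.carrier) (s : A ⊗[k] A), LinearMap.rTensor A (actOn g)
        ((TensorProduct.assoc k _ A A).symm (v ⊗ₜ s)) =
          TensorProduct.map₂ W.lact (LinearMap.mul k A) s (g v ⊗ₜ 1) := by
      intro v s
      induction s with
      | zero => simp
      | add x y hx hy => simp only [map_add, LinearMap.add_apply, TensorProduct.tmul_add, hx, hy]
      | tmul x y => simp [actOn_tmul]
    have e2 : ∀ t : V.carrier ⊗[k] A, LinearMap.rTensor A (actOn g)
        ((TensorProduct.assoc k _ A A).symm (LinearMap.lTensor _ δ t)) =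
          W.rcoact (actOn g t) := by
      intro t
      induction t with
      | zero => simp
      | add x y hx hy => simp only [map_add, hx, hy]
      | tmul v b => rw [LinearMap.lTensor_tmul, e1, actOn_tmul, W.rcoact_lact, hr]
    rw [recon, LinearMap.rTensor_comp_apply, LinearMap.comp_apply, ← e2, ← V.coassoc_rcoact,
      LinearEquiv.symm_apply_apply]

variable [FiniteDimensional k A]

/-- The projection `v ↦ ∑ S⁻¹(v₍₁₎) v₍₀₎` onto the right coinvariants. -/
noncomputable def coinv (V : HopfBimodule k A) : V.carrier →ₗ[k] V.carrier :=
  actOn LinearMap.id ∘ₗ LinearMap.lTensor V.carrier S' ∘ₗ V.rcoact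

/-- The inverse antipode reverses the coproduct, so the coaction of `∑ S⁻¹(v₍₁₎) v₍₀₎` is `∑
S⁻¹(v₍₃₎) v₍₀₎ ⊗ S⁻¹(v₍₂₎) v₍₁₎`, and the second factor collapses to the counit. A left action
paired with a right coaction is what calls for `S⁻¹` rather than `S`. -/
lemma rcoact_coinv (V : HopfBimodule k A) (v : V.carrier) :
    V.rcoact (coinv V v) = coinv V v ⊗ₜ 1 := by
  let f : A ⊗[k] A →ₗ[k] A := LinearMap.mul' k A ∘ₗ (TensorProduct.comm k A A).toLinearMap ∘ₗ
    LinearMap.lTensor A S'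
  let G : V.carrier → A ⊗[k] A →ₗ[k] V.carrier ⊗[k] A := fun w =>
    (TensorProduct.comm k A V.carrier).toLinearMap ∘ₗ LinearMap.lTensor A (V.lact.flip w ∘ₗ S')
  let Φ : (V.carrier ⊗[k] A) ⊗[k] A →ₗ[k] V.carrier ⊗[k] A :=
    TensorProduct.lift (TensorProduct.map₂ V.lact (LinearMap.mul k A) ∘ₗ δ ∘ₗ S').flip
  have e1 : ∀ w x (t : A ⊗[k] A), TensorProduct.map₂ V.lact (LinearMap.mul k A)
      (TensorProduct.map S' S' (TensorProduct.comm k A A t)) (w ⊗ₜ x) =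
        G w (LinearMap.rTensor A f ((TensorProduct.assoc k A A A).symm (x ⊗ₜ t))) := by
    intro w x t
    induction t with
    | zero => simp
    | add x y hx hy => simp only [map_add, LinearMap.add_apply, TensorProduct.tmul_add, hx, hy]
    | tmul y z => simp [G, f]
  have e2 : ∀ w (s : A ⊗[k] A), Φ ((TensorProduct.assoc k _ A A).symm (w ⊗ₜ s)) =
      G w (LinearMap.rTensor A f ((TensorProduct.assoc k A A A).symm
        (LinearMap.lTensor A δ s))) := by
    intro w s
    induction s with
    | zero => simp
    | add x y hx hy => simp only [map_add, TensorProduct.tmul_add, hx, hy]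
    | tmul x y =>
      rw [LinearMap.lTensor_tmul, ← e1, ← comul_antipodeInv]
      rfl
  have e3 : ∀ t : V.carrier ⊗[k] A, Φ ((TensorProduct.assoc k _ A A).symm
      (LinearMap.lTensor _ δ t)) =
        actOn (W := V) LinearMap.id (LinearMap.lTensor V.carrier S' t) ⊗ₜ 1 := by
    intro t
    induction t with
    | zero => simp
    | add x y hx hy => simp only [map_add, TensorProduct.add_tmul, hx, hy]
    | tmul w b =>
      rw [LinearMap.lTensor_tmul, e2]
      have := cancel_left (f := f) mul_antipodeInv_lTensor b
      rw [comul₃, LinearMap.comp_apply] at this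
      rw [this]
      rfl
  have e4 : ∀ t : V.carrier ⊗[k] A, V.rcoact (actOn (W := V) LinearMap.id
      (LinearMap.lTensor V.carrier S' t)) = Φ (LinearMap.rTensor A V.rcoact t) := by
    intro t
    induction t with
    | zero => simp
    | add x y hx hy => simp only [map_add, hx, hy]
    | tmul w b =>
      rw [LinearMap.lTensor_tmul, actOn_tmul, LinearMap.id_apply, V.rcoact_lact]
      rfl
  rw [coinv, LinearMap.comp_apply, LinearMap.comp_apply, e4, ← e3, ← V.coassoc_rcoact,
    LinearEquiv.symm_apply_apply]

/-- `S⁻¹(a₍₂₎ v₍₁₎) a₍₁₎ = S⁻¹(v₍₁₎) S⁻¹(a₍₂₎) a₍₁₎`, and the sum of the last two factors is the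
counit of `a`. -/
lemma coinv_lact (V : HopfBimodule k A) (a : A) (v : V.carrier) :
    coinv V (V.lact a v) = ε a • coinv V v := by
  let f : A ⊗[k] A →ₗ[k] A := LinearMap.mul' k A ∘ₗ (TensorProduct.comm k A A).toLinearMap ∘ₗ
    LinearMap.lTensor A S'
  have e : ∀ (s : A ⊗[k] A) (t : V.carrier ⊗[k] A), actOn (W := V) LinearMap.id
      (LinearMap.lTensor V.carrier S' (TensorProduct.map₂ V.lact (LinearMap.mul k A) s t)) =
        actOn (V.lact (f s)) (LinearMap.lTensor V.carrier S' t) := by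
    intro s t
    induction t with
    | zero => simp
    | add x y hx hy => simp only [map_add, hx, hy]
    | tmul v b =>
      rw [LinearMap.lTensor_tmul, actOn_tmul]
      induction s with
      | zero => simp
      | add x y hx hy => simp only [map_add, LinearMap.add_apply, hx, hy]
      | tmul x y => simp [f, actOn_tmul, antipodeInv_mul, V.lact_mul]
  have h : V.lact (f (δ a)) = ε a • LinearMap.id := by
    rw [mul_antipodeInv_lTensor a]
    exact LinearMap.ext fun v => lact_algebraMap V _ v
  rw [coinv, LinearMap.comp_apply, LinearMap.comp_apply, V.rcoact_lact, e, h]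
  exact ten_ext (f := actOn (W := V) (ε a • LinearMap.id)) (g := ε a • actOn LinearMap.id)
    (fun v b => by simp [actOn_tmul]) (LinearMap.lTensor V.carrier S' (V.rcoact v))

/-- The reconstruction half of the fundamental theorem of Hopf modules: `∑ v₍₂₎ S⁻¹(v₍₁₎) v₍₀₎ = v`.
-/
lemma recon_coinv (V : HopfBimodule k A) (v : V.carrier) : recon (coinv V) v = v := by
  let f : A ⊗[k] A →ₗ[k] A := LinearMap.mul' k A ∘ₗ (TensorProduct.comm k A A).toLinearMap ∘ₗ
    LinearMap.rTensor A S'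
  let Φ : (V.carrier ⊗[k] A) ⊗[k] A →ₗ[k] V.carrier :=
    actOn (actOn LinearMap.id ∘ₗ LinearMap.lTensor V.carrier S')
  have e1 : ∀ w (s : A ⊗[k] A), Φ ((TensorProduct.assoc k _ A A).symm (w ⊗ₜ s)) =
      V.lact (f s) w := by
    intro w s
    induction s with
    | zero => simp
    | add x y hx hy => simp only [map_add, LinearMap.add_apply, TensorProduct.tmul_add, hx, hy]
    | tmul x y => simp [Φ, f, actOn_tmul, V.lact_mul]
  have e2 : ∀ t : V.carrier ⊗[k] A, Φ ((TensorProduct.assoc k _ A A).symm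
      (LinearMap.lTensor _ δ t)) = TensorProduct.rid k _ (LinearMap.lTensor _ ε t) := by
    intro t
    induction t with
    | zero => simp
    | add x y hx hy => simp only [map_add, hx, hy]
    | tmul w b =>
      rw [LinearMap.lTensor_tmul, e1, mul_antipodeInv_rTensor b, lact_algebraMap]
      simp
  have e3 : recon (coinv V) v = Φ (LinearMap.rTensor A V.rcoact (V.rcoact v)) :=
    (actOn_rTensor (actOn (W := V) LinearMap.id ∘ₗ LinearMap.lTensor V.carrier S') V.rcoact
      (V.rcoact v)).symm
  rw [e3, ← LinearEquiv.symm_apply_apply (TensorProduct.assoc k V.carrier A A)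
    (LinearMap.rTensor A V.rcoact (V.rcoact v)), V.coassoc_rcoact, e2, V.counit_rcoact]

lemma IsRelHopf.map_coinv {V W : HopfBimodule k A} {f : V.carrier →ₗ[k] W.carrier}
    (hf : IsRelHopf f) (v : V.carrier) : f (coinv V v) = coinv W (f v) := by
  rw [coinv, coinv, LinearMap.comp_apply, LinearMap.comp_apply, LinearMap.comp_apply,
    LinearMap.comp_apply, ← hf.rcoact, map_actOn hf.lact]
  exact ten_ext (f := actOn (f ∘ₗ LinearMap.id) ∘ₗ LinearMap.lTensor V.carrier S')
    (g := actOn (W := W) LinearMap.id ∘ₗ LinearMap.lTensor W.carrier S' ∘ₗ LinearMap.rTensor A f)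
    (fun _ _ => rfl) (V.rcoact v)

lemma coinv_coinv (V : HopfBimodule k A) (v : V.carrier) :
    coinv V (coinv V v) = coinv V v := by
  change actOn LinearMap.id (LinearMap.lTensor V.carrier S' (V.rcoact (coinv V v))) = _
  rw [rcoact_coinv, LinearMap.lTensor_tmul, actOn_tmul, antipodeInv_one, V.lact_one]
  rfl

/-- The average of a linear map: a map commuting with the left actions and the right coactions. -/
noncomputable def reynolds {V W : HopfBimodule k A} (t : V.carrier →ₗ[k] W.carrier) :
    V.carrier →ₗ[k] W.carrier := recon (coinv W ∘ₗ t ∘ₗ coinv V)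

/-- The inner `coinv` makes the map invariant under the left action and the outer one makes its
values coinvariant, as `isRelHopf_recon` demands. -/
lemma isRelHopf_reynolds {V W : HopfBimodule k A} (t : V.carrier →ₗ[k] W.carrier) :
    IsRelHopf (reynolds t) :=
  isRelHopf_recon (fun a v => by simp [coinv_lact]) (fun v => rcoact_coinv W _)

/-- A compatible map commutes with the projections onto coinvariants. On coinvariants the average of
`r` therefore still undoes `f`, and coinvariants determine the rest by `recon_coinv`. -/
lemma reynolds_retraction {V W : HopfBimodule k A} {f : V.carrier →ₗ[k] W.carrier}
    (hf : IsRelHopf f) {r : W.carrier →ₗ[k] V.carrier} (hr : r ∘ₗ f = LinearMap.id) :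
    reynolds r ∘ₗ f = LinearMap.id := by
  refine LinearMap.ext fun v => ?_
  have h : (coinv V ∘ₗ r ∘ₗ coinv W) ∘ₗ f = coinv V := by
    refine LinearMap.ext fun v => ?_
    have hr' := LinearMap.congr_fun hr (coinv V v)
    simp only [LinearMap.comp_apply, LinearMap.id_apply] at hr' ⊢
    rw [← hf.map_coinv, hr', coinv_coinv]
  rw [LinearMap.comp_apply, reynolds, recon, LinearMap.comp_apply, ← hf.rcoact, actOn_rTensor, h]
  exact recon_coinv V v

lemma reynolds_section {V W : HopfBimodule k A} {f : V.carrier →ₗ[k] W.carrier}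
    (hf : IsRelHopf f) {s : W.carrier →ₗ[k] V.carrier} (hs : f ∘ₗ s = LinearMap.id) :
    f ∘ₗ reynolds s = LinearMap.id := by
  refine LinearMap.ext fun v => ?_
  have h : f ∘ₗ (coinv V ∘ₗ s ∘ₗ coinv W) = coinv W := by
    refine LinearMap.ext fun v => ?_
    have hs' := LinearMap.congr_fun hs (coinv W v)
    simp only [LinearMap.comp_apply, LinearMap.id_apply] at hs' ⊢
    rw [hf.map_coinv, hs', coinv_coinv]
  rw [LinearMap.comp_apply, reynolds, recon, LinearMap.comp_apply, map_actOn hf.lact, h]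
  exact recon_coinv W v

end Reynolds
end HopfBimodule
end CRHopf

/-! ### Morphisms from a free module to a cofree comodule -/

namespace CRHopf
namespace HopfBimodule
section Extend
variable {k A : Type u} [Field k] [Ring A] [HopfAlgebra k A]
local notation "δ" => Coalgebra.comul (R := k) (A := A)
local notation "ε" => Coalgebra.counit (R := k) (A := A)

/-- The map `v ⊗ a ↦ Ψ(v) a` is a map of Hopf bimodules if `Ψ` commutes with the left actions and
the coactions. -/
def extendHom {V Y : HopfBimodule k A} (Ψ : V.carrier →ₗ[k] Y.carrier)
    (h : ∀ a v, Ψ (V.lact a v) = Y.lact a (Ψ v))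
    (hl : ∀ v, LinearMap.lTensor A Ψ (V.lcoact v) = Y.lcoact (Ψ v))
    (hr : ∀ v, LinearMap.rTensor A Ψ (V.rcoact v) = Y.rcoact (Ψ v)) : V.tenObj ⟶ Y :=
  mkHom (M := V.tenObj) (N := Y) (TensorProduct.lift (Y.ract.flip ∘ₗ Ψ))
    (fun a => ten_ext (f := TensorProduct.lift (Y.ract.flip ∘ₗ Ψ) ∘ₗ LinearMap.rTensor A (V.lact a))
      (g := Y.lact a ∘ₗ TensorProduct.lift (Y.ract.flip ∘ₗ Ψ)) fun m x => by simp [Y.ract_lact, h])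
    (fun a => ten_ext (f := TensorProduct.lift (Y.ract.flip ∘ₗ Ψ) ∘ₗ
      LinearMap.lTensor _ (LinearMap.mulRight k a))
      (g := Y.ract a ∘ₗ TensorProduct.lift (Y.ract.flip ∘ₗ Ψ)) fun m x => by simp [Y.ract_mul])
    (ten_ext (f := LinearMap.lTensor A (TensorProduct.lift (Y.ract.flip ∘ₗ Ψ)) ∘ₗ V.tenLcoact)
      (g := Y.lcoact ∘ₗ TensorProduct.lift (Y.ract.flip ∘ₗ Ψ)) fun m x => by
      refine (map_map₂ (φ₁ := LinearMap.id) (φ₂ := LinearMap.id) (ψ₁ := Ψ)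
        (ψ₂ := LinearMap.id) (f' := LinearMap.mul k A) (g' := Y.ract.flip)
        (fun _ _ => rfl) (fun _ _ => by simp) (V.lcoact m) (δ x)).trans ?_
      rw [LinearMap.comp_apply, TensorProduct.lift.tmul, LinearMap.comp_apply, LinearMap.flip_apply,
        Y.lcoact_ract, map₂_flip, TensorProduct.map_id, ← hl]
      rfl)
    (ten_ext (f := LinearMap.rTensor A (TensorProduct.lift (Y.ract.flip ∘ₗ Ψ)) ∘ₗ V.tenRcoact)
      (g := Y.rcoact ∘ₗ TensorProduct.lift (Y.ract.flip ∘ₗ Ψ)) fun m x => by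
      refine (map_map₂ (φ₁ := Ψ) (φ₂ := LinearMap.id) (ψ₁ := LinearMap.id)
        (ψ₂ := LinearMap.id) (f' := Y.ract.flip) (g' := LinearMap.mul k A)
        (fun _ _ => by simp) (fun _ _ => rfl) (V.rcoact m) (δ x)).trans ?_
      rw [LinearMap.comp_apply, TensorProduct.lift.tmul, LinearMap.comp_apply, LinearMap.flip_apply,
        Y.rcoact_ract, map₂_flip, TensorProduct.map_id, ← hr]
      rfl)

variable {V W : HopfBimodule k A}

section
variable {γ : V.carrier →ₗ[k] W.carrier}

lemma IsRelHopf.lTensor_lcoact_lact (hγ : IsRelHopf γ) (a : A) (v : V.carrier) :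
    LinearMap.lTensor A γ (V.lcoact (V.lact a v)) =
      W.cotLact a (LinearMap.lTensor A γ (V.lcoact v)) := by
  rw [V.lcoact_lact]
  exact (lTensor_map₂ (ψ₁ := LinearMap.id) V.lact hγ.lact (δ a) (V.lcoact v)).trans
    (congrArg (fun z => TensorProduct.map₂ _ _ z _) (LinearMap.congr_fun (LinearMap.lTensor_id _ _) _))

/-- Only coassociativity is used: composing the coaction with any linear map on its second factor
gives a map of left comodules into the cofree one. -/
lemma lTensor_lTensor_lcoact (γ : V.carrier →ₗ[k] W.carrier) (v : V.carrier) :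
    LinearMap.lTensor A (LinearMap.lTensor A γ ∘ₗ V.lcoact) (V.lcoact v) =
      W.cotLcoact (LinearMap.lTensor A γ (V.lcoact v)) := by
  rw [LinearMap.lTensor_comp_apply, ← V.coassoc_lcoact]
  exact ten_ext (f := LinearMap.lTensor A (LinearMap.lTensor A γ) ∘ₗ
    (TensorProduct.assoc k A A V.carrier).toLinearMap ∘ₗ LinearMap.rTensor _ δ)
    (g := W.cotLcoact ∘ₗ LinearMap.lTensor A γ) (fun c n =>
      ten_ext (f := LinearMap.lTensor A (LinearMap.lTensor A γ) ∘ₗ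
        (TensorProduct.assoc k A A V.carrier).toLinearMap ∘ₗ (TensorProduct.mk k _ _).flip n)
      (g := (TensorProduct.assoc k A A W.carrier).toLinearMap ∘ₗ
        (TensorProduct.mk k _ _).flip (γ n)) (fun _ _ => rfl) (δ c)) (V.lcoact v)

/-- The two coactions of `V` commute and `γ` respects the right one. -/
lemma IsRelHopf.rTensor_lTensor_lcoact (hγ : IsRelHopf γ) (v : V.carrier) :
    LinearMap.rTensor A (LinearMap.lTensor A γ ∘ₗ V.lcoact) (V.rcoact v) =
      W.cotRcoact (LinearMap.lTensor A γ (V.lcoact v)) := by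
  have e1 : ∀ t : A ⊗[k] (V.carrier ⊗[k] A),
      LinearMap.rTensor A (LinearMap.lTensor A γ) ((TensorProduct.assoc k A _ A).symm t) =
      (TensorProduct.assoc k A _ A).symm (LinearMap.lTensor A (LinearMap.rTensor A γ) t) := by
    intro t
    induction t with
    | zero => simp
    | add a b ha hb => simp only [map_add, ha, hb]
    | tmul c t =>
      induction t with
      | zero => simp
      | add a b ha hb => simp only [TensorProduct.tmul_add, map_add, ha, hb]
      | tmul x y => simp
  rw [LinearMap.rTensor_comp_apply, ← LinearEquiv.symm_apply_apply
    (TensorProduct.assoc k A _ A) (LinearMap.rTensor A V.lcoact _), V.lcoact_rcoact, e1,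
    ← LinearMap.lTensor_comp_apply,
    show LinearMap.rTensor A γ ∘ₗ V.rcoact = W.rcoact ∘ₗ γ from LinearMap.ext hγ.rcoact,
    LinearMap.lTensor_comp_apply]
  rfl

end

/-- The map of Hopf bimodules `v ⊗ a ↦ ∑ (v₍₋₁₎ ⊗ γ(v₍₀₎)) a`. -/
def extend (γ : V.carrier →ₗ[k] W.carrier) (hγ : IsRelHopf γ) : V.tenObj ⟶ W.cotObj :=
  extendHom (Y := W.cotObj) (LinearMap.lTensor A γ ∘ₗ V.lcoact)
    hγ.lTensor_lcoact_lact (lTensor_lTensor_lcoact γ) hγ.rTensor_lTensor_lcoact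

lemma extend_tmul {γ : V.carrier →ₗ[k] W.carrier} (hγ : IsRelHopf γ) (v : V.carrier) (a : A) :
    lin (extend γ hγ) (v ⊗ₜ a) = W.cotObj.ract a (LinearMap.lTensor A γ (V.lcoact v)) := rfl

/-- `v ↦ (ε ⊗ 1)(α(v ⊗ 1))`. -/
noncomputable def core (α : V.tenObj ⟶ W.cotObj) : V.carrier →ₗ[k] W.carrier :=
  (TensorProduct.lid k W.carrier).toLinearMap ∘ₗ LinearMap.rTensor W.carrier ε ∘ₗ lin α ∘ₗ
    (TensorProduct.mk k V.carrier A).flip 1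

lemma tenRcoact_tmul_one (v : V.carrier) : V.tenRcoact (v ⊗ₜ 1) =
    LinearMap.rTensor A ((TensorProduct.mk k V.carrier A).flip 1) (V.rcoact v) := by
  rw [tenRcoact_tmul, Bialgebra.comul_one, Algebra.TensorProduct.one_def]
  exact ten_ext (f := (TensorProduct.map₂ (TensorProduct.mk k V.carrier A)
    (LinearMap.mul k A)).flip (1 ⊗ₜ 1)) (g := LinearMap.rTensor A _) (fun _ _ => by simp) _

lemma tenLcoact_tmul_one (v : V.carrier) : V.tenLcoact (v ⊗ₜ 1) =
    LinearMap.lTensor A ((TensorProduct.mk k V.carrier A).flip 1) (V.lcoact v) := by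
  rw [tenLcoact_tmul, Bialgebra.comul_one, Algebra.TensorProduct.one_def]
  exact ten_ext (f := (TensorProduct.map₂ (LinearMap.mul k A)
    (TensorProduct.mk k V.carrier A)).flip (1 ⊗ₜ 1)) (g := LinearMap.lTensor A _)
    (fun _ _ => by simp) _

/-- The embedding `v ↦ v ⊗ 1` respects the left action, and also the right coaction, since `1` is
grouplike. The counit on `A ⊗ W` respects both structures, being multiplicative for the diagonal
action and invisible to a coaction that comes from `W` alone. -/
lemma isRelHopf_core (α : V.tenObj ⟶ W.cotObj) : IsRelHopf (core α) where
  lact a v := by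
    have e : ∀ (s : A ⊗[k] A) (t : A ⊗[k] W.carrier), TensorProduct.lid k W.carrier
        (LinearMap.rTensor W.carrier ε (TensorProduct.map₂ (LinearMap.mul k A) W.lact s t)) =
          W.lact (TensorProduct.lid k A (LinearMap.rTensor A ε s))
            (TensorProduct.lid k W.carrier (LinearMap.rTensor W.carrier ε t)) := by
      intro s t
      induction s with
      | zero => simp
      | add x y hx hy => simp only [map_add, LinearMap.add_apply, hx, hy]
      | tmul x y =>
        induction t with
        | zero => simp
        | add x y hx hy => simp only [map_add, hx, hy]
        | tmul v b => simp [smul_smul, mul_comm]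
    have h := lin_lact α a (v ⊗ₜ 1)
    have h' : lin α (V.lact a v ⊗ₜ 1) = _ := h
    change TensorProduct.lid k W.carrier (LinearMap.rTensor W.carrier ε
      (lin α (V.lact a v ⊗ₜ 1))) = _
    rw [h']
    refine (e (δ a) _).trans ?_
    rw [Coalgebra.rTensor_counit_comul, TensorProduct.lid_tmul, one_smul]
    rfl
  rcoact v := by
    have e : ∀ t : A ⊗[k] W.carrier, LinearMap.rTensor A
        ((TensorProduct.lid k W.carrier).toLinearMap ∘ₗ LinearMap.rTensor W.carrier ε)
          (W.cotRcoact t) = W.rcoact (TensorProduct.lid k W.carrier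
            (LinearMap.rTensor W.carrier ε t)) := ten_ext (f := LinearMap.rTensor A
        ((TensorProduct.lid k W.carrier).toLinearMap ∘ₗ LinearMap.rTensor W.carrier ε) ∘ₗ
          W.cotRcoact) (g := W.rcoact ∘ₗ (TensorProduct.lid k W.carrier).toLinearMap ∘ₗ
            (LinearMap.rTensor W.carrier ε)) fun c n => by
      rw [LinearMap.comp_apply, cotRcoact_tmul]
      simp only [LinearMap.comp_apply, LinearEquiv.coe_coe, LinearMap.rTensor_tmul,
        TensorProduct.lid_tmul, map_smul]
      exact ten_ext (f := LinearMap.rTensor A ((TensorProduct.lid k W.carrier).toLinearMap ∘ₗ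
        LinearMap.rTensor W.carrier ε) ∘ₗ (TensorProduct.assoc k A W.carrier A).symm.toLinearMap ∘ₗ
          TensorProduct.mk k _ _ c) (g := ε c • LinearMap.id)
        (fun x y => by simp [TensorProduct.smul_tmul']) (W.rcoact n)
    have h : LinearMap.rTensor A (lin α) (V.tenRcoact (v ⊗ₜ 1)) =
      W.cotRcoact (lin α (v ⊗ₜ 1)) := lin_rcoact α (v ⊗ₜ 1)
    rw [tenRcoact_tmul_one] at h
    refine Eq.trans ?_ ((congrArg _ h).trans (e (lin α (v ⊗ₜ 1))))
    let α' : V.carrier ⊗[k] A →ₗ[k] A ⊗[k] W.carrier := lin α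
    let P : A ⊗[k] W.carrier →ₗ[k] W.carrier :=
      (TensorProduct.lid k W.carrier).toLinearMap ∘ₗ LinearMap.rTensor W.carrier ε
    exact (LinearMap.rTensor_comp_apply A P (α' ∘ₗ (TensorProduct.mk k V.carrier A).flip 1) _).trans
      (congrArg _ (LinearMap.rTensor_comp_apply A α' _ _))

/-- A colinear map into a cofree comodule is recovered from its composite with the counit. Together
with `tenHom_ext` this shows that `α` is determined by `core α`. -/
lemma lin_tmul_one (α : V.tenObj ⟶ W.cotObj) (v : V.carrier) :
    lin α (v ⊗ₜ 1) = LinearMap.lTensor A (core α) (V.lcoact v) := by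
  have e : ∀ t : A ⊗[k] W.carrier, LinearMap.lTensor A
      ((TensorProduct.lid k W.carrier).toLinearMap ∘ₗ LinearMap.rTensor W.carrier ε)
        (W.cotLcoact t) = t := ten_ext (f := LinearMap.lTensor A
      ((TensorProduct.lid k W.carrier).toLinearMap ∘ₗ LinearMap.rTensor W.carrier ε) ∘ₗ
        W.cotLcoact) (g := LinearMap.id) fun c n => by
    rw [LinearMap.comp_apply, cotLcoact_tmul]
    have := ten_ext (f := LinearMap.lTensor A ((TensorProduct.lid k W.carrier).toLinearMap ∘ₗ
      LinearMap.rTensor W.carrier ε) ∘ₗ (TensorProduct.assoc k A A W.carrier).toLinearMap ∘ₗ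
        (TensorProduct.mk k _ _).flip n) (g := (TensorProduct.mk k _ _).flip n ∘ₗ
          (TensorProduct.rid k A).toLinearMap ∘ₗ LinearMap.lTensor A ε)
      (fun x y => by simp [TensorProduct.smul_tmul']) (δ c)
    refine this.trans ?_
    rw [LinearMap.comp_apply, LinearMap.comp_apply, Coalgebra.lTensor_counit_comul]
    simp
  have h : LinearMap.lTensor A (lin α) (V.tenLcoact (v ⊗ₜ 1)) =
    W.cotLcoact (lin α (v ⊗ₜ 1)) := lin_lcoact α (v ⊗ₜ 1)
  rw [tenLcoact_tmul_one] at h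
  refine Eq.trans (Eq.trans (e _).symm (congrArg _ h.symm)) ?_
  let α' : V.carrier ⊗[k] A →ₗ[k] A ⊗[k] W.carrier := lin α
  let P : A ⊗[k] W.carrier →ₗ[k] W.carrier :=
    (TensorProduct.lid k W.carrier).toLinearMap ∘ₗ LinearMap.rTensor W.carrier ε
  exact ((LinearMap.lTensor_comp_apply A P (α' ∘ₗ (TensorProduct.mk k V.carrier A).flip 1) _).trans
    (congrArg _ (LinearMap.lTensor_comp_apply A α' _ _))).symm

/-- `V ⊗ A` is generated by the elements `v ⊗ 1` under the right action. -/
lemma tenHom_ext {Y : HopfBimodule k A} {α β : V.tenObj ⟶ Y}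
    (h : ∀ v, lin α (v ⊗ₜ 1) = lin β (v ⊗ₜ 1)) : α = β := by
  have e : ∀ (γ : V.tenObj ⟶ Y) v a, lin γ (v ⊗ₜ a) = Y.ract a (lin γ (v ⊗ₜ 1)) := fun γ v a =>
    (congrArg (lin γ) (congrArg (v ⊗ₜ[k] ·) (one_mul a).symm)).trans (lin_ract γ a (v ⊗ₜ[k] 1))
  exact hom_ext (ten_ext (f := lin α) (g := lin β) fun v a =>
    (e α v a).trans ((congrArg _ (h v)).trans (e β v a).symm))

lemma extend_tmul_one {γ : V.carrier →ₗ[k] W.carrier} (hγ : IsRelHopf γ) (v : V.carrier) :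
    lin (extend γ hγ) (v ⊗ₜ 1) = LinearMap.lTensor A γ (V.lcoact v) :=
  (extend_tmul hγ v 1).trans (W.cotObj.ract_one _)

variable [FiniteDimensional k A]

/-- A linear retraction of `f` averages to one compatible with left action and right coaction.
Composing it with `core α` and extending back gives the morphism sought. The retraction itself need
not be a morphism of Hopf bimodules. -/
lemma exists_tenMap_comp_eq {V V' : HopfBimodule k A} {f : V' ⟶ V}
    (hf : Function.Injective (lin f)) (α : V'.tenObj ⟶ W.cotObj) :
    ∃ β : V.tenObj ⟶ W.cotObj, tenMap f ≫ β = α := by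
  obtain ⟨r, hr⟩ := (lin f).exists_leftInverse_of_injective (LinearMap.ker_eq_bot.2 hf)
  have h := reynolds_retraction (isRelHopf_lin f) hr
  have hc := (isRelHopf_core α).comp (isRelHopf_reynolds r)
  refine ⟨extend (core α ∘ₗ reynolds r) hc,
    tenHom_ext fun v => (extend_tmul_one hc (lin f v)).trans (.trans ?_ (lin_tmul_one α v).symm)⟩
  rw [← lin_lcoact, ← LinearMap.lTensor_comp_apply, LinearMap.comp_assoc, h, LinearMap.comp_id]

/-- The same argument with an averaged linear section of `g`, applied after `core α`. -/
lemma exists_comp_cotMap_eq {W W' : HopfBimodule k A} {g : W ⟶ W'}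
    (hg : Function.Surjective (lin g)) (α : V.tenObj ⟶ W'.cotObj) :
    ∃ β : V.tenObj ⟶ W.cotObj, β ≫ cotMap g = α := by
  obtain ⟨s, hs⟩ := (lin g).exists_rightInverse_of_surjective (LinearMap.range_eq_top.2 hg)
  have h := reynolds_section (isRelHopf_lin g) hs
  refine ⟨extend (reynolds s ∘ₗ core α) ((isRelHopf_reynolds s).comp (isRelHopf_core α)),
    tenHom_ext fun v => (congrArg (LinearMap.lTensor A (lin g)) (extend_tmul_one _ v)).trans
      (.trans ?_ (lin_tmul_one α v).symm)⟩
  rw [← LinearMap.lTensor_comp_apply, ← LinearMap.comp_assoc, h, LinearMap.id_comp]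

end Extend
end HopfBimodule
end CRHopf

/-! ### Short exact sequences of total complexes -/

namespace CRHopf
section DTot
variable {k : Type u} [Field k] {K K' K'' : ℕ → ℕ → Type u} [∀ p q, AddCommGroup (K p q)]
  [∀ p q, Module k (K p q)] [∀ p q, AddCommGroup (K' p q)] [∀ p q, Module k (K' p q)]
  [∀ p q, AddCommGroup (K'' p q)] [∀ p q, Module k (K'' p q)]
  {φ : ∀ p q, K p q →ₗ[k] K' p q} {ψ : ∀ p q, K' p q →ₗ[k] K'' p q}

lemma dtotMap_injective (h : ∀ p q, Function.Injective (φ p q)) (n : ℕ) :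
    Function.Injective (dtotMap φ n) := fun _ _ e => funext fun x => h _ _ (congrFun e x)

lemma dtotMap_surjective (h : ∀ p q, Function.Surjective (φ p q)) (n : ℕ) :
    Function.Surjective (dtotMap φ n) := fun α => by
  choose β hβ using fun x : {x : ℕ × ℕ // x.1 + x.2 = n} => h x.1.1 x.1.2 (α x)
  exact ⟨β, funext hβ⟩

lemma dtotMap_exact (h : ∀ p q, Function.Exact (φ p q) (ψ p q)) (n : ℕ) :
    Function.Exact (dtotMap φ n) (dtotMap ψ n) := fun α => by
  constructor
  · intro e
    choose β hβ using fun x : {x : ℕ × ℕ // x.1 + x.2 = n} =>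
      (h x.1.1 x.1.2 (α x)).1 (congrFun e x)
    exact ⟨β, funext hβ⟩
  · rintro ⟨β, rfl⟩
    exact funext fun x => (h x.1.1 x.1.2).apply_apply_eq_zero (β x)

end DTot

namespace HopfBimodule
section ShortExact
variable {k A : Type u} [Field k] [Ring A] [HopfAlgebra k A] {M N P : HopfBimodule k A}
  {f : M ⟶ N} {g : N ⟶ P}

/-- Tensoring over a field is exact, so the bar and cobar constructions preserve injectivity,
surjectivity and exactness degree by degree. -/
lemma barMap_injective (h : Function.Injective (lin f)) :
    ∀ n, Function.Injective (lin (barMap f n))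
  | 0 => h
  | n + 1 => Module.Flat.rTensor_preserves_injective_linearMap (M := A) (lin (barMap f n))
    (barMap_injective h n)

lemma cobMap_injective (h : Function.Injective (lin f)) :
    ∀ n, Function.Injective (lin (cobMap f n))
  | 0 => h
  | n + 1 => Module.Flat.lTensor_preserves_injective_linearMap (M := A) (lin (cobMap f n))
    (cobMap_injective h n)

lemma barMap_surjective (h : Function.Surjective (lin f)) :
    ∀ n, Function.Surjective (lin (barMap f n))
  | 0 => h
  | n + 1 => LinearMap.rTensor_surjective A (barMap_surjective h n)

lemma cobMap_surjective (h : Function.Surjective (lin f)) :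
    ∀ n, Function.Surjective (lin (cobMap f n))
  | 0 => h
  | n + 1 => LinearMap.lTensor_surjective A (cobMap_surjective h n)

lemma barMap_exact (h : Function.Exact (lin f) (lin g)) :
    ∀ n, Function.Exact (lin (barMap f n)) (lin (barMap g n))
  | 0 => h
  | n + 1 => Module.Flat.rTensor_exact A (barMap_exact h n)

lemma cobMap_exact (h : Function.Exact (lin f) (lin g)) :
    ∀ n, Function.Exact (lin (cobMap f n)) (lin (cobMap g n))
  | 0 => h
  | n + 1 => Module.Flat.lTensor_exact A (cobMap_exact h n)

lemma kMap_apply_id_right (f : M ⟶ N) (p q : ℕ) (α : K N P p q) :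
    kMap f (𝟙 P) p q α = barMap f (q + 1) ≫ α := by
  change barMap f (q + 1) ≫ α ≫ cobMap (𝟙 P) (p + 1) = _
  rw [cobMap_id, Category.comp_id]

lemma kMap_apply_id_left (g : N ⟶ P) (p q : ℕ) (α : K M N p q) :
    kMap (𝟙 M) g p q α = α ≫ cobMap g (p + 1) := by
  change barMap (𝟙 M) (q + 1) ≫ α ≫ cobMap g (p + 1) = _
  rw [barMap_id, Category.id_comp]

variable [FiniteDimensional k A]

/-- Injectivity and exactness in the middle are left exactness of Hom in the abelian category.
Surjectivity is the special feature of these Hom spaces, `exists_tenMap_comp_eq` with `V = M ⊗ A^{⊗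
q}` and `W = A^{⊗ p} ⊗ N`. -/
lemma totFunctor₁_shortExact (N : HopfBimodule k A) (S : ShortComplex (HopfBimodule k A)ᵒᵖ)
    (h : IsShortExactOp k A S) : (S.map (totFunctor₁ k A N)).ShortExact := by
  have h' : S.unop.ShortExact := (isShortExact_iff _).1 h
  have hi := (mono_iff S.unop.f).1 h'.mono_f
  have hs := (epi_iff S.unop.g).1 h'.epi_g
  have he := (exact_iff _).1 h'.exact
  refine HomologicalComplex.shortExact_of_degreewise_shortExact _ fun n =>
    ModuleCat.shortComplex_shortExact _ ?_ ?_ ?_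
  · refine dtotMap_exact (φ := kMap S.unop.g (𝟙 N)) (ψ := kMap S.unop.f (𝟙 N)) (fun p q α => ?_) n
    rw [kMap_apply_id_right]
    have hz : barMap S.unop.f (q + 1) ≫ barMap S.unop.g (q + 1) = 0 :=
      hom_ext fun v => (barMap_exact he (q + 1)).apply_apply_eq_zero v
    constructor
    · intro hα
      have := (epi_iff _).2 (barMap_surjective hs (q + 1))
      let T := ShortComplex.mk (barMap S.unop.f (q + 1)) (barMap S.unop.g (q + 1)) hz
      have hT : T.Exact := (exact_iff T).2 (barMap_exact he (q + 1))
      have : Epi T.g := this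
      refine ⟨hT.desc α hα, ?_⟩
      rw [kMap_apply_id_right]
      exact hT.g_desc α hα
    · rintro ⟨β, rfl⟩
      rw [kMap_apply_id_right, ← Category.assoc, hz, Limits.zero_comp]
  · refine dtotMap_injective (φ := kMap S.unop.g (𝟙 N)) (fun p q α β hαβ => ?_) n
    have := (epi_iff _).2 (barMap_surjective hs (q + 1))
    rw [kMap_apply_id_right, kMap_apply_id_right] at hαβ
    exact (cancel_epi _).1 hαβ
  · refine dtotMap_surjective (φ := kMap S.unop.f (𝟙 N)) (fun p q α => ?_) n
    obtain ⟨β, hβ⟩ := exists_tenMap_comp_eq (barMap_injective hi q) α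
    exact ⟨β, (kMap_apply_id_right _ _ _ _).trans hβ⟩

/-- Left exactness of Hom again, with surjectivity supplied by `exists_comp_cotMap_eq`. -/
lemma totFunctor₂_shortExact (M : HopfBimodule k A) (S : ShortComplex (HopfBimodule k A))
    (h : IsShortExact S) : (S.map (totFunctor₂ k A M)).ShortExact := by
  have h' : S.ShortExact := (isShortExact_iff _).1 h
  have hi := (mono_iff S.f).1 h'.mono_f
  have hs := (epi_iff S.g).1 h'.epi_g
  have he := (exact_iff _).1 h'.exact
  refine HomologicalComplex.shortExact_of_degreewise_shortExact _ fun n =>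
    ModuleCat.shortComplex_shortExact _ ?_ ?_ ?_
  · refine dtotMap_exact (φ := kMap (𝟙 M) S.f) (ψ := kMap (𝟙 M) S.g) (fun p q α => ?_) n
    rw [kMap_apply_id_left]
    have hz : cobMap S.f (p + 1) ≫ cobMap S.g (p + 1) = 0 :=
      hom_ext fun v => (cobMap_exact he (p + 1)).apply_apply_eq_zero v
    constructor
    · intro hα
      have := (mono_iff _).2 (cobMap_injective hi (p + 1))
      let T := ShortComplex.mk (cobMap S.f (p + 1)) (cobMap S.g (p + 1)) hz
      have hT : T.Exact := (exact_iff T).2 (cobMap_exact he (p + 1))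
      have : Mono T.f := this
      refine ⟨hT.lift α hα, ?_⟩
      rw [kMap_apply_id_left]
      exact hT.lift_f α hα
    · rintro ⟨β, rfl⟩
      rw [kMap_apply_id_left, Category.assoc, hz, Limits.comp_zero]
  · refine dtotMap_injective (φ := kMap (𝟙 M) S.f) (fun p q α β hαβ => ?_) n
    have := (mono_iff _).2 (cobMap_injective hi (p + 1))
    rw [kMap_apply_id_left, kMap_apply_id_left] at hαβ
    exact (cancel_mono _).1 hαβ
  · refine dtotMap_surjective (φ := kMap (𝟙 M) S.g) (fun p q α => ?_) n
    obtain ⟨β, hβ⟩ := exists_comp_cotMap_eq (cobMap_surjective hs p) α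
    exact ⟨β, (kMap_apply_id_left _ _ _ _).trans hβ⟩

end ShortExact
end HopfBimodule
end CRHopf

/-! ### The long exact sequence of a functor to complexes -/

namespace CRHopf
namespace DeltaData
section
variable {k : Type u} [Field k] {C : Type v} [Category.{w} C] [Preadditive C]
  {E : ShortComplex C → Prop} (F : C ⥤ CochainComplex (ModuleCat.{u} k) ℕ) [F.Additive]

lemma ofComplex_δ {S : ShortComplex C} (h : E S) (hS : (S.map F).ShortExact) (n : ℕ) :
    (ofComplex E F).δ S h n = hS.δ n (n + 1) rfl := dif_pos hS

/-- The long exact cohomology sequence and the naturality of the snake map. The first map is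
injective because no differential enters degree 0. -/
lemma ofComplex_isDeltaFunctor (hF : ∀ S, E S → (S.map F).ShortExact) :
    (ofComplex E F).IsDeltaFunctor where
  additive n := inferInstanceAs (F ⋙ HomologicalComplex.homologyFunctor _ _ n).Additive
  injective S h := by
    have := (hF S h).mono_f
    exact (ModuleCat.mono_iff_injective _).1
      (HomologicalComplex.mono_homologyMap_of_mono_of_not_rel (S.map F).f 0 (by simp))
  exact₂ S h n := (ShortComplex.ShortExact.moduleCat_exact_iff_function_exact _).1
    ((hF S h).homology_exact₂ n)
  exact₃ S h n := by
    rw [ofComplex_δ F h (hF S h)]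
    exact (ShortComplex.ShortExact.moduleCat_exact_iff_function_exact _).1
      ((hF S h).homology_exact₃ n (n + 1) rfl)
  exact₁ S h n := by
    rw [ofComplex_δ F h (hF S h)]
    exact (ShortComplex.ShortExact.moduleCat_exact_iff_function_exact _).1
      ((hF S h).homology_exact₁ n (n + 1) rfl)
  natural S S' h h' τ n := by
    rw [ofComplex_δ F h (hF S h), ofComplex_δ F h' (hF S' h')]
    exact HomologicalComplex.HomologySequence.δ_naturality (F.mapShortComplex.map τ)
      (hF S h) (hF S' h') n (n + 1) rfl

end
end DeltaData

/-! ### Ext as a δ-functor -/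

section Ext
open Abelian
variable {D : Type v} [Category.{w} D] [Abelian D] [HasExt.{u} D] {S S' : ShortComplex D}
  (h : S.ShortExact) (h' : S'.ShortExact)

lemma comp_mk₀_comp_extClass {X : D} {n : ℕ} (y : Ext X S.X₂ n) :
    (y.comp (Ext.mk₀ S.g) (add_zero n)).comp h.extClass (rfl : n + 1 = n + 1) = 0 := by
  rw [Ext.comp_assoc _ _ _ (add_zero n) (zero_add 1) (by omega), h.comp_extClass, Ext.comp_zero]

lemma comp_extClass_comp_mk₀ {X : D} {n : ℕ} (y : Ext X S.X₃ n) :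
    (y.comp h.extClass (rfl : n + 1 = n + 1)).comp (Ext.mk₀ S.f) (add_zero _) = 0 := by
  rw [Ext.comp_assoc _ _ _ rfl (add_zero 1) (by omega), h.extClass_comp, Ext.comp_zero]

lemma comp_extClass_naturality (τ : S ⟶ S') {X : D} {n : ℕ} (x : Ext X S.X₃ n) :
    (x.comp h.extClass (rfl : n + 1 = n + 1)).comp (Ext.mk₀ τ.τ₁) (add_zero _) =
      (x.comp (Ext.mk₀ τ.τ₃) (add_zero n)).comp h'.extClass rfl := by
  rw [Ext.comp_assoc _ _ _ rfl (add_zero 1) (by omega),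
    Ext.comp_assoc _ _ _ (add_zero n) (zero_add 1) (by omega), h.extClass_naturality h']

/-- A map of extensions intertwines the two classes; associativity of the Yoneda product turns this
into naturality of the connecting map in the first variable. -/
lemma extClass_comp_naturality (τ : S ⟶ S') {X : D} {n : ℕ} (x : Ext S'.X₁ X n) :
    (Ext.mk₀ τ.τ₃).comp (h'.extClass.comp x (add_comm 1 n)) (zero_add _) =
      h.extClass.comp ((Ext.mk₀ τ.τ₁).comp x (zero_add n)) (add_comm 1 n) := by
  rw [← Ext.comp_assoc _ _ _ (zero_add 1) (add_comm 1 n) (by omega),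
    ← Ext.comp_assoc _ _ _ (add_zero 1) (zero_add n) (by omega), h.extClass_naturality h']

end Ext

namespace HopfBimodule
section ExtX
variable {k A : Type u} [Field k] [Ring A] [HopfAlgebra k A] [FiniteDimensional k A]

lemma extDelta₁_isDeltaFunctor (N : HopfBimodule k A) : (extDelta₁ N).IsDeltaFunctor where
  additive n := ⟨fun {X Y f g} => by
    refine ModuleCat.hom_ext (LinearMap.ext fun (x : ExtX X.unop N n) => ?_)
    change (Abelian.Ext.mk₀ ((toX k A).map (f.unop + g.unop))).comp x (zero_add n) =
      (Abelian.Ext.mk₀ ((toX k A).map f.unop)).comp x (zero_add n) +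
        (Abelian.Ext.mk₀ ((toX k A).map g.unop)).comp x (zero_add n)
    rw [Functor.map_add, Abelian.Ext.mk₀_add, Abelian.Ext.add_comp]⟩
  injective S h := by
    have := (isShortExact_toX S.unop h).epi_g
    exact Abelian.Ext.precomp_mk₀_injective_of_epi _ (S.unop.map (toX k A)).g
  exact₂ S h n x := by
    constructor
    · intro hx
      obtain ⟨y, hy⟩ := Abelian.Ext.contravariant_sequence_exact₂ (isShortExact_toX S.unop h) _ x hx
      exact ⟨y, hy⟩
    · rintro ⟨y : ExtX S.X₁.unop N n, rfl⟩
      change (Abelian.Ext.mk₀ ((toX k A).map S.g.unop)).comp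
        ((Abelian.Ext.mk₀ ((toX k A).map S.f.unop)).comp y (zero_add n)) (zero_add n) = 0
      rw [Abelian.Ext.mk₀_comp_mk₀_assoc, ← Functor.map_comp, ← unop_comp, S.zero]
      simp
  exact₃ S h n x := by
    constructor
    · intro hx
      obtain ⟨y, hy⟩ := Abelian.Ext.contravariant_sequence_exact₁ (isShortExact_toX S.unop h) _ x
        (add_comm 1 n) hx
      exact ⟨y, hy⟩
    · rintro ⟨y, rfl⟩
      exact (isShortExact_toX S.unop h).extClass_comp_assoc y (h := add_comm 1 n)
  exact₁ S h n x := by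
    constructor
    · intro hx
      obtain ⟨y, hy⟩ := Abelian.Ext.contravariant_sequence_exact₃ (isShortExact_toX S.unop h) _ x hx
        (add_comm 1 n)
      exact ⟨y, hy⟩
    · rintro ⟨y, rfl⟩
      exact (isShortExact_toX S.unop h).comp_extClass_assoc y (add_comm 1 n)
  -- Passing from the opposite category reverses `τ`, so `S'` and `S` exchange their roles.
  natural S S' h h' τ n := ModuleCat.hom_ext (LinearMap.ext fun x =>
    extClass_comp_naturality (isShortExact_toX S'.unop h') (isShortExact_toX S.unop h)
      ((toX k A).mapShortComplex.map (ShortComplex.unopMap τ)) x)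

lemma extDelta₂_isDeltaFunctor (M : HopfBimodule k A) : (extDelta₂ M).IsDeltaFunctor where
  additive n := ⟨fun {X Y f g} => by
    refine ModuleCat.hom_ext (LinearMap.ext fun (x : ExtX M X n) => ?_)
    change x.comp (Abelian.Ext.mk₀ ((toX k A).map (f + g))) (add_zero n) =
      x.comp (Abelian.Ext.mk₀ ((toX k A).map f)) (add_zero n) +
        x.comp (Abelian.Ext.mk₀ ((toX k A).map g)) (add_zero n)
    rw [Functor.map_add, Abelian.Ext.mk₀_add, Abelian.Ext.comp_add]⟩
  injective S h := by
    have := (isShortExact_toX S h).mono_f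
    exact Abelian.Ext.postcomp_mk₀_injective_of_mono _ (S.map (toX k A)).f
  exact₂ S h n x := by
    constructor
    · intro hx
      obtain ⟨y, hy⟩ := Abelian.Ext.covariant_sequence_exact₂ _ (isShortExact_toX S h) x hx
      exact ⟨y, hy⟩
    · rintro ⟨y : ExtX M S.X₁ n, rfl⟩
      change (y.comp (Abelian.Ext.mk₀ ((toX k A).map S.f)) (add_zero n)).comp
        (Abelian.Ext.mk₀ ((toX k A).map S.g)) (add_zero n) = 0
      rw [Abelian.Ext.comp_assoc_of_third_deg_zero,
        Abelian.Ext.mk₀_comp_mk₀, ← Functor.map_comp, S.zero]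
      simp
  exact₃ S h n x := by
    constructor
    · intro hx
      obtain ⟨y, hy⟩ := Abelian.Ext.covariant_sequence_exact₃ _ (isShortExact_toX S h) x rfl hx
      exact ⟨y, hy⟩
    · rintro ⟨y, rfl⟩
      exact comp_mk₀_comp_extClass (isShortExact_toX S h) y
  exact₁ S h n x := by
    constructor
    · intro hx
      obtain ⟨y, hy⟩ := Abelian.Ext.covariant_sequence_exact₁ _ (isShortExact_toX S h) x hx rfl
      exact ⟨y, hy⟩
    · rintro ⟨y, rfl⟩
      exact comp_extClass_comp_mk₀ (isShortExact_toX S h) y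
  natural S S' h h' τ n := ModuleCat.hom_ext (LinearMap.ext fun x =>
    comp_extClass_naturality (isShortExact_toX S h) (isShortExact_toX S' h')
      ((toX k A).mapShortComplex.map τ) x)

end ExtX
end HopfBimodule
end CRHopf

/-! ### Dimension shifting and universality -/

namespace CRHopf
namespace DeltaData
section
variable {k : Type u} [Field k] {C : Type v} [Category.{w} C] [Preadditive C]
  {E : ShortComplex C → Prop}

/-- A short exact sequence `0 ⟶ X ⟶ I ⟶ Q ⟶ 0` to which every map from the first term of a short
exact sequence to `X` extends. -/
structure Effacement (E : ShortComplex C → Prop) (X : C) where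
  {I Q : C}
  i : X ⟶ I
  p : I ⟶ Q
  zero : i ≫ p = 0
  mem : E (ShortComplex.mk i p zero)
  exists_lift : ∀ S : ShortComplex C, E S → ∀ f : S.X₁ ⟶ X,
    ∃ τ : S ⟶ ShortComplex.mk i p zero, τ.τ₁ = f

/-- The sequence is an embedding into an injective followed by its cokernel. Maps extend to the
middle term by injectivity and then pass to the quotients. In the opposite category this covers
projective presentations. -/
lemma nonempty_effacement {C : Type v} [Category.{w} C] [Abelian C] [EnoughInjectives C]
    {E : ShortComplex C → Prop} (hE : ∀ S, E S ↔ S.ShortExact) (X : C) :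
    ∃ e : Effacement E X, Injective e.I := by
  have w := Limits.cokernel.condition (Injective.ι X)
  have hX : (ShortComplex.mk (Injective.ι X) (Limits.cokernel.π (Injective.ι X)) w).ShortExact :=
    { exact := ShortComplex.exact_cokernel _ }
  refine ⟨⟨_, _, w, (hE _).2 hX, fun S hS f => ?_⟩, (inferInstance : Injective (Injective.under X))⟩
  have hS' := (hE S).1 hS
  have := hS'.mono_f
  have := hS'.epi_g
  let t : S.X₂ ⟶ Injective.under X := Injective.factorThru (f ≫ Injective.ι X) S.f
  have ht : S.f ≫ t = f ≫ Injective.ι X := Injective.comp_factorThru _ _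
  have ht' : S.f ≫ t ≫ Limits.cokernel.π (Injective.ι X) = 0 := by
    rw [← Category.assoc, ht, Category.assoc, w, Limits.comp_zero]
  exact ⟨⟨f, t, hS'.exact.desc _ ht', ht.symm, (hS'.exact.g_desc _ ht').symm⟩, rfl⟩

variable {D D' : DeltaData k E}

lemma IsDeltaFunctor.δ_surjective (hD : D.IsDeltaFunctor) {S : ShortComplex C} (h : E S) (n : ℕ)
    (h0 : Subsingleton ((D.T (n + 1)).obj S.X₂)) : Function.Surjective (D.δ S h n) :=
  fun x => (hD.exact₁ S h n x).1 (Subsingleton.elim _ _)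

lemma IsDeltaFunctor.δ_map (hD : D.IsDeltaFunctor) {S S' : ShortComplex C} (h : E S) (h' : E S')
    (τ : S ⟶ S') (n : ℕ) (y : (D.T n).obj S.X₃) :
    (D.T (n + 1)).map τ.τ₁ (D.δ S h n y) = D.δ S' h' n ((D.T n).map τ.τ₃ y) :=
  ConcreteCategory.congr_hom (hD.natural S S' h h' τ n) y

omit [Preadditive C] in
lemma app_map {T T' : C ⥤ ModuleCat.{u} k} (φ : T ⟶ T') {X Y : C} (f : X ⟶ Y) (x : T.obj X) :
    φ.app Y (T.map f x) = T'.map f (φ.app X x) :=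
  ConcreteCategory.congr_hom (φ.naturality f) x

section
variable (hD : D.IsDeltaFunctor) (hD' : D'.IsDeltaFunctor) {n : ℕ} (φ : D.T n ⟶ D'.T n)
include hD hD'

/-- As `δ` is onto with kernel the image of `Tⁿ(S.X₂)`, the rule `δ y ↦ δ' (φ y)` is well defined:
`φ` carries that image to the corresponding one for `D'`, which `δ'` kills. -/
lemma exists_app_succ {S : ShortComplex C} (h : E S) (h0 : Subsingleton ((D.T (n + 1)).obj S.X₂)) :
    ∃ ψ : (D.T (n + 1)).obj S.X₁ ⟶ (D'.T (n + 1)).obj S.X₁,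
      ∀ y, ψ (D.δ S h n y) = D'.δ S h n (φ.app S.X₃ y) := by
  -- Over a field `δ` has a linear section, which defines `ψ` without passing to a quotient.
  obtain ⟨s, hs⟩ := (D.δ S h n).hom.exists_rightInverse_of_surjective
    (LinearMap.range_eq_top.2 (hD.δ_surjective h n h0))
  refine ⟨ModuleCat.ofHom ((D'.δ S h n).hom ∘ₗ (φ.app S.X₃).hom ∘ₗ s), fun y => ?_⟩
  have h1 : D.δ S h n (s (D.δ S h n y) - y) = 0 := by
    rw [map_sub, sub_eq_zero]
    exact LinearMap.congr_fun hs _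
  obtain ⟨z, hz⟩ := (hD.exact₃ S h n _).1 h1
  have h2 : D'.δ S h n (φ.app S.X₃ (s (D.δ S h n y) - y)) = 0 := by
    rw [← hz, app_map]
    exact (hD'.exact₃ S h n).apply_apply_eq_zero _
  rw [map_sub, map_sub, sub_eq_zero] at h2
  exact h2

variable (eff : ∀ X : C, Effacement E X)
  (h0 : ∀ X n, Subsingleton ((D.T (n + 1)).obj (eff X).I))
include h0

/-- Naturality of `ψ` and its compatibility with `δ` are two cases of `key`: the first takes `S` to
be the chosen sequence of the source, the second takes the identity for `f`. -/
lemma exists_succ : ∃ ψ : D.T (n + 1) ⟶ D'.T (n + 1), ∀ S (h : E S),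
    D.δ S h n ≫ ψ.app S.X₁ = φ.app S.X₃ ≫ D'.δ S h n := by
  choose ψ hψ using fun X => exists_app_succ hD hD' φ (eff X).mem (h0 X n)
  have key : ∀ S (h : E S) {Y : C} (f : S.X₁ ⟶ Y) y, ψ Y ((D.T (n + 1)).map f (D.δ S h n y)) =
      (D'.T (n + 1)).map f (D'.δ S h n (φ.app S.X₃ y)) := by
    intro S h Y f y
    -- Extending `f` to a map into the chosen sequence of `Y` reduces the claim to naturality of
    -- both connecting maps and the defining property of `ψ`.
    obtain ⟨τ, rfl⟩ := (eff Y).exists_lift S h f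
    rw [hD.δ_map h (eff Y).mem τ, hD'.δ_map h (eff Y).mem τ, hψ, app_map]
  refine ⟨{ app := ψ, naturality := fun X Y f => ?_ }, fun S h => ?_⟩
  · refine ModuleCat.hom_ext (LinearMap.ext fun x => ?_)
    obtain ⟨y, rfl⟩ := hD.δ_surjective (eff X).mem n (h0 X n) x
    exact (key _ (eff X).mem f y).trans (congrArg _ (hψ X y).symm)
  · refine ModuleCat.hom_ext (LinearMap.ext fun y => ?_)
    exact (congrArg (ψ S.X₁) (ConcreteCategory.congr_hom ((D.T (n + 1)).map_id S.X₁) _).symm).trans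
      ((key S h (𝟙 _) y).trans (ConcreteCategory.congr_hom ((D'.T (n + 1)).map_id S.X₁) _))

/-- Both sides in degree `n + 1` are the cokernel of `Tⁿ(I) ⟶ Tⁿ(Q)`, and `φ` identifies the two
cokernels. -/
lemma isIso_succ (h0' : ∀ X n, Subsingleton ((D'.T (n + 1)).obj (eff X).I)) [IsIso φ]
    (ψ : D.T (n + 1) ⟶ D'.T (n + 1))
    (hψ : ∀ S (h : E S), D.δ S h n ≫ ψ.app S.X₁ = φ.app S.X₃ ≫ D'.δ S h n) : IsIso ψ := by
  have hφ : ∀ X, Function.Bijective (φ.app X) := fun X =>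
    (ConcreteCategory.isIso_iff_bijective (φ.app X)).1 inferInstance
  have hψ' : ∀ S (h : E S) y, ψ.app S.X₁ (D.δ S h n y) = D'.δ S h n (φ.app S.X₃ y) :=
    fun S h y => ConcreteCategory.congr_hom (hψ S h) y
  have : ∀ X, IsIso (ψ.app X) := fun X => by
    refine (ConcreteCategory.isIso_iff_bijective (ψ.app X)).2 ⟨?_, fun x => ?_⟩
    · refine (injective_iff_map_eq_zero (ψ.app X).hom).2 fun x hx => ?_
      obtain ⟨y, rfl⟩ := hD.δ_surjective (eff X).mem n (h0 X n) x
      have hx' := (hψ' _ (eff X).mem y).symm.trans hx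
      obtain ⟨z, hz⟩ := (hD'.exact₃ _ (eff X).mem n _).1 hx'
      obtain ⟨z, rfl⟩ := (hφ _).2 z
      rw [← app_map] at hz
      exact (hD.exact₃ _ (eff X).mem n _).2 ⟨z, (hφ _).1 hz⟩
    · obtain ⟨y, rfl⟩ := hD'.δ_surjective (eff X).mem n (h0' X n) x
      obtain ⟨y, rfl⟩ := (hφ _).2 y
      exact ⟨D.δ _ (eff X).mem n y, hψ' _ (eff X).mem y⟩
  exact NatIso.isIso_of_isIso_app ψ

omit hD' in
-- Each class of degree `n + 1` is a `δ y` for the chosen sequence, so its image is forced by degree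
-- `n`. Only the source has to be effaceable.
lemma hom_eq_of_app_zero_eq {φ ψ : Hom D D'} (h : φ.app 0 = ψ.app 0) : φ = ψ := by
  refine Hom.ext (funext fun n => ?_)
  induction n with
  | zero => exact h
  | succ n ih =>
    refine NatTrans.ext (funext fun X => ModuleCat.hom_ext (LinearMap.ext fun x => ?_))
    obtain ⟨y, rfl⟩ := hD.δ_surjective (eff X).mem n (h0 X n) x
    have h1 := ConcreteCategory.congr_hom (φ.comm _ (eff X).mem n) y
    have h2 := ConcreteCategory.congr_hom (ψ.comm _ (eff X).mem n) y
    rw [ih] at h1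
    exact h1.trans h2.symm

lemma exists_hom (φ₀ : D.T 0 ⟶ D'.T 0) : ∃ φ : Hom D D', φ.app 0 = φ₀ := by
  choose step hstep using fun n (φ : D.T n ⟶ D'.T n) => exists_succ hD hD' φ eff h0
  let app : ∀ n, D.T n ⟶ D'.T n := fun n => Nat.rec φ₀ step n
  exact ⟨⟨app, fun S h n => hstep n (app n) S h⟩, rfl⟩

lemma isIso_app (h0' : ∀ X n, Subsingleton ((D'.T (n + 1)).obj (eff X).I)) (φ : Hom D D')
    (h : IsIso (φ.app 0)) : ∀ n, IsIso (φ.app n)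
  | 0 => h
  | n + 1 => by
    have := isIso_app h0' φ h n
    exact isIso_succ hD hD' (φ.app n) eff h0 h0' _ fun S h => φ.comm S h n

end
end
end DeltaData
end CRHopf

/-! ### Comparison of the two theories -/

namespace CRHopf
namespace HopfBimodule
section Comparison
variable {k A : Type u} [Field k] [Ring A] [HopfAlgebra k A]

lemma augTot_nat {M M' N N' : HopfBimodule k A} (f : M' ⟶ M) (g : N ⟶ N') (β : M ⟶ N) :
    totMap f g 0 (augTot M N β) = augTot M' N' (f ≫ β ≫ g) := by
  funext ⟨⟨p, q⟩, h⟩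
  dsimp only at h
  obtain rfl : p = 0 := by omega
  obtain rfl : q = 0 := by omega
  let β' : barObj M 0 ⟶ cobObj N 0 := β
  change barMap f 1 ≫ (barD M 0 ≫ β' ≫ cobD N 0) ≫ cobMap g 1 =
    barD M' 0 ≫ (barMap f 0 ≫ β' ≫ cobMap g 0) ≫ cobD N' 0
  simp only [Category.assoc]
  rw [← Category.assoc, barD_nat, cobD_nat, Category.assoc]

omit [Ring A] [HopfAlgebra k A] in
lemma liftCycles_homologyπ_nat {K L : CochainComplex (ModuleCat.{u} k) ℕ} (φ : K ⟶ L)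
    {V W : ModuleCat.{u} k} {a : V ⟶ K.X 0} {b : W ⟶ L.X 0} {c : V ⟶ W} (h : a ≫ φ.f 0 = c ≫ b)
    (hi) (ha : a ≫ K.d 0 1 = 0) (hb : b ≫ L.d 0 1 = 0) :
    (K.liftCycles a 1 hi ha ≫ K.homologyπ 0) ≫ HomologicalComplex.homologyMap φ 0 =
      c ≫ L.liftCycles b 1 hi hb ≫ L.homologyπ 0 := by
  simp [h, HomologicalComplex.comp_liftCycles_assoc]

/-- The bar and cobar differentials are natural, so composing `β` with `f` and `g` matches the
induced map on the degree-zero cocycles. -/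
lemma homToH_nat {M M' N N' : HopfBimodule k A} (f : M' ⟶ M) (g : N ⟶ N') (β : M ⟶ N) :
    HomologicalComplex.homologyMap (totComplexMap k A f g) 0 (homToH M N β) =
      homToH M' N' (f ≫ β ≫ g) := by
  let c : ModuleCat.of k (M ⟶ N) ⟶ ModuleCat.of k (M' ⟶ N') :=
    ModuleCat.ofHom (Linear.leftComp k _ f ∘ₗ Linear.rightComp k _ g)
  have h : homToH M N ≫ HomologicalComplex.homologyMap (totComplexMap k A f g) 0 =
      c ≫ homToH M' N' :=
    liftCycles_homologyπ_nat _ (ModuleCat.hom_ext (LinearMap.ext (augTot_nat f g))) _ _ _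
  exact ConcreteCategory.congr_hom h β

variable [FiniteDimensional k A]

/-- The isomorphism of `Hom_{A4}(M, N)` with `Ext_X⁰(M, N)`. -/
noncomputable def homEquivExt (M N : HopfBimodule k A) : (M ⟶ N) ≃ₗ[k] ExtX M N 0 :=
  LinearEquiv.ofBijective
    { toFun β := Abelian.Ext.mk₀ ((toX k A).map β)
      map_add' β β' := by rw [Functor.map_add, Abelian.Ext.mk₀_add]
      map_smul' c β := by rw [Functor.map_smul, Abelian.Ext.mk₀_smul]; rfl }
    ((Abelian.Ext.mk₀_bijective _ _).comp
      ((Functor.FullyFaithful.ofFullyFaithful (toX k A)).map_bijective M N))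

/-- The isomorphism of `H_{A4}⁰(M, N)` with `Ext_X⁰(M, N)`. -/
noncomputable def hEquivExt (M N : HopfBimodule k A) : hopfCohomology M N 0 ≃ₗ[k] ExtX M N 0 :=
  (LinearEquiv.ofBijective (homToH M N).hom (homToH_bijective M N)).symm ≪≫ₗ homEquivExt M N

lemma hEquivExt_homToH (M N : HopfBimodule k A) (β : M ⟶ N) :
    hEquivExt M N (homToH M N β) = Abelian.Ext.mk₀ ((toX k A).map β) :=
  congrArg (homEquivExt M N)
    ((LinearEquiv.ofBijective (homToH M N).hom (homToH_bijective M N)).symm_apply_apply β)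

/-- Every class of degree 0 comes from a morphism, for which both sides are the class of `f ≫ β ≫
g`. -/
lemma hEquivExt_nat {M M' N N' : HopfBimodule k A} (f : M' ⟶ M) (g : N ⟶ N')
    (x : hopfCohomology M N 0) :
    hEquivExt M' N' (HomologicalComplex.homologyMap (totComplexMap k A f g) 0 x) =
      (Abelian.Ext.mk₀ ((toX k A).map f)).comp
        ((hEquivExt M N x).comp (Abelian.Ext.mk₀ ((toX k A).map g)) (add_zero 0)) (zero_add 0) := by
  obtain ⟨β, rfl⟩ := (homToH_bijective M N).2 x
  rw [homToH_nat, hEquivExt_homToH, hEquivExt_homToH]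
  simp

/-- The comparison map in degree `0`, for fixed `N`. -/
noncomputable def zeroHom₁ (N : HopfBimodule k A) : (hopfDelta₁ N).T 0 ⟶ (extDelta₁ N).T 0 where
  app M := ModuleCat.ofHom (hEquivExt M.unop N).toLinearMap
  naturality M M' f := ModuleCat.hom_ext (LinearMap.ext fun x => by
    refine (hEquivExt_nat f.unop (𝟙 N) x).trans ?_
    rw [CategoryTheory.Functor.map_id, Abelian.Ext.comp_mk₀_id]
    rfl)

/-- The comparison map in degree `0`, for fixed `M`. -/
noncomputable def zeroHom₂ (M : HopfBimodule k A) : (hopfDelta₂ M).T 0 ⟶ (extDelta₂ M).T 0 where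
  app N := ModuleCat.ofHom (hEquivExt M N).toLinearMap
  naturality N N' g := ModuleCat.hom_ext (LinearMap.ext fun x => by
    refine (hEquivExt_nat (𝟙 M) g x).trans ?_
    rw [CategoryTheory.Functor.map_id, Abelian.Ext.mk₀_id_comp]
    rfl)

lemma isIso_zeroHom₁ (N : HopfBimodule k A) : IsIso (zeroHom₁ N) := by
  have : ∀ M, IsIso ((zeroHom₁ N).app M) := fun M =>
    (ConcreteCategory.isIso_iff_bijective ((zeroHom₁ N).app M)).2 (hEquivExt M.unop N).bijective
  exact NatIso.isIso_of_isIso_app _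

lemma isIso_zeroHom₂ (M : HopfBimodule k A) : IsIso (zeroHom₂ M) := by
  have : ∀ N, IsIso ((zeroHom₂ M).app N) := fun N =>
    (ConcreteCategory.isIso_iff_bijective ((zeroHom₂ M).app N)).2 (hEquivExt M N).bijective
  exact NatIso.isIso_of_isIso_app _

/-- Since `homToH` is onto, the normalisation on morphisms fixes the whole degree-zero component;
uniqueness in the theorem thus becomes uniqueness of an extension from degree 0. -/
lemma ExtendsId₁.app_zero {N : HopfBimodule k A} {φ : DeltaData.Hom (hopfDelta₁ N) (extDelta₁ N)}
    (h : ExtendsId₁ φ) : φ.app 0 = zeroHom₁ N := by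
  refine NatTrans.ext (funext fun M => ModuleCat.hom_ext (LinearMap.ext fun x => ?_))
  obtain ⟨β, rfl⟩ := (homToH_bijective M.unop N).2 x
  exact (h M.unop β).trans (hEquivExt_homToH M.unop N β).symm

lemma ExtendsId₂.app_zero {M : HopfBimodule k A} {φ : DeltaData.Hom (hopfDelta₂ M) (extDelta₂ M)}
    (h : ExtendsId₂ φ) : φ.app 0 = zeroHom₂ M := by
  refine NatTrans.ext (funext fun N => ModuleCat.hom_ext (LinearMap.ext fun x => ?_))
  obtain ⟨β, rfl⟩ := (homToH_bijective M N).2 x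
  exact (h N β).trans (hEquivExt_homToH M N β).symm

lemma isShortExactOp_iff (S : ShortComplex (HopfBimodule k A)ᵒᵖ) :
    IsShortExactOp k A S ↔ S.ShortExact :=
  (isShortExact_iff S.unop).trans ⟨fun h => h.op, fun h => h.unop⟩

lemma hopfDelta₁_isDeltaFunctor (N : HopfBimodule k A) : (hopfDelta₁ N).IsDeltaFunctor :=
  DeltaData.ofComplex_isDeltaFunctor _ (totFunctor₁_shortExact N)

lemma hopfDelta₂_isDeltaFunctor (M : HopfBimodule k A) : (hopfDelta₂ M).IsDeltaFunctor :=
  DeltaData.ofComplex_isDeltaFunctor _ (totFunctor₂_shortExact M)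

theorem existsUnique_hom₁ (N : HopfBimodule k A) :
    ∃ φ : DeltaData.Hom (hopfDelta₁ N) (extDelta₁ N),
      ExtendsId₁ φ ∧ (∀ n, IsIso (φ.app n)) ∧ ∀ ψ, ExtendsId₁ ψ → ψ = φ := by
  -- Injectives of the opposite category are projective Hopf bimodules, on which both theories
  -- vanish in positive degrees in the first variable.
  choose eff heff using DeltaData.nonempty_effacement (isShortExactOp_iff (k := k) (A := A))
  have h0 : ∀ X n, Subsingleton (((hopfDelta₁ N).T (n + 1)).obj (eff X).I) := fun X n =>
    have := heff X
    hopfCohomology_subsingleton_of_projective (eff X).I.unop N n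
  have h0' : ∀ X n, Subsingleton (((extDelta₁ N).T (n + 1)).obj (eff X).I) := fun X n =>
    have := heff X
    Abelian.Ext.subsingleton_of_projective ((toX k A).obj (eff X).I.unop) _ n
  have hD := hopfDelta₁_isDeltaFunctor N
  have hD' := extDelta₁_isDeltaFunctor N
  obtain ⟨φ, hφ⟩ := DeltaData.exists_hom hD hD' eff h0 (zeroHom₁ N)
  have hφ' : ExtendsId₁ φ := fun M β => by rw [hφ]; exact hEquivExt_homToH M N β
  exact ⟨φ, hφ', DeltaData.isIso_app hD hD' eff h0 h0' φ (hφ ▸ isIso_zeroHom₁ N), fun ψ hψ =>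
    DeltaData.hom_eq_of_app_zero_eq hD eff h0 (hψ.app_zero.trans hφ.symm)⟩

theorem existsUnique_hom₂ (M : HopfBimodule k A) :
    ∃ φ : DeltaData.Hom (hopfDelta₂ M) (extDelta₂ M),
      ExtendsId₂ φ ∧ (∀ n, IsIso (φ.app n)) ∧ ∀ ψ, ExtendsId₂ ψ → ψ = φ := by
  choose eff heff using DeltaData.nonempty_effacement (isShortExact_iff (k := k) (A := A))
  have h0 : ∀ X n, Subsingleton (((hopfDelta₂ M).T (n + 1)).obj (eff X).I) := fun X n =>
    have := heff X
    hopfCohomology_subsingleton_of_injective M (eff X).I n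
  have h0' : ∀ X n, Subsingleton (((extDelta₂ M).T (n + 1)).obj (eff X).I) := fun X n =>
    have := heff X
    Abelian.Ext.subsingleton_of_injective _ ((toX k A).obj (eff X).I) n
  have hD := hopfDelta₂_isDeltaFunctor M
  have hD' := extDelta₂_isDeltaFunctor M
  obtain ⟨φ, hφ⟩ := DeltaData.exists_hom hD hD' eff h0 (zeroHom₂ M)
  have hφ' : ExtendsId₂ φ := fun N β => by rw [hφ]; exact hEquivExt_homToH M N β
  exact ⟨φ, hφ', DeltaData.isIso_app hD hD' eff h0 h0' φ (hφ ▸ isIso_zeroHom₂ M), fun ψ hψ =>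
    DeltaData.hom_eq_of_app_zero_eq hD eff h0 (hψ.app_zero.trans hφ.symm)⟩

end Comparison
end HopfBimodule
end CRHopf

open CRHopf CRHopf.HopfBimodule
theorem mainTheorem1 {k A : Type u} [Field k] [Ring A] [HopfAlgebra k A] [FiniteDimensional k A] :
    (∀ M N : HopfBimodule k A, Function.Bijective (homToH M N)) ∧
    (∀ N : HopfBimodule k A,
      (∀ S : ShortComplex (HopfBimodule k A)ᵒᵖ, IsShortExactOp k A S →
        (S.map (totFunctor₁ k A N)).ShortExact) ∧
      (hopfDelta₁ N).IsDeltaFunctor ∧ (extDelta₁ N).IsDeltaFunctor ∧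
      ∃ φ : DeltaData.Hom (hopfDelta₁ N) (extDelta₁ N),
        ExtendsId₁ φ ∧ (∀ n, IsIso (φ.app n)) ∧ ∀ ψ, ExtendsId₁ ψ → ψ = φ) ∧
    (∀ M : HopfBimodule k A,
      (∀ S : ShortComplex (HopfBimodule k A), IsShortExact S →
        (S.map (totFunctor₂ k A M)).ShortExact) ∧
      (hopfDelta₂ M).IsDeltaFunctor ∧ (extDelta₂ M).IsDeltaFunctor ∧
      ∃ φ : DeltaData.Hom (hopfDelta₂ M) (extDelta₂ M),
        ExtendsId₂ φ ∧ (∀ n, IsIso (φ.app n)) ∧ ∀ ψ, ExtendsId₂ ψ → ψ = φ) :=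
  ⟨fun M N => homToH_bijective M N,
    fun N => ⟨totFunctor₁_shortExact N, hopfDelta₁_isDeltaFunctor N, extDelta₁_isDeltaFunctor N,
      existsUnique_hom₁ N⟩,
    fun M => ⟨totFunctor₂_shortExact M, hopfDelta₂_isDeltaFunctor M, extDelta₂_isDeltaFunctor M,
      existsUnique_hom₂ M⟩⟩
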